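/- **Setting.** Let $M$ be a smooth manifold of dimension $2m+1$, and let $(H,J)$ be an almost CR-structure on $M$: $H\subset TM$ is a smooth subbundle of rank $2m$ and $J$ a smooth complex structure on $H$. Equivalently, it is the complex subbundle $T_{10}=\{X-iJX : X\in H\}$ of $TM\otimes\mathbb C$; put $T_{01}=\overline{T_{10}}$. Assume that $(H,J)$ is partially integrable, i.e. $[X,Y]-[JX,JY]\in\Gamma(H)$ for all (local) $X,Y\in\Gamma(H)$. A *pseudo-Hermitian form* is a smooth nowhere vanishing real $1$-form $\theta$ on $M$ with $\theta|_H=0$ such that $d\theta(\cdot,J\cdot)$ is positive definite on $H$ (its existence means that the structure is strictly pseudoconvex). Let $T$ be its Reeb field, $\theta(T)=1$, $d\theta(T,\cdot)=0$, and let $L_\theta$ be the symmetric bilinear form on $TM$ with $L_\theta(X,Y)=d\theta(X,JY)$ on $H$ and $L_\theta(T,\cdot)=0$. The Tanaka–Webster connection $\nabla$ of $\theta$ is the unique linear connection on $TM$ which preserves $H$, satisfies $\nabla J=0$ on $H$, $\nabla T=0$ and $X(L_\theta(Y,Z))=L_\theta(\nabla_XY,Z)+L_\theta(Y,\nabla_XZ)$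 for $Y,Z\in\Gamma(H)$, and whose torsion satisfies $$\mathrm{Tor}(X,Y)=L_\theta(JX,Y)\,T-\tfrac14\big([X,Y]-[JX,JY]+J[JX,Y]+J[X,JY]\big),\qquad \mathrm{Tor}(T,X)=-\tfrac12\big([T,X]+J[T,JX]\big)$$ for $X,Y\in\Gamma(H)$. With $R(X,Y)=[\nabla_X,\nabla_Y]-\nabla_{[X,Y]}$ and a basis $(e_1,Je_1,\dots,e_m,Je_m)$ of $H$ orthonormal for $L_\theta$, put $$\mathrm{Ric}(X,Y)=i\sum_{\alpha}L_\theta(R(X,Y)e_\alpha,Je_\alpha),\qquad \mathrm{scal}=i\sum_\alpha \mathrm{Ric}(e_\alpha,Je_\alpha)\in\mathbb R .$$ Let $\Lambda^{m+1,0}M$ be the complex line bundle of complex $(m+1)$-forms annihilated by contraction with every element of $T_{01}$, and let $\pi:F_c=(\Lambda^{m+1,0}M\setminus 0)/\mathbb R^+\to M$ be the canonical circle bundle. Let $A^W:TF_c\to i\mathbb R$ be the connection form on $F_c$ induced by $\nabla$: for a local nowhere vanishing section $\sigma$ of $\Lambda^{m+1,0}M$ with $\nabla\sigma=\alpha\otimes\sigma$,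 $[\sigma]^*A^W=i\,\mathrm{Im}\,\alpha$. Put $A_\theta=A^W-\frac{i}{2(m+1)}\,\mathrm{scal}\;\pi^*\theta$. The *Fefferman metric* of $\theta$ is the symmetric $2$-tensor on $F_c$ $$f_\theta=\pi^*L_\theta-i\,\frac{4}{m+2}\,\pi^*\theta\circ A_\theta ,\qquad a\circ b:=\tfrac12(a\otimes b+b\otimes a).$$ For a smooth $1$-form $\ell\in\Omega^1(M;i\mathbb R)$ with purely imaginary values, the *$\ell$-Fefferman metric* is $$f_{\theta,\ell}=\pi^*L_\theta-i\,\frac{4}{m+2}\,\pi^*\theta\circ(A_\theta+\pi^*\ell).$$ **Theorem.** Let $(H,J)$ be a partially integrable almost CR-structure on $M$. 1. If $f$ is a smooth real function on $M$ and $\theta$, $\tilde\theta=e^{2f}\theta$ are pseudo-Hermitian forms, then $f_{\tilde\theta}=e^{2f}f_\theta$ on $F_c$ (with $f$ lifted to $F_c$), and $f_{\tilde\theta,\ell}=e^{2f}f_{\theta,\ell}$ for every $\ell\in\Omega^1(M;i\mathbb R)$. 2. Consequently, if $m\ge 1$, the conformal class $\{e^{2\varphi}f_\theta:\varphi\in C^\infty(F_c,\mathbb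 R)\}$ is the same for all pseudo-Hermitian forms $\theta$, so it is an invariant of the CR-structure $T_{10}$; and for each $\ell\in\Omega^1(M;i\mathbb R)$ the conformal class $\{e^{2\varphi}f_{\theta,\ell}:\varphi\in C^\infty(F_c,\mathbb R)\}$ is the same for all $\theta$, so it is an invariant of the pair $(T_{10},\ell)$. -/

import Mathlib

open scoped Manifold ContDiff Bundle Topology
open Bundle

noncomputable section
namespace CR

theorem form_eq_zero {m : ℕ} {V : Type*} [AddCommGroup V] [Module ℝ V] (H : Submodule ℝ V)
    (J : V →ₗ[ℝ] V) (b : Module.Basis (Option (Fin m ⊕ Fin m)) ℝ V)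
    (hH : ∀ α, b (some (Sum.inl α)) ∈ H)
    (hJ : ∀ α, b (some (Sum.inr α)) = J (b (some (Sum.inl α))))
    (ρ : AlternatingMap ℝ V ℂ (Fin (m + 1)))
    (hρ : ∀ v ∈ H, ∀ Y : Fin m → V,
      ρ (Fin.cons v Y) + Complex.I * ρ (Fin.cons (J v) Y) = 0)
    (h0 : ρ (Fin.cons (b none) (fun α => b (some (Sum.inl α)))) = 0) : ρ = 0 := by
  have slot : ∀ (i : Fin (m + 1)) (w : Fin (m + 1) → V), ∀ v ∈ H,
      ρ (Function.update w i (J v)) = Complex.I * ρ (Function.update w i v) := by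
    intro i w v hv
    have key : ∀ u : V, ρ (Function.update w i u) =
        Equiv.Perm.sign (Equiv.swap 0 i) •
          ρ (Fin.cons u (Fin.tail (fun j => w (Equiv.swap 0 i j)))) := by
      intro u
      rw [← AlternatingMap.map_perm]
      congr 1
      funext j
      simp only [Function.comp]
      by_cases hj : j = i
      · subst hj; simp
      · rw [Function.update_of_ne hj]
        have hne : Equiv.swap 0 i j ≠ 0 := by
          intro h
          apply hj
          have := congrArg (Equiv.swap 0 i) h
          simpa using this
        obtain ⟨k, hk⟩ := Fin.exists_succ_eq.mpr hne
        rw [← hk, Fin.cons_succ, Fin.tail, hk]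
        simp
    rw [key, key]
    have h := hρ v hv (Fin.tail (fun j => w (Equiv.swap 0 i j)))
    have h' : ρ (Fin.cons (J v) (Fin.tail (fun j => w (Equiv.swap 0 i j)))) =
        Complex.I * ρ (Fin.cons v (Fin.tail (fun j => w (Equiv.swap 0 i j)))) := by
      linear_combination (-Complex.I) * h + (ρ (Fin.cons (J v)
        (Fin.tail (fun j => w (Equiv.swap 0 i j))))) * Complex.I_mul_I
    rw [h', mul_smul_comm]
  let f : Fin (m + 1) → V := Fin.cons (b none) (fun α => b (some (Sum.inl α)))
  let red : Option (Fin m ⊕ Fin m) → Fin (m + 1) := fun o =>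
    match o with
    | none => 0
    | some (Sum.inl α) => α.succ
    | some (Sum.inr α) => α.succ
  refine Module.Basis.ext_alternating b (fun κ _ => ?_)
  have claim : ∀ s : Finset (Fin (m + 1)), ∃ c : ℂ, ρ (fun j => b (κ j)) =
      c * ρ (fun j => if j ∈ s then f (red (κ j)) else b (κ j)) := by
    intro s
    induction s using Finset.induction_on with
    | empty => exact ⟨1, by simp⟩
    | insert i s hi ih =>
      obtain ⟨c, hc⟩ := ih
      set w : Fin (m + 1) → V := fun j => if j ∈ s then f (red (κ j)) else b (κ j) with hw
      have e1 : w = Function.update w i (b (κ i)) := by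
        rw [eq_comm, Function.update_eq_self_iff]; simp [hw, hi]
      have e2 : (fun j => if j ∈ insert i s then f (red (κ j)) else b (κ j)) =
          Function.update w i (f (red (κ i))) := by
        funext j
        by_cases hj : j = i
        · subst hj; simp
        · rw [Function.update_of_ne hj]; simp [hw, hj]
      rw [e2, hc, e1]
      rcases hκ : κ i with _ | (α | α)
      · exact ⟨c, by simp [f, red]⟩
      · exact ⟨c, by simp [f, red]⟩
      · refine ⟨c * Complex.I, ?_⟩
        rw [hJ, slot i _ _ (hH α)]
        simp [f, red, mul_assoc]
  obtain ⟨c, hc⟩ := claim Finset.univ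
  rw [hc]
  simp only [Finset.mem_univ, if_true, AlternatingMap.zero_apply, mul_eq_zero]
  right
  by_cases hinj : Function.Injective (fun j => red (κ j))
  · have hb : Function.Bijective (fun j => red (κ j)) := Finite.injective_iff_bijective.mp hinj
    have := ρ.map_perm f (Equiv.ofBijective _ hb)
    rw [show (fun j => f (red (κ j))) = f ∘ (Equiv.ofBijective _ hb) from rfl, this, h0, smul_zero]
  · apply ρ.map_eq_zero_of_not_injective
    intro h
    apply hinj
    intro j k hjk
    exact h (congrArg f hjk)

/-- The direction `c / |c|` of a nonzero complex number, as a point of the unit circle. -/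
def phase (c : ℂ) : Circle := Circle.exp c.arg

theorem norm_mul_phase (c : ℂ) : (‖c‖ : ℂ) * (phase c : ℂ) = c := by
  simp [phase, Circle.coe_exp]

theorem phase_smul {r : ℝ} (hr : 0 < r) (c : ℂ) : phase (r • c) = phase c := by
  simp [phase, Complex.real_smul, Complex.arg_real_mul c hr]

theorem phase_mul {a b : ℂ} (ha : a ≠ 0) (hb : b ≠ 0) : phase (a * b) = phase a * phase b := by
  simp only [phase]
  rw [← Circle.exp_add]
  exact (Circle.exp_eq_exp.2) (by
    have := Complex.arg_mul_coe_angle ha hb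
    rw [← Real.Angle.coe_add, Real.Angle.angle_eq_iff_two_pi_dvd_sub] at this
    obtain ⟨k, hk⟩ := this
    exact ⟨k, by linarith⟩)

theorem phase_coe (z : Circle) : phase (z : ℂ) = z := by
  simp [phase, Circle.exp_arg]

theorem phase_eq (c : ℂ) (hc : c ≠ 0) : (phase c : ℂ) = c / ‖c‖ := by
  have := norm_mul_phase c
  have hn : (‖c‖ : ℂ) ≠ 0 := by simpa using hc
  field_simp
  rw [mul_comm]; exact this

theorem continuousOn_phase : ContinuousOn phase {0}ᶜ := by
  have hi : Topology.IsInducing (fun z : Circle => (z : ℂ)) := Topology.IsInducing.subtypeVal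
  rw [hi.continuousOn_iff]
  refine ContinuousOn.congr (f := fun c : ℂ => c / ‖c‖) ?_ (fun c hc => phase_eq c hc)
  refine ContinuousOn.div continuousOn_id (by fun_prop) ?_
  intro c hc; simpa using hc


theorem contMDiffAt_frameCoeff {E : Type*} [NormedAddCommGroup E] [NormedSpace ℝ E]
    [FiniteDimensional ℝ E] {H : Type*} [TopologicalSpace H] {I : ModelWithCorners ℝ E H}
    {M : Type*} [TopologicalSpace M] [ChartedSpace H M] [IsManifold I ∞ M]
    {ι : Type*} [Fintype ι] {s : ι → ∀ x : M, TangentSpace I x} {u : Set M}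
    (hs : IsLocalFrameOn I E ∞ s u) {x : M} (hu : u ∈ 𝓝 x)
    {t : ∀ x : M, TangentSpace I x}
    (ht : ContMDiffAt I (I.prod 𝓘(ℝ, E)) ∞ (fun y => TotalSpace.mk' E y (t y)) x) (i : ι) :
    ContMDiffAt I 𝓘(ℝ, ℝ) ∞ (fun y => hs.coeff i y (t y)) x := by
  let e := trivializationAt E (TangentSpace I : M → Type _) x
  have hx : x ∈ e.baseSet := mem_baseSet_trivializationAt _ _ _
  have hsec : ∀ v : ∀ x : M, TangentSpace I x,
      ContMDiffAt I (I.prod 𝓘(ℝ, E)) ∞ (fun y => TotalSpace.mk' E y (v y)) x →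
      ContMDiffAt I 𝓘(ℝ, E) ∞ (fun y => e.continuousLinearMapAt ℝ y (v y)) x := by
    intro v hv
    have := (e.contMDiffAt_section_iff (IB := I) (n := ∞) hx).1 hv
    refine this.congr_of_eventuallyEq ?_
    filter_upwards [e.open_baseSet.mem_nhds hx] with y hy
    rw [e.continuousLinearMapAt_apply ℝ, e.coe_linearMapAt_of_mem (R := ℝ) hy]
  let Lm : M → ((ι → ℝ) →L[ℝ] E) := fun y =>
    ∑ j, (ContinuousLinearMap.proj (R := ℝ) (φ := fun _ : ι => ℝ) j).smulRight
      (e.continuousLinearMapAt ℝ y (s j y))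
  have hL : ContMDiffAt I 𝓘(ℝ, (ι → ℝ) →L[ℝ] E) ∞ Lm x := by
    refine ContMDiffAt.sum (fun j _ => ?_)
    exact ((ContinuousLinearMap.smulRightL ℝ (ι → ℝ) E
      (ContinuousLinearMap.proj (R := ℝ) (φ := fun _ : ι => ℝ) j)).contMDiff.contMDiffAt).comp x
      (hsec _ ((hs.contMDiffOn j).contMDiffAt hu))
  let eq : ∀ y, y ∈ u → y ∈ e.baseSet → ((ι → ℝ) ≃L[ℝ] E) := fun y hyu hye =>
    ((hs.toBasisAt hyu).equivFun.symm.trans (e.linearEquivAt ℝ y hye)).toContinuousLinearEquiv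
  have hLeq : ∀ y (hyu : y ∈ u) (hye : y ∈ e.baseSet),
      Lm y = (eq y hyu hye : (ι → ℝ) →L[ℝ] E) := by
    intro y hyu hye
    ext c
    simp only [Lm, eq, sum_apply, ContinuousLinearMap.smulRight_apply,
      ContinuousLinearMap.proj_apply, ContinuousLinearEquiv.coe_coe,
      LinearEquiv.coe_toContinuousLinearEquiv', LinearEquiv.trans_apply,
      Module.Basis.equivFun_symm_apply, map_sum, map_smul, IsLocalFrameOn.toBasisAt_coe]
    refine Finset.sum_congr rfl (fun j _ => ?_)
    congr 1
    rw [e.continuousLinearMapAt_apply ℝ, e.coe_linearMapAt_of_mem (R := ℝ) hye]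
    rfl
  have hxu := mem_of_mem_nhds hu
  have hinv : ContMDiffAt I 𝓘(ℝ, E →L[ℝ] (ι → ℝ)) ∞
      (fun y => ContinuousLinearMap.inverse (Lm y)) x := by
    have h1 : ContDiffAt ℝ ∞ (ContinuousLinearMap.inverse : ((ι → ℝ) →L[ℝ] E) → _) (Lm x) := by
      rw [hLeq x hxu hx]; exact contDiffAt_map_inverse _
    exact h1.contMDiffAt.comp x hL
  have hval : ContMDiffAt I 𝓘(ℝ, ι → ℝ) ∞ (fun y => ContinuousLinearMap.inverse (Lm y)
      (e.continuousLinearMapAt ℝ y (t y))) x := hinv.clm_apply (hsec t ht)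
  have hcomp : ContMDiffAt I 𝓘(ℝ, ℝ) ∞ (fun y => ContinuousLinearMap.inverse (Lm y)
      (e.continuousLinearMapAt ℝ y (t y)) i) x :=
    ((ContinuousLinearMap.proj (R := ℝ) (φ := fun _ : ι => ℝ) i).contMDiff.contMDiffAt).comp x hval
  refine hcomp.congr_of_eventuallyEq ?_
  filter_upwards [hu, e.open_baseSet.mem_nhds hx] with y hyu hye
  rw [hLeq y hyu hye, ContinuousLinearMap.inverse_equiv, hs.coeff_apply_of_mem hyu]
  rw [e.continuousLinearMapAt_apply ℝ, e.coe_linearMapAt_of_mem (R := ℝ) hye]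
  change _ = (eq y hyu hye).symm (e.linearEquivAt ℝ y hye (t y)) i
  simp [eq, e.symm_apply_apply_mk hye]


/-- The determinant `det (v₁, …, v_n)` of `n` vectors of `ℂⁿ`, as a real-multilinear alternating map. -/
def detForm (n : ℕ) : AlternatingMap ℝ (Fin n → ℂ) ℂ (Fin n) :=
  { (Matrix.detRowAlternating (n := Fin n) (R := ℂ)).toMultilinearMap.restrictScalars ℝ with
    map_eq_zero_of_eq' := fun v _ _ h hij =>
      (Matrix.detRowAlternating (n := Fin n) (R := ℂ)).map_eq_zero_of_eq v h hij }

theorem detForm_apply (n : ℕ) (v : Fin n → Fin n → ℂ) :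
  detForm n v = Matrix.det (Matrix.of v) := rfl

/-- The tangent space `T_xM` of a manifold `M` of dimension `2m+1`. -/
abbrev Tgt (m : ℕ) {M : Type*} [TopologicalSpace M]
    [ChartedSpace (EuclideanSpace ℝ (Fin (2 * m + 1))) M] (x : M) : Type :=
  TangentSpace (𝓡 (2 * m + 1)) x

/-- Vector fields on `M` (no regularity). -/
abbrev VecField (m : ℕ) (M : Type*) [TopologicalSpace M]
    [ChartedSpace (EuclideanSpace ℝ (Fin (2 * m + 1))) M] : Type _ :=
  ∀ x : M, Tgt m x

variable {m : ℕ} {M : Type*} [TopologicalSpace M]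
  [ChartedSpace (EuclideanSpace ℝ (Fin (2 * m + 1))) M]

/-- The family `(ξ, Z₁, …, Z_m, J Z₁, …, J Z_m)` of vector fields. -/
def complexFrame (J : ∀ x : M, Tgt m x →ₗ[ℝ] Tgt m x)
    (ξ : VecField m M)
    (Z : Fin m → VecField m M) :
    Option (Fin m ⊕ Fin m) → VecField m M
  | none => ξ
  | some (Sum.inl α) => Z α
  | some (Sum.inr α) => fun x => J x (Z α x)

variable [IsManifold (𝓡 (2 * m + 1)) ∞ M] 
variable (m M) in
/-- An almost CR-structure `(H, J)` on the manifold `M` of dimension `2m+1`: a smooth subbundle `H`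
of `TM` of rank `2m` and a smooth complex structure `J` on `H`. Only the restriction of `J x` to
`H x` is meaningful. The corresponding complex subbundle of `TM ⊗ ℂ` is
`T₁₀ = {v - i J v : v ∈ H}`, with conjugate `T₀₁ = {v + i J v : v ∈ H}`. Smoothness is expressed by
local smooth frames `(ξ, Z₁, …, Z_m, J Z₁, …, J Z_m)` of `TM` in which the `Z_α, J Z_α` span `H`. -/
structure AlmostCRStructure where
  H : ∀ x : M, Submodule ℝ (Tgt m x)
  J : ∀ x : M, Tgt m x →ₗ[ℝ] Tgt m x
  J_mem : ∀ x, ∀ v ∈ H x, J x v ∈ H x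
  J_J : ∀ x, ∀ v ∈ H x, J x (J x v) = -v
  exists_frame : ∀ x₀ : M, ∃ (U : Set M) (ξ : VecField m M)
    (Z : Fin m → VecField m M), IsOpen U ∧ x₀ ∈ U ∧
      IsLocalFrameOn (𝓡 (2 * m + 1)) (EuclideanSpace ℝ (Fin (2 * m + 1))) ∞ (complexFrame J ξ Z) U ∧
      ∀ x ∈ U, H x = Submodule.span ℝ
        (Set.range (fun α => Z α x) ∪ Set.range (fun α => J x (Z α x)))

namespace AlmostCRStructure
variable (S : AlmostCRStructure m M)

/-- The fibre at `x` of the canonical line bundle `Λ^{m+1,0}M`: complex valued alternating real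
`(m+1)`-forms `ρ` on `T_xM` (equivalently, complex `(m+1)`-forms) whose contraction with every
element `v + i J v` of `T₀₁` vanishes. -/
def canonicalLine (x : M) :
    Submodule ℂ (AlternatingMap ℝ (Tgt m x) ℂ (Fin (m + 1))) where
  carrier := {ρ | ∀ v ∈ S.H x, ∀ Y : Fin m → Tgt m x,
    ρ (Fin.cons v Y) + Complex.I * ρ (Fin.cons (S.J x v) Y) = 0}
  zero_mem' := by intro v _ Y; simp
  add_mem' := by
    intro a b ha hb v hv Y
    have h1 := ha v hv Y
    have h2 := hb v hv Y
    simp only [AlternatingMap.add_apply]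
    linear_combination h1 + h2
  smul_mem' := by
    intro c a ha v hv Y
    have h1 := ha v hv Y
    simp only [AlternatingMap.smul_apply, smul_eq_mul]
    linear_combination c * h1


/-- Domain of a chosen local frame `(ξ, Z_α, J Z_α)` around `x₀`. -/
def frameDomain (x₀ : M) : Set M := (S.exists_frame x₀).choose

/-- The field `ξ`, transverse to `H`, of the chosen local frame around `x₀`. -/
def transverse (x₀ : M) : VecField m M :=
  (S.exists_frame x₀).choose_spec.choose

/-- The fields `Z₁, …, Z_m` of the chosen local frame around `x₀`. -/
def holFrame (x₀ : M) : Fin m → VecField m M :=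
  (S.exists_frame x₀).choose_spec.choose_spec.choose

theorem frame_spec (x₀ : M) : IsOpen (S.frameDomain x₀) ∧ x₀ ∈ S.frameDomain x₀ ∧
    IsLocalFrameOn (𝓡 (2 * m + 1)) (EuclideanSpace ℝ (Fin (2 * m + 1))) ∞
      (complexFrame S.J (S.transverse x₀) (S.holFrame x₀)) (S.frameDomain x₀) ∧
    ∀ x ∈ S.frameDomain x₀, S.H x = Submodule.span ℝ
      (Set.range (fun α => S.holFrame x₀ α x) ∪
        Set.range (fun α => S.J x (S.holFrame x₀ α x))) :=
  (S.exists_frame x₀).choose_spec.choose_spec.choose_spec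

/-- The fields `(ξ, Z₁, …, Z_m)`: they form a complex basis of `T_xM ⊗ ℂ` modulo `T₀₁`. -/
def quotFrame (x₀ : M) : Fin (m + 1) → VecField m M :=
  Fin.cons (S.transverse x₀) (S.holFrame x₀)

/-- The complex valued coframe vanishing on `T₀₁` which is dual to `(ξ, Z₁, …, Z_m)`
(zero outside of the frame domain). -/
def coframe (x₀ x : M) : Tgt m x →ₗ[ℝ] (Fin (m + 1) → ℂ) :=
  LinearMap.pi (Fin.cons
    (Complex.ofRealCLM.toLinearMap ∘ₗ (S.frame_spec x₀).2.2.1.coeff none x)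
    (fun α => Complex.ofRealCLM.toLinearMap ∘ₗ
        (S.frame_spec x₀).2.2.1.coeff (some (Sum.inl α)) x +
      Complex.I • (Complex.ofRealCLM.toLinearMap ∘ₗ
        (S.frame_spec x₀).2.2.1.coeff (some (Sum.inr α)) x)))

theorem coframe_zero (x₀ x : M) (v : Tgt m x) :
    S.coframe x₀ x v 0 = ((S.frame_spec x₀).2.2.1.coeff none x v : ℂ) := rfl

theorem coframe_succ (x₀ x : M) (v : Tgt m x) (α : Fin m) :
    S.coframe x₀ x v α.succ = ((S.frame_spec x₀).2.2.1.coeff (some (Sum.inl α)) x v : ℂ) +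
      Complex.I * ((S.frame_spec x₀).2.2.1.coeff (some (Sum.inr α)) x v : ℂ) := rfl

theorem coeff_frame {x₀ x : M} (hx : x ∈ S.frameDomain x₀) (i j : Option (Fin m ⊕ Fin m)) :
    (S.frame_spec x₀).2.2.1.coeff i x (complexFrame S.J (S.transverse x₀) (S.holFrame x₀) j x) =
      if j = i then 1 else 0 := by
  rw [IsLocalFrameOn.coeff_apply_of_mem _ hx,
    ← IsLocalFrameOn.toBasisAt_coe (S.frame_spec x₀).2.2.1 hx, Module.Basis.repr_self,
    Finsupp.single_apply]

theorem coframe_quotFrame {x₀ x : M} (hx : x ∈ S.frameDomain x₀) (k : Fin (m + 1)) :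
    S.coframe x₀ x (S.quotFrame x₀ k x) = Pi.single k 1 := by
  have hn := S.coeff_frame hx
  funext l
  refine Fin.cases ?_ (fun β => ?_) k <;> refine Fin.cases ?_ (fun α => ?_) l
  · have := hn none none
    simp_all [coframe_zero, quotFrame, complexFrame]
  · have h1 := hn (some (Sum.inl α)) none
    have h2 := hn (some (Sum.inr α)) none
    simp_all [coframe_succ, quotFrame, complexFrame]
  · have := hn none (some (Sum.inl β))
    simp_all [coframe_zero, quotFrame, complexFrame]
  · have h1 : (S.frame_spec x₀).2.2.1.coeff (some (Sum.inl α)) x (S.holFrame x₀ β x) =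
        if β = α then 1 else 0 := by simpa [complexFrame] using hn (some (Sum.inl α)) (some (Sum.inl β))
    have h2 : (S.frame_spec x₀).2.2.1.coeff (some (Sum.inr α)) x (S.holFrame x₀ β x) = 0 := by
      simpa [complexFrame] using hn (some (Sum.inr α)) (some (Sum.inl β))
    rw [coframe_succ, quotFrame, Fin.cons_succ, h1, h2, Pi.single_apply]
    by_cases h : β = α
    · simp [h]
    · simp [h, Ne.symm h]

theorem coframe_J (x₀ x : M) (v : Tgt m x) (hv : v ∈ S.H x) :
    S.coframe x₀ x (S.J x v) = Complex.I • S.coframe x₀ x v := by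
  by_cases hx : x ∈ S.frameDomain x₀
  · have hn := S.coeff_frame hx
    have hH := (S.frame_spec x₀).2.2.2 x hx
    have hZ : ∀ α, S.holFrame x₀ α x ∈ S.H x := fun α => by
      rw [hH]; exact Submodule.subset_span (Or.inl ⟨α, rfl⟩)
    have base : ∀ β, S.coframe x₀ x (S.J x (S.holFrame x₀ β x)) =
        Complex.I • S.coframe x₀ x (S.holFrame x₀ β x) := by
      intro β
      funext l
      refine Fin.cases ?_ (fun α => ?_) l
      · have h1 := hn none (some (Sum.inl β))
        have h2 := hn none (some (Sum.inr β))
        simp_all [coframe_zero, complexFrame]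
      · have h1 := hn (some (Sum.inl α)) (some (Sum.inl β))
        have h2 := hn (some (Sum.inr α)) (some (Sum.inl β))
        have h3 := hn (some (Sum.inl α)) (some (Sum.inr β))
        have h4 := hn (some (Sum.inr α)) (some (Sum.inr β))
        simp_all [coframe_succ, complexFrame]
    rw [hH] at hv
    induction hv using Submodule.span_induction with
    | mem w hw =>
      rcases hw with ⟨β, rfl⟩ | ⟨β, rfl⟩
      · exact base β
      · simp only [S.J_J x _ (hZ β), map_neg, base, smul_smul, Complex.I_mul_I, neg_smul, one_smul]
    | zero => simp
    | add a b _ _ ha hb => simp [ha, hb]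
    | smul r a _ ha => simp [ha, smul_comm r Complex.I]
  · have : S.coframe x₀ x = 0 := by
      ext w l
      refine Fin.cases ?_ (fun α => ?_) l
      · simp [coframe_zero, IsLocalFrameOn.coeff_apply_of_notMem _ hx]
      · simp [coframe_succ, IsLocalFrameOn.coeff_apply_of_notMem _ hx]
    simp [this]

/-- The wedge product of the coframe around `x₀`, a local section of `Λ^{m+1,0}M`. It takes the
value `1` on `(ξ, Z₁, …, Z_m)`. -/
def frameForm (x₀ x : M) : S.canonicalLine x :=
  ⟨(detForm (m + 1)).compLinearMap (S.coframe x₀ x), by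
    intro v hv Y
    have key : ∀ u : Tgt m x,
        (detForm (m + 1)).compLinearMap (S.coframe x₀ x) (Fin.cons u Y) =
        Matrix.detRowAlternating (Function.update
          (fun k => S.coframe x₀ x ((Fin.cons 0 Y : Fin (m + 1) → Tgt m x) k)) 0 (S.coframe x₀ x u)) := by
      intro u
      change Matrix.detRowAlternating (fun k => S.coframe x₀ x ((Fin.cons u Y : Fin (m + 1) → Tgt m x) k)) = _
      congr 1
      funext k
      refine Fin.cases ?_ (fun α => ?_) k <;> simp
    rw [key, key, S.coframe_J x₀ x v hv, AlternatingMap.map_update_smul, smul_eq_mul,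
      ← mul_assoc, Complex.I_mul_I]
    ring⟩

/-- Evaluation of an `(m+1,0)`-form on `(ξ, Z₁, …, Z_m)`. -/
def evalFrame (x₀ x : M) : S.canonicalLine x →ₗ[ℂ] ℂ where
  toFun ρ := ρ.1 (fun k => S.quotFrame x₀ k x)
  map_add' _ _ := rfl
  map_smul' _ _ := rfl

theorem frameForm_apply (x₀ x : M) (Y : Fin (m + 1) → Tgt m x) :
    (S.frameForm x₀ x).1 Y = Matrix.det (Matrix.of fun k => S.coframe x₀ x (Y k)) := rfl

theorem evalFrame_frameForm {x₀ x : M} (hx : x ∈ S.frameDomain x₀) :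
    S.evalFrame x₀ x (S.frameForm x₀ x) = 1 := by
  change (S.frameForm x₀ x).1 _ = 1
  rw [frameForm_apply]
  have : (Matrix.of fun k => S.coframe x₀ x (S.quotFrame x₀ k x)) =
      (1 : Matrix (Fin (m + 1)) (Fin (m + 1)) ℂ) := by
    ext k l
    rw [Matrix.of_apply, S.coframe_quotFrame hx, Matrix.one_apply, Pi.single_apply]
    simp [eq_comm]
  rw [this, Matrix.det_one]

theorem evalFrame_injective {x₀ x : M} (hx : x ∈ S.frameDomain x₀) :
    Function.Injective (S.evalFrame x₀ x) := by
  rw [injective_iff_map_eq_zero]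
  intro ρ h0
  apply Subtype.ext
  have hH := (S.frame_spec x₀).2.2.2 x hx
  refine form_eq_zero (S.H x) (S.J x) ((S.frame_spec x₀).2.2.1.toBasisAt hx) ?_ ?_ ρ.1 ρ.2 ?_
  · intro α
    rw [IsLocalFrameOn.toBasisAt_coe, hH]
    exact Submodule.subset_span (Or.inl ⟨α, rfl⟩)
  · intro α
    simp only [IsLocalFrameOn.toBasisAt_coe]; rfl
  · rw [← h0]
    change _ = ρ.1 _
    congr 1
    funext k
    refine Fin.cases ?_ (fun α => ?_) k <;>
      simp [quotFrame, IsLocalFrameOn.toBasisAt_coe, complexFrame]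

theorem eq_evalFrame_smul {x₀ x : M} (hx : x ∈ S.frameDomain x₀) (ρ : S.canonicalLine x) :
    ρ = S.evalFrame x₀ x ρ • S.frameForm x₀ x := by
  apply S.evalFrame_injective hx
  rw [map_smul, S.evalFrame_frameForm hx, smul_eq_mul, mul_one]

/-- The fibre `(Λ^{m+1,0}_x ∖ {0}) / ℝ⁺` of the canonical circle bundle. -/
abbrev circleFiber (x : M) : Type := Module.Ray ℝ (S.canonicalLine x)

theorem frameForm_ne_zero {x₀ x : M} (hx : x ∈ S.frameDomain x₀) : S.frameForm x₀ x ≠ 0 := by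
  intro h
  have := S.evalFrame_frameForm hx
  rw [h, map_zero] at this
  exact zero_ne_one this

/-- The fibre coordinate of the canonical circle bundle given by the local section `frameForm x₀`:
the class of `ρ = c • frameForm x₀` has coordinate `c / |c|`. -/
def fibreCoord (x₀ : M) {x : M} (r : S.circleFiber x) : Circle :=
  Quotient.lift (fun ρ : RayVector ℝ (S.canonicalLine x) =>
    phase (S.evalFrame x₀ x (RayVector.equiv ℝ _ ρ).1)) (by
      intro ρ ρ' h
      have h' : SameRay ℝ (RayVector.equiv ℝ _ ρ).1 (RayVector.equiv ℝ _ ρ').1 :=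
        equiv_iff_sameRay.1 h
      obtain ⟨a, b, ha, hb, hab⟩ := h'.exists_pos (RayVector.equiv ℝ _ ρ).2
        (RayVector.equiv ℝ _ ρ').2
      have := congrArg (fun σ => phase (S.evalFrame x₀ x σ)) hab
      simpa only [LinearMap.map_smul_of_tower, phase_smul ha, phase_smul hb] using this) r

theorem fibreCoord_ray (x₀ : M) {x : M} (ρ : S.canonicalLine x) (h : ρ ≠ 0) :
    S.fibreCoord x₀ (rayOfNeZero ℝ ρ h : Module.Ray ℝ (S.canonicalLine x)) =
      phase (S.evalFrame x₀ x ρ) := rfl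

open scoped Classical in
/-- The inverse of the fibre coordinate: `z` is sent to the class of `z • frameForm x₀` (for `x` in
the frame domain). -/
def fibrePoint (x₀ x : M) (z : Circle) : S.circleFiber x :=
  if hx : x ∈ S.frameDomain x₀ then
    (rayOfNeZero ℝ ((z : ℂ) • S.frameForm x₀ x)
      (smul_ne_zero z.coe_ne_zero (S.frameForm_ne_zero hx)) : Module.Ray ℝ (S.canonicalLine x))
  else (rayOfNeZero ℝ (S.frameForm x x) (S.frameForm_ne_zero (S.frame_spec x).2.1) :
    Module.Ray ℝ (S.canonicalLine x))

theorem fibrePoint_of_mem {x₀ x : M} (hx : x ∈ S.frameDomain x₀) (z : Circle) :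
    S.fibrePoint x₀ x z = rayOfNeZero ℝ ((z : ℂ) • S.frameForm x₀ x)
      (smul_ne_zero z.coe_ne_zero (S.frameForm_ne_zero hx)) := dif_pos hx

theorem fibreCoord_fibrePoint (x₁ : M) {x₀ x : M} (hx : x ∈ S.frameDomain x₀) (z : Circle) :
    S.fibreCoord x₁ (S.fibrePoint x₀ x z) =
      phase ((z : ℂ) * S.evalFrame x₁ x (S.frameForm x₀ x)) := by
  rw [S.fibrePoint_of_mem hx, fibreCoord_ray, map_smul, smul_eq_mul]

theorem fibreCoord_fibrePoint_self {x₀ x : M} (hx : x ∈ S.frameDomain x₀) (z : Circle) :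
    S.fibreCoord x₀ (S.fibrePoint x₀ x z) = z := by
  rw [S.fibreCoord_fibrePoint x₀ hx, S.evalFrame_frameForm hx, mul_one, phase_coe]

theorem fibrePoint_fibreCoord {x₀ x : M} (hx : x ∈ S.frameDomain x₀) (r : S.circleFiber x) :
    S.fibrePoint x₀ x (S.fibreCoord x₀ r) = r := by
  induction r using Module.Ray.ind with
  | h ρ hρ =>
    rw [S.fibrePoint_of_mem hx, fibreCoord_ray, ray_eq_iff]
    have hc : S.evalFrame x₀ x ρ ≠ 0 := fun h => hρ (by
      rw [S.eq_evalFrame_smul hx ρ, h, zero_smul])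
    refine Or.inr (Or.inr ⟨‖S.evalFrame x₀ x ρ‖, 1, norm_pos_iff.2 hc, one_pos, ?_⟩)
    rw [one_smul]
    conv_rhs => rw [S.eq_evalFrame_smul hx ρ]
    rw [← norm_mul_phase (S.evalFrame x₀ x ρ), mul_smul]
    rw [norm_mul_phase]
    exact (Complex.coe_smul _ _).symm

/-- The local trivialization of the canonical circle bundle over the frame domain of `x₀`. -/
def pretriv (x₀ : M) : Pretrivialization Circle (π Circle S.circleFiber) where
  toFun p := (p.proj, S.fibreCoord x₀ p.snd)
  invFun q := ⟨q.1, S.fibrePoint x₀ q.1 q.2⟩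
  source := π Circle S.circleFiber ⁻¹' S.frameDomain x₀
  target := S.frameDomain x₀ ×ˢ Set.univ
  map_source' _ h := ⟨h, trivial⟩
  map_target' _ h := h.1
  left_inv' := by
    rintro ⟨x, r⟩ h
    simp only
    rw [S.fibrePoint_fibreCoord h]
  right_inv' := by
    rintro ⟨x, z⟩ h
    simp only
    rw [S.fibreCoord_fibrePoint_self h.1]
  open_target := (S.frame_spec x₀).1.prod isOpen_univ
  baseSet := S.frameDomain x₀
  open_baseSet := (S.frame_spec x₀).1
  source_eq := rfl
  target_eq := rfl
  proj_toFun _ _ := rfl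

theorem quotFrame_smooth (x₀ : M) (k : Fin (m + 1)) :
    ContMDiffOn (𝓡 (2 * m + 1)) ((𝓡 (2 * m + 1)).prod 𝓘(ℝ, EuclideanSpace ℝ (Fin (2 * m + 1)))) ∞
      (fun x => TotalSpace.mk' (EuclideanSpace ℝ (Fin (2 * m + 1))) x (S.quotFrame x₀ k x))
      (S.frameDomain x₀) := by
  refine Fin.cases ?_ (fun α => ?_) k
  · exact (S.frame_spec x₀).2.2.1.contMDiffOn none
  · exact (S.frame_spec x₀).2.2.1.contMDiffOn (some (Sum.inl α))

theorem transition_smooth (x₀ x₁ : M) :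
    ContMDiffOn (𝓡 (2 * m + 1)) 𝓘(ℝ, ℂ) ∞ (fun x => S.evalFrame x₁ x (S.frameForm x₀ x))
      (S.frameDomain x₀ ∩ S.frameDomain x₁) := by
  intro x hx
  have h0 := (S.frame_spec x₀).1.mem_nhds hx.1
  have h1 := (S.frame_spec x₁).1.mem_nhds hx.2
  have hc : ∀ (k : Fin (m + 1)) (i : Option (Fin m ⊕ Fin m)),
      ContMDiffAt (𝓡 (2 * m + 1)) 𝓘(ℝ, ℂ) ∞ (fun y =>
        (((S.frame_spec x₀).2.2.1.coeff i y (S.quotFrame x₁ k y) : ℝ) : ℂ)) x := fun k i =>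
    (Complex.ofRealCLM.contMDiff.contMDiffAt).comp x
      (contMDiffAt_frameCoeff _ h0 ((S.quotFrame_smooth x₁ k).contMDiffAt h1) i)
  have hcf : ∀ (k l : Fin (m + 1)), ContMDiffAt (𝓡 (2 * m + 1)) 𝓘(ℝ, ℂ) ∞ (fun y =>
        S.coframe x₀ y (S.quotFrame x₁ k y) l) x := by
    intro k l
    refine Fin.cases ?_ (fun α => ?_) l
    · exact hc k none
    · simp only [coframe_succ]
      exact (hc k _).add ((((ContinuousLinearMap.mul ℝ ℂ) Complex.I).contMDiff.contMDiffAt).comp x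
        (hc k _))
  refine ContMDiffAt.contMDiffWithinAt ?_
  have hdet : ContDiff ℝ ∞ (fun A : Fin (m + 1) → Fin (m + 1) → ℂ => Matrix.det (Matrix.of A)) := by
    simp only [Matrix.det_apply, Matrix.of_apply]
    fun_prop
  exact (hdet.contMDiff.contMDiffAt).comp x
    (contMDiffAt_pi_space.2 fun k => contMDiffAt_pi_space.2 fun l => hcf k l)

theorem transition_ne_zero {x₀ x₁ x : M} (h0 : x ∈ S.frameDomain x₀)
    (h1 : x ∈ S.frameDomain x₁) : S.evalFrame x₁ x (S.frameForm x₀ x) ≠ 0 := by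
  intro h
  exact S.frameForm_ne_zero h0 (S.evalFrame_injective h1 (by rw [h, map_zero]))

instance (x : M) : TopologicalSpace (S.circleFiber x) :=
  TopologicalSpace.induced (S.fibreCoord x) inferInstance

/-- The local trivializations glue, with smooth transition functions. -/
def prebundle : FiberPrebundle Circle S.circleFiber where
  pretrivializationAtlas := Set.range S.pretriv
  pretrivializationAt := S.pretriv
  mem_base_pretrivializationAt x := (S.frame_spec x).2.1
  pretrivialization_mem_atlas x := ⟨x, rfl⟩
  continuous_trivChange := by
    rintro _ ⟨x₁, rfl⟩ _ ⟨x₀, rfl⟩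
    have hset : ∀ q ∈ (S.pretriv x₀).target ∩
        (S.pretriv x₀).toPartialEquiv.symm ⁻¹' (S.pretriv x₁).source,
        q.1 ∈ S.frameDomain x₀ ∩ S.frameDomain x₁ := fun q hq => ⟨hq.1.1, hq.2⟩
    refine ContinuousOn.congr (f := fun q : M × Circle =>
      (q.1, phase ((q.2 : ℂ) * S.evalFrame x₁ q.1 (S.frameForm x₀ q.1)))) ?_ ?_
    · refine continuousOn_fst.prodMk ?_
      refine continuousOn_phase.comp ?_ ?_
      · refine ContinuousOn.mul (by fun_prop) ?_
        exact (S.transition_smooth x₀ x₁).continuousOn.comp continuousOn_fst hset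
      · intro q hq
        exact mul_ne_zero q.2.coe_ne_zero
          (S.transition_ne_zero (hset q hq).1 (hset q hq).2)
    · intro q hq
      exact Prod.ext rfl (S.fibreCoord_fibrePoint x₁ (hset q hq).1 q.2)
  totalSpaceMk_isInducing b := by
    have : (S.pretriv b ∘ TotalSpace.mk b) = fun r => (b, S.fibreCoord b r) := rfl
    rw [this]
    exact (Topology.isInducing_const_prod).2 ⟨rfl⟩


instance : TopologicalSpace (TotalSpace Circle S.circleFiber) := S.prebundle.totalSpaceTopology

instance : FiberBundle Circle S.circleFiber := S.prebundle.toFiberBundle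

/-- The total space `F_c = (Λ^{m+1,0}M ∖ {0}) / ℝ⁺` of the canonical circle bundle of `(M, H, J)`,
with projection `π Circle S.circleFiber` to `M`. -/
abbrev CanonicalBundle : Type _ := TotalSpace Circle S.circleFiber

/-- The smooth structure of the canonical circle bundle: charts of `M × S¹` composed with the local
trivializations. -/
instance : ChartedSpace (ModelProd (EuclideanSpace ℝ (Fin (2 * m + 1))) (EuclideanSpace ℝ (Fin 1)))
    S.CanonicalBundle :=
  ChartedSpace.comp _ (M × Circle) _

end AlmostCRStructure

/-- An extension of a tangent vector to a vector field which is smooth near the base point. -/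
def extendVec {x : M} (v : Tgt m x) : VecField m M :=
  FiberBundle.extend (EuclideanSpace ℝ (Fin (2 * m + 1))) v

/-- The derivative `v(g)` of a function `g` on `M` in the direction of `v ∈ T_xM`. -/
abbrev dirDeriv {F : Type*} [NormedAddCommGroup F] [NormedSpace ℝ F] (g : M → F) (x : M)
    (v : Tgt m x) : F := mvfderiv (𝓡 (2 * m + 1)) g x v

/-- The Lie bracket of vector fields. -/
abbrev lieBr (X Y : VecField m M) : VecField m M := VectorField.mlieBracket (𝓡 (2 * m + 1)) X Y

/-- The exterior derivative of a real 1-form, `dη(V,W) = V(η(W)) - W(η(V)) - η([V,W])`, evaluated on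
extensions of the two vectors. -/
def extD (η : ∀ x : M, Tgt m x →L[ℝ] ℝ) (x : M) (v w : Tgt m x) : ℝ :=
  dirDeriv (fun y => η y (extendVec w y)) x v - dirDeriv (fun y => η y (extendVec v y)) x w -
    η x (lieBr (extendVec v) (extendVec w) x)

variable (m M) in
/-- Smooth 1-forms `ℓ ∈ Ω¹(M; iℝ)` with purely imaginary values. -/
structure ImaginaryOneForm where
  form : ∀ x : M, Tgt m x →L[ℝ] ℂ
  smooth : ContMDiff (𝓡 (2 * m + 1))
    ((𝓡 (2 * m + 1)).prod 𝓘(ℝ, EuclideanSpace ℝ (Fin (2 * m + 1)) →L[ℝ] ℂ)) ∞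
    (fun x => TotalSpace.mk' (EuclideanSpace ℝ (Fin (2 * m + 1)) →L[ℝ] ℂ) x (form x))
  re_eq_zero : ∀ x v, (form x v).re = 0

namespace AlmostCRStructure
variable (S : AlmostCRStructure m M)

/-- The vector field `JX`. -/
abbrev JF (X : VecField m M) : VecField m M := fun y => S.J y (X y)

/-- `X` restricts to a smooth section of `H` over `U`. -/
structure IsSection (U : Set M) (X : VecField m M) : Prop where
  smooth : ContMDiffOn (𝓡 (2 * m + 1))
    ((𝓡 (2 * m + 1)).prod 𝓘(ℝ, EuclideanSpace ℝ (Fin (2 * m + 1)))) ∞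
    (fun x => TotalSpace.mk' (EuclideanSpace ℝ (Fin (2 * m + 1))) x (X x)) U
  mem : ∀ x ∈ U, X x ∈ S.H x

/-- Partial integrability: the bracket `L_H : H × H → TM/H` satisfies `L_H(X,Y) = L_H(JX,JY)`. -/
def IsPartiallyIntegrable : Prop :=
  ∀ (U : Set M) (X Y : VecField m M), IsOpen U → S.IsSection U X → S.IsSection U Y →
    ∀ x ∈ U, lieBr X Y x - lieBr (S.JF X) (S.JF Y) x ∈ S.H x

/-- The Nijenhuis tensor `[X,Y] - [JX,JY] + J[JX,Y] + J[X,JY]`, for sections `X`, `Y` of `H`. -/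
def nijenhuis (X Y : VecField m M) (x : M) : Tgt m x :=
  lieBr X Y x - lieBr (S.JF X) (S.JF Y) x + S.J x (lieBr (S.JF X) Y x + lieBr X (S.JF Y) x)

/-- The tangent space of the canonical circle bundle at `p`. -/
abbrev TgtF (S : AlmostCRStructure m M) (p : S.CanonicalBundle) : Type _ :=
  TangentSpace ((𝓡 (2 * m + 1)).prod (𝓡 1)) p

/-- The differential of the projection of the canonical circle bundle to `M`. -/
def dproj {S : AlmostCRStructure m M} (p : S.CanonicalBundle) : TgtF S p →L[ℝ] Tgt m p.proj :=
  mfderiv ((𝓡 (2 * m + 1)).prod (𝓡 1)) (𝓡 (2 * m + 1)) (π Circle S.circleFiber) p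

/-- 2-tensors on the canonical circle bundle. -/
abbrev TwoTensor (S : AlmostCRStructure m M) : Type _ :=
  ∀ p : S.CanonicalBundle, TgtF S p → TgtF S p → ℝ

/-- A pseudo-Hermitian form on a strictly pseudoconvex space: a smooth nowhere vanishing 1-form `θ`
with `θ|_H = 0` whose Levi form `dθ(·,J·)` is positive definite on `H`. -/
structure PseudoHermitian where
  form : ∀ x : M, Tgt m x →L[ℝ] ℝ
  smooth : ContMDiff (𝓡 (2 * m + 1))
    ((𝓡 (2 * m + 1)).prod 𝓘(ℝ, EuclideanSpace ℝ (Fin (2 * m + 1)) →L[ℝ] ℝ)) ∞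
    (fun x => TotalSpace.mk' (EuclideanSpace ℝ (Fin (2 * m + 1)) →L[ℝ] ℝ) x (form x))
  ne_zero : ∀ x, form x ≠ 0
  vanish : ∀ x, ∀ v ∈ S.H x, form x v = 0
  pos : ∀ x, ∀ v ∈ S.H x, v ≠ 0 → 0 < extD form x v (S.J x v)

namespace PseudoHermitian
variable {S} (θ : S.PseudoHermitian)

/-- The Reeb vector field: `θ(T) = 1` and `dθ(T,·) = 0`. -/
def reeb : VecField m M := fun x =>
  Classical.epsilon (fun T : Tgt m x => θ.form x T = 1 ∧ ∀ v, extD θ.form x T v = 0)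

/-- The Levi form `L_θ` as a symmetric bilinear form on `TM`: `L_θ = dθ(·,J·)` on `H` and
`L_θ(T,·) = 0`. -/
def levi (x : M) (v w : Tgt m x) : ℝ :=
  extD θ.form x v (S.J x (w - θ.form x w • θ.reeb x))

/-- The determining properties of the Tanaka-Webster connection `∇` on `TM`, where `D Y x v = ∇_v Y`:
it preserves `(H,J)` and the Reeb field `T`, it is metric for `L_θ` on `H`, and its torsion
`Tor(X,Y) = ∇_X Y - ∇_Y X - [X,Y]` satisfies `Tor(X,Y) = L_θ(JX,Y) T - N_J(X,Y)/4` and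
`Tor(T,X) = -([T,X] + J[T,JX])/2` for sections `X`, `Y` of `H`. -/
structure IsTanakaWebster (D : VecField m M → ∀ x : M, Tgt m x →L[ℝ] Tgt m x) : Prop where
  isCov : IsCovariantDerivativeOn (EuclideanSpace ℝ (Fin (2 * m + 1)))
    (V := fun x : M => TangentSpace (𝓡 (2 * m + 1)) x) D Set.univ
  mem : ∀ U Y, IsOpen U → S.IsSection U Y → ∀ x ∈ U, ∀ v, D Y x v ∈ S.H x
  comm_J : ∀ U Y, IsOpen U → S.IsSection U Y → ∀ x ∈ U, ∀ v, D (S.JF Y) x v = S.J x (D Y x v)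
  reeb_parallel : ∀ x, D θ.reeb x = 0
  metric : ∀ U Y Z, IsOpen U → S.IsSection U Y → S.IsSection U Z → ∀ x ∈ U, ∀ v,
    dirDeriv (fun y => θ.levi y (Y y) (Z y)) x v =
      θ.levi x (D Y x v) (Z x) + θ.levi x (Y x) (D Z x v)
  torsion : ∀ U X Y, IsOpen U → S.IsSection U X → S.IsSection U Y → ∀ x ∈ U,
    D Y x (X x) - D X x (Y x) - lieBr X Y x =
      θ.levi x (S.J x (X x)) (Y x) • θ.reeb x - (1 / 4 : ℝ) • S.nijenhuis X Y x
  torsion_reeb : ∀ U X, IsOpen U → S.IsSection U X → ∀ x ∈ U,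
    D X x (θ.reeb x) - D θ.reeb x (X x) - lieBr θ.reeb X x =
      -(1 / 2 : ℝ) • (lieBr θ.reeb X x + S.J x (lieBr θ.reeb (S.JF X) x))

/-- The Tanaka-Webster connection; `θ.tanakaWebster Y x v` is `∇_v Y`. -/
def tanakaWebster : VecField m M → ∀ x : M, Tgt m x →L[ℝ] Tgt m x :=
  Classical.epsilon θ.IsTanakaWebster

/-- The curvature `R(v,w)z = ∇_v ∇_w z - ∇_w ∇_v z - ∇_{[v,w]} z` of the Tanaka-Webster connection. -/
def curvature (x : M) (v w z : Tgt m x) : Tgt m x :=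
  θ.tanakaWebster (fun y => θ.tanakaWebster (extendVec z) y (extendVec w y)) x v -
    θ.tanakaWebster (fun y => θ.tanakaWebster (extendVec z) y (extendVec v y)) x w -
    θ.tanakaWebster (extendVec z) x (lieBr (extendVec v) (extendVec w) x)

/-- `(e₁, J e₁, …, e_m, J e_m)` is an orthonormal basis of `(H_x, L_θ)`. -/
structure IsUnitaryBasis (x : M) (e : Fin m → Tgt m x) : Prop where
  mem : ∀ α, e α ∈ S.H x
  levi_self : ∀ α β, θ.levi x (e α) (e β) = if α = β then 1 else 0
  levi_J : ∀ α β, θ.levi x (e α) (S.J x (e β)) = 0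

/-- A chosen orthonormal basis `(e₁, J e₁, …, e_m, J e_m)` of `(H_x, L_θ)`. -/
def unitaryBasis (x : M) : Fin m → Tgt m x := Classical.epsilon (θ.IsUnitaryBasis x)

/-- The Webster-Ricci curvature `Ric(v,w) = i ∑_α L_θ(R(v,w)e_α, J e_α)`. With
`Z_α = (e_α - i J e_α)/√2` it is `∑_α L_θ(R(v,w)Z_α, Z_α)`. -/
def ric (x : M) (v w : Tgt m x) : ℂ :=
  Complex.I * ∑ α, (θ.levi x (θ.curvature x v w (θ.unitaryBasis x α))
    (S.J x (θ.unitaryBasis x α)) : ℂ)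

/-- The Webster scalar curvature `i ∑_α Ric(e_α, J e_α)` (a real number). -/
def scal (x : M) : ℝ :=
  (Complex.I * ∑ α, θ.ric x (θ.unitaryBasis x α) (S.J x (θ.unitaryBasis x α))).re

/-- The covariant derivative induced on complex valued `k`-forms:
`(∇_v σ)(Y₁,…,Y_k) = v(σ(Y₁,…,Y_k)) - ∑_j σ(Y₁,…,∇_v Y_j,…,Y_k)`. -/
def covDerivForm {k : ℕ} (σ : ∀ x : M, AlternatingMap ℝ (Tgt m x) ℂ (Fin k))
    (Y : Fin k → VecField m M) (x : M) (v : Tgt m x) : ℂ :=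
  dirDeriv (fun y => σ y (fun j => Y j y)) x v -
    ∑ j, σ x (Function.update (fun i => Y i x) j (θ.tanakaWebster (Y j) x v))

/-- The 1-form `Im α`, where `∇_v σ = α(v) σ` for the local section `σ = frameForm x₀` of
`Λ^{m+1,0}M`. -/
def gaugeForm (x₀ x : M) (v : Tgt m x) : ℝ :=
  (θ.covDerivForm (fun y => (S.frameForm x₀ y).1) (S.quotFrame x₀) x v /
    (S.frameForm x₀ x).1 (fun k => S.quotFrame x₀ k x)).im

/-- The connection form `A^W : TF_c → iℝ` induced by the Tanaka-Webster connection on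
`Λ^{m+1,0}M`. With the class `[σ]` of `σ = frameForm x₀` as local section, and `z` the
corresponding fibre coordinate, it is `z⁻¹ dz + i Im α`, where `∇σ = α σ`; the real part of `α` is
lost on dividing by `ℝ⁺`. -/
def websterForm (p : S.CanonicalBundle) (v : TgtF S p) : ℂ :=
  (S.fibreCoord p.proj p.snd : ℂ)⁻¹ *
      mvfderiv ((𝓡 (2 * m + 1)).prod (𝓡 1))
        (fun q : S.CanonicalBundle => (S.fibreCoord p.proj q.snd : ℂ)) p v +
    Complex.I * θ.gaugeForm p.proj p.proj (dproj p v)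

/-- The Weyl connection form `A_θ = A^W - i/(2(m+1)) scal θ`. -/
def weylForm (p : S.CanonicalBundle) (v : TgtF S p) : ℂ :=
  θ.websterForm p v -
    Complex.I / (2 * (m + 1)) * θ.scal p.proj * θ.form p.proj (dproj p v)

/-- The symmetric 2-tensor `L_θ - i 4/(m+2) θ ∘ A` on `F_c`, where `A` has values in `iℝ` and
`θ ∘ A = (θ ⊗ A + A ⊗ θ)/2` is the symmetric product. -/
def metricOf (A : ∀ p : S.CanonicalBundle, TgtF S p → ℂ) (p : S.CanonicalBundle)
    (v w : TgtF S p) : ℝ :=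
  θ.levi p.proj (dproj p v) (dproj p w) +
    (-(Complex.I * (4 / (m + 2))) * ((1 / 2) *
      (θ.form p.proj (dproj p v) * A p w + θ.form p.proj (dproj p w) * A p v))).re

/-- The Fefferman metric `f_θ = L_θ - i 4/(m+2) θ ∘ A_θ`. -/
def feffermanMetric : S.TwoTensor := θ.metricOf θ.weylForm

/-- The `ℓ`-Fefferman metric `f_{θ,ℓ} = L_θ - i 4/(m+2) θ ∘ (A_θ + ℓ)`. -/
def ellFeffermanMetric (ℓ : ImaginaryOneForm m M) : S.TwoTensor :=
  θ.metricOf (fun p v => θ.weylForm p v + ℓ.form p.proj (dproj p v))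

end PseudoHermitian

/-- The conformal class of `g`: all `e^{2φ} g` with `φ` a smooth function on `F_c`. -/
def conformalClass {S : AlmostCRStructure m M} (g : S.TwoTensor) : Set S.TwoTensor :=
  {h | ∃ φ : S.CanonicalBundle → ℝ,
    ContMDiff ((𝓡 (2 * m + 1)).prod (𝓡 1)) 𝓘(ℝ, ℝ) ∞ φ ∧
      ∀ p v w, h p v w = Real.exp (2 * φ p) * g p v w}

end AlmostCRStructure
end CR
end

/-! Write `h` for the projection of TM to H along the Reeb field T, φ = J∘h, g for the horizontal
gradient of f with respect to L_θ, W = -2φg (`twist`) and |g|² = L_θ(g,g). For θ' = e^{2f}θ the Reeb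
field becomes e^{-2f}(T + W), so L_θ' is e^{2f}L_θ evaluated on h(v) - θ(v)W and h(w) - θ(w)W.
Compared with e^{2f}L_θ(v,w) this produces the error e^{2f}(-θ(v)L_θ(W,w) - θ(w)L_θ(W,v) +
4|g|²θ(v)θ(w)). The summand θ∘A of the Fefferman metric compensates it exactly when Im A_θ' = Im A_θ
+ (m+2)/2 · L_θ(W,·) - (m+2)|g|²θ, which is how `IsConformal.metricOf_eq` concludes. The real work
is this law for A_θ, `IsConformal.im_weylForm`. The vertical part z⁻¹dz of A^W does not involve θ,
and a form ℓ occurs identically on both sides, so only the gauge form γ = Im α and the scalar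
curvature matter.

The Tanaka-Webster connection is made computable by a Koszul formula. Combining the torsion
condition for the pairs (V,Y), (φV,φY), (φV,Y), (V,φY) eliminates the Nijenhuis tensor and expresses
∇_V Y + φ∇_{φV}Y by brackets; metricity then isolates L_θ(∇_V Y, Z), which is `koszul`, and the
torsion with T gives ∇_T. This proves uniqueness on sections of H (`eq_koszulConn`). Conversely the
formula defines a connection, and the identities d(dθ) = 0 and ι_T dθ = 0 show that it has all the
required properties (`isTanakaWebster_koszulConn`). Partial integrability enters as dθ(J·,J·) = dθ
on H.

In a frame of H, γ is half the real trace of J composed with the connection matrix ω. Since ω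
commutes with J, the quadratic part of the curvature dω + ω∧ω has no J-trace, so scal = ∑ dγ(e_α,
Je_α) (`scal_eq`).

Inserting the conformal change into the Koszul formula and into the bracket formula for ∇_T, and
taking traces, gives γ' = γ + (m+2)/2 · L_θ(W,·) + cθ with c = -½ tr(φ∇W) - 2(m+1)|g|², where ∇W is
taken along H. Differentiating the law for γ gives e^{2f}scal' = scal - (m+2)/2 · tr(φ∇W) + mc.
Eliminating the second order term tr(φ∇W) yields c = (e^{2f}scal' - scal)/(2(m+1)) - (m+2)|g|². The
correction -scal θ/(2(m+1)) in A_θ removes the first summand, and the law for A_θ follows.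

For the conformal classes, any two pseudo-Hermitian forms differ by a factor, which is smooth, and
positive once H ≠ 0; write it as e^{2f}. -/

open scoped Manifold ContDiff Bundle Topology
open Bundle

noncomputable section
namespace CR
variable {m : ℕ} {M : Type*} [TopologicalSpace M]
  [ChartedSpace (EuclideanSpace ℝ (Fin (2 * m + 1))) M] [IsManifold (𝓡 (2 * m + 1)) ∞ M]

set_option linter.unusedSectionVars false

/-! ### Derivatives of functions and brackets of vector fields on M -/

section Calculus

/-- The vector field `X` is differentiable at `x`. -/
abbrev DiffField (X : VecField m M) (x : M) : Prop :=
  MDifferentiableAt (𝓡 (2 * m + 1))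
    ((𝓡 (2 * m + 1)).prod 𝓘(ℝ, EuclideanSpace ℝ (Fin (2 * m + 1))))
    (fun y => TotalSpace.mk' (EuclideanSpace ℝ (Fin (2 * m + 1))) y (X y)) x

/-- The vector field `X` is smooth at `x`. -/
abbrev SmoothField (X : VecField m M) (x : M) : Prop :=
  ContMDiffAt (𝓡 (2 * m + 1))
    ((𝓡 (2 * m + 1)).prod 𝓘(ℝ, EuclideanSpace ℝ (Fin (2 * m + 1)))) ∞
    (fun y => TotalSpace.mk' (EuclideanSpace ℝ (Fin (2 * m + 1))) y (X y)) x

/-- The function `f` is differentiable at `x`. -/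
abbrev DiffFun {F : Type*} [NormedAddCommGroup F] [NormedSpace ℝ F] (f : M → F) (x : M) : Prop :=
  MDifferentiableAt (𝓡 (2 * m + 1)) 𝓘(ℝ, F) f x

/-- The function `f` is smooth at `x`. -/
abbrev SmoothFun {F : Type*} [NormedAddCommGroup F] [NormedSpace ℝ F] (f : M → F) (x : M) : Prop :=
  ContMDiffAt (𝓡 (2 * m + 1)) 𝓘(ℝ, F) ∞ f x

variable {F : Type*} [NormedAddCommGroup F] [NormedSpace ℝ F] {x : M} {X Y Z : VecField m M}

theorem SmoothFun.diff {f : M → F} (h : SmoothFun (m := m) f x) : DiffFun (m := m) f x :=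
  h.mdifferentiableAt (by simp)

theorem dirDeriv_congr {f g : M → F} (h : f =ᶠ[𝓝 x] g) (v : Tgt m x) :
    dirDeriv f x v = dirDeriv g x v := by
  have h1 := h.mfderiv_eq (I := 𝓡 (2 * m + 1)) (I' := 𝓘(ℝ, F))
  simp only [dirDeriv, mvfderiv, ContinuousLinearMap.comp_apply]
  exact DFunLike.congr_fun h1 v

theorem dirDeriv_add_vec (f : M → F) (v w : Tgt m x) :
    dirDeriv f x (v + w) = dirDeriv f x v + dirDeriv f x w := map_add _ _ _

theorem dirDeriv_smul_vec (f : M → F) (c : ℝ) (v : Tgt m x) :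
    dirDeriv f x (c • v) = c • dirDeriv f x v := map_smul _ _ _

theorem dirDeriv_const (c : F) (v : Tgt m x) : dirDeriv (fun _ : M => c) x v = 0 := by
  exact DFunLike.congr_fun (mvfderiv_const (I := 𝓡 (2 * m + 1)) c) v

theorem dirDeriv_add {f g : M → F} (hf : DiffFun (m := m) f x) (hg : DiffFun (m := m) g x)
    (v : Tgt m x) :
    dirDeriv (fun y => f y + g y) x v = dirDeriv f x v + dirDeriv g x v := by
  simp only [dirDeriv, mvfderiv_fun_add hf hg, add_apply]

theorem dirDeriv_sub {f g : M → F} (hf : DiffFun (m := m) f x) (hg : DiffFun (m := m) g x)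
    (v : Tgt m x) :
    dirDeriv (fun y => f y - g y) x v = dirDeriv f x v - dirDeriv g x v := by
  simp only [dirDeriv, mvfderiv_fun_sub hf hg, sub_apply]

theorem dirDeriv_neg (f : M → F) (v : Tgt m x) :
    dirDeriv (fun y => - f y) x v = - dirDeriv f x v := by
  simp only [dirDeriv, mvfderiv_fun_neg, neg_apply]

theorem dirDeriv_mul {f g : M → ℝ} (hf : DiffFun (m := m) f x) (hg : DiffFun (m := m) g x)
    (v : Tgt m x) :
    dirDeriv (fun y => f y * g y) x v = f x * dirDeriv g x v + g x * dirDeriv f x v := by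
  simp only [dirDeriv, mvfderiv_fun_mul hf hg, add_apply, smul_apply, smul_eq_mul]

theorem DiffFun.sum {ι : Type*} {s : Finset ι} {f : ι → M → F}
    (hf : ∀ i ∈ s, DiffFun (m := m) (f i) x) : DiffFun (m := m) (fun y => ∑ i ∈ s, f i y) x := by
  classical
  induction s using Finset.induction_on with
  | empty => simpa using mdifferentiableAt_const
  | insert a s ha ih =>
    simp only [Finset.sum_insert ha]
    simp only [Finset.mem_insert, forall_eq_or_imp] at hf
    exact hf.1.add (ih hf.2)

theorem dirDeriv_sum {ι : Type*} {s : Finset ι} {f : ι → M → F}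
    (hf : ∀ i ∈ s, DiffFun (m := m) (f i) x) (v : Tgt m x) :
    dirDeriv (fun y => ∑ i ∈ s, f i y) x v = ∑ i ∈ s, dirDeriv (f i) x v := by
  classical
  induction s using Finset.induction_on with
  | empty => simpa using dirDeriv_const (0 : F) v
  | insert a s ha ih =>
    simp only [Finset.sum_insert ha]
    simp only [Finset.mem_insert, forall_eq_or_imp] at hf
    rw [← ih hf.2]
    exact dirDeriv_add hf.1 (DiffFun.sum hf.2) v

theorem SmoothField.diff (h : SmoothField X x) : DiffField X x := h.mdifferentiableAt (by simp)

instance isManifold_infty_add_one : IsManifold (𝓡 (2 * m + 1)) (∞ + 1) M := by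
  rw [show (∞ : WithTop ℕ∞) + 1 = ∞ from rfl]; infer_instance

instance isManifold_three : IsManifold (𝓡 (2 * m + 1)) (minSmoothness ℝ 3) M := by
  simp only [minSmoothness_of_isRCLikeNormedField]
  exact IsManifold.of_le (n := ∞) (WithTop.coe_le_coe.2 (le_top : (3 : ℕ∞) ≤ ⊤))

/-- Tangent spaces carry only a vector space topology here. Being Hausdorff and finite dimensional
makes every linear map on them continuous, which is how pointwise algebra is turned into `→L[ℝ]`
maps later. -/
instance t2Space_tangentSpace (x : M) : T2Space (Tgt m x) :=
  FiberBundle.t2Space (EuclideanSpace ℝ (Fin (2 * m + 1)))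
    (TangentSpace (𝓡 (2 * m + 1)) : M → Type _) x

instance finiteDimensional_tangentSpace (x : M) : FiniteDimensional ℝ (Tgt m x) :=
  VectorBundle.finiteDimensional ℝ (EuclideanSpace ℝ (Fin (2 * m + 1)))
    (TangentSpace (𝓡 (2 * m + 1)) : M → Type _) x

theorem SmoothField.lieBr (hX : SmoothField X x) (hY : SmoothField Y x) :
    SmoothField (lieBr X Y) x :=
  ContMDiffAt.mlieBracket_vectorField (n := (⊤ : ℕ∞)) (m := (⊤ : ℕ∞)) hX hY (by simp)

theorem SmoothField.add (hX : SmoothField X x) (hY : SmoothField Y x) :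
    SmoothField (fun y => X y + Y y) x := ContMDiffAt.add_section hX hY

theorem SmoothField.sub (hX : SmoothField X x) (hY : SmoothField Y x) :
    SmoothField (fun y => X y - Y y) x := ContMDiffAt.sub_section hX hY

theorem SmoothField.smul {f : M → ℝ} (hf : SmoothFun (m := m) f x) (hX : SmoothField X x) :
    SmoothField (fun y => f y • X y) x := ContMDiffAt.smul_section hf hX

theorem SmoothField.congr (hX : SmoothField X x) (h : ∀ᶠ y in 𝓝 x, Y y = X y) :
    SmoothField Y x := by
  refine ContMDiffAt.congr_of_eventuallyEq hX ?_
  filter_upwards [h] with y hy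
  simp only [hy]

theorem DiffField.congr (hX : DiffField X x) (h : ∀ᶠ y in 𝓝 x, Y y = X y) :
    DiffField Y x := by
  refine MDifferentiableAt.congr_of_eventuallyEq hX ?_
  filter_upwards [h] with y hy
  simp only [hy]

theorem DiffField.add (hX : DiffField X x) (hY : DiffField Y x) :
    DiffField (fun y => X y + Y y) x := mdifferentiableAt_add_section hX hY

theorem DiffField.sub (hX : DiffField X x) (hY : DiffField Y x) :
    DiffField (fun y => X y - Y y) x := mdifferentiableAt_sub_section hX hY

theorem DiffField.smul {f : M → ℝ} (hf : DiffFun (m := m) f x) (hX : DiffField X x) :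
    DiffField (fun y => f y • X y) x := MDifferentiableAt.smul_section hf hX

theorem smoothField_extendVec (v : Tgt m x) : SmoothField (extendVec v) x :=
  FiberBundle.contMDiffAt_extend _ _ v

theorem diffField_extendVec (v : Tgt m x) : DiffField (extendVec v) x :=
  (smoothField_extendVec v).diff

@[simp] theorem extendVec_self (v : Tgt m x) : extendVec v x = v :=
  FiberBundle.extend_apply_self _ v

theorem lieBr_add_left (hX : DiffField X x) (hY : DiffField Y x) :
    lieBr (fun y => X y + Y y) Z x = lieBr X Z x + lieBr Y Z x :=
  VectorField.mlieBracket_add_left hX hY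

theorem lieBr_add_right (hX : DiffField X x) (hY : DiffField Y x) :
    lieBr Z (fun y => X y + Y y) x = lieBr Z X x + lieBr Z Y x :=
  VectorField.mlieBracket_add_right hX hY

theorem lieBr_smul_right {f : M → ℝ} (hf : DiffFun (m := m) f x) (hX : DiffField X x) :
    lieBr Z (fun y => f y • X y) x = dirDeriv f x (Z x) • X x + f x • lieBr Z X x :=
  VectorField.mlieBracket_smul_right hf hX

theorem lieBr_smul_left {f : M → ℝ} (hf : DiffFun (m := m) f x) (hX : DiffField X x) :
    lieBr (fun y => f y • X y) Z x = - dirDeriv f x (Z x) • X x + f x • lieBr X Z x :=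
  VectorField.mlieBracket_smul_left hf hX

theorem lieBr_swap : lieBr X Y x = - lieBr Y X x := VectorField.mlieBracket_swap_apply

theorem lieBr_neg_left (hX : DiffField X x) : lieBr (fun y => - X y) Z x = - lieBr X Z x := by
  have := VectorField.mlieBracket_const_smul_left (I := 𝓡 (2 * m + 1)) (c := (-1 : ℝ)) (W := Z) hX
  simp only [neg_smul, one_smul] at this
  exact this

theorem lieBr_neg_right (hX : DiffField X x) : lieBr Z (fun y => - X y) x = - lieBr Z X x := by
  rw [lieBr_swap, lieBr_neg_left hX, lieBr_swap (X := Z)]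

theorem lieBr_congr {X' Y' : VecField m M} (hX : ∀ᶠ y in 𝓝 x, X y = X' y)
    (hY : ∀ᶠ y in 𝓝 x, Y y = Y' y) : lieBr X Y x = lieBr X' Y' x :=
  Filter.EventuallyEq.mlieBracket_vectorField_eq hX hY

theorem lieBr_jacobi (hX : SmoothField X x) (hY : SmoothField Y x) (hZ : SmoothField Z x) :
    lieBr X (lieBr Y Z) x = lieBr (lieBr X Y) Z x + lieBr Y (lieBr X Z) x := by
  have h2 : minSmoothness ℝ 2 ≤ (∞ : WithTop ℕ∞) := by
    simp only [minSmoothness_of_isRCLikeNormedField]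
    exact WithTop.coe_le_coe.2 (le_top : (2 : ℕ∞) ≤ ⊤)
  exact VectorField.leibniz_identity_mlieBracket_apply (hX.of_le h2) (hY.of_le h2) (hZ.of_le h2)

end Calculus

/-! ### One-forms and their exterior derivative -/

section Forms
variable {x : M} {X Y Z X' Y' : VecField m M}

/-- The 1-form `η` takes differentiable fields to functions differentiable at `x`. -/
def DiffForm (η : ∀ y : M, Tgt m y →L[ℝ] ℝ) (x : M) : Prop :=
  ∀ X : VecField m M, DiffField X x → DiffFun (m := m) (fun y => η y (X y)) x

/-- The 1-form `η` takes fields smooth at `x` to functions smooth at `x`. -/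
def SmoothForm (η : ∀ y : M, Tgt m y →L[ℝ] ℝ) (x : M) : Prop :=
  ∀ X : VecField m M, SmoothField X x → SmoothFun (m := m) (fun y => η y (X y)) x

/-- Smooth forms are differentiable. -/
theorem SmoothForm.diffForm {η : ∀ y : M, Tgt m y →L[ℝ] ℝ} (h : SmoothForm η x) :
    DiffForm η x := by
  intro X hX
  let e := trivializationAt (EuclideanSpace ℝ (Fin (2 * m + 1)))
    (TangentSpace (𝓡 (2 * m + 1)) : M → Type _) x
  let b := Module.Basis.ofVectorSpace ℝ (EuclideanSpace ℝ (Fin (2 * m + 1)))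
  have hx : x ∈ e.baseSet := mem_baseSet_trivializationAt _ _ _
  -- Expanding X in a smooth local frame leaves differentiable coefficients times values of η on
  -- smooth fields.
  have h1 : ∀ᶠ y in 𝓝 x, η y (X y) =
      ∑ i, e.localFrameCoeff (𝓡 (2 * m + 1)) b i y (X y) * η y (e.localFrame b i y) := by
    filter_upwards [e.eventually_eq_localFrame_sum_coeff_smul (I := 𝓡 (2 * m + 1)) b (s := X) hx]
      with y hy
    conv_lhs => rw [hy]
    simp [map_sum]
  refine MDifferentiableAt.congr_of_eventuallyEq (DiffFun.sum (fun i _ => ?_)) h1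
  refine MDifferentiableAt.mul ?_ ?_
  · exact mdifferentiableAt_localFrameCoeff b hx hX i
  · exact (h _ (contMDiffAt_localFrame_of_mem ∞ _ b i hx)).diff

theorem smoothForm_of_contMDiff {η : ∀ y : M, Tgt m y →L[ℝ] ℝ}
    (h : ContMDiff (𝓡 (2 * m + 1))
    ((𝓡 (2 * m + 1)).prod 𝓘(ℝ, EuclideanSpace ℝ (Fin (2 * m + 1)) →L[ℝ] ℝ)) ∞
    (fun x => TotalSpace.mk' (EuclideanSpace ℝ (Fin (2 * m + 1)) →L[ℝ] ℝ) x (η x))) (x : M) :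
    SmoothForm η x := by
  intro X hX
  have := ContMDiffAt.clm_bundle_apply (E₂ := Bundle.Trivial M ℝ) (F₂ := ℝ) (h x) hX
  have := (contMDiffAt_section x).1 this
  exact this

/-- A 1-form evaluated on two fields, antisymmetrized: the formula for its exterior derivative. -/
theorem tensorialAt_extD_right {η : ∀ y : M, Tgt m y →L[ℝ] ℝ} (hη : DiffForm η x)
    (X : VecField m M) :
    TensorialAt (𝓡 (2 * m + 1)) (EuclideanSpace ℝ (Fin (2 * m + 1))) (A := ℝ)
      (fun Y : VecField m M => dirDeriv (fun y => η y (Y y)) x (X x) -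
        dirDeriv (fun y => η y (X y)) x (Y x) - η x (lieBr X Y x)) x where
  smul {f Y} hf hY := by
    have h1 : (fun y => η y ((f • Y) y)) = fun y => f y * η y (Y y) := by
      funext y; simp
    have h2 : lieBr X (f • Y) x = _ := lieBr_smul_right (Z := X) hf hY
    simp only [h1, h2]
    rw [dirDeriv_mul hf (hη Y hY)]
    simp only [Pi.smul_apply', map_smul, map_add, smul_eq_mul]
    ring
  add {Y Y'} hY hY' := by
    have h1 : (fun y => η y ((Y + Y') y)) = fun y => η y (Y y) + η y (Y' y) := by
      funext y; simp
    have h2 : lieBr X (Y + Y') x = _ := lieBr_add_right (Z := X) hY hY'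
    simp only [h1, h2]
    rw [dirDeriv_add (hη Y hY) (hη Y' hY')]
    simp only [Pi.add_apply, map_add]
    ring

theorem extD_swap (η : ∀ y : M, Tgt m y →L[ℝ] ℝ) (v w : Tgt m x) :
    extD η x v w = - extD η x w v := by
  simp only [extD]
  rw [lieBr_swap, map_neg]
  ring

/-- The exterior derivative of a differentiable 1-form may be computed with arbitrary
differentiable extensions. -/
theorem extD_eq {η : ∀ y : M, Tgt m y →L[ℝ] ℝ} (hη : DiffForm η x)
    (hX : DiffField X x) (hY : DiffField Y x) :
    extD η x (X x) (Y x) = dirDeriv (fun y => η y (Y y)) x (X x) -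
        dirDeriv (fun y => η y (X y)) x (Y x) - η x (lieBr X Y x) := by
  -- The fields are exchanged one slot at a time; antisymmetry transports tensoriality from the
  -- second slot to the first.
  have h1 := (tensorialAt_extD_right hη X).pointwise (diffField_extendVec (Y x)) hY (by simp)
  rw [← h1]
  have h2 := (tensorialAt_extD_right hη (extendVec (Y x))).pointwise
    (diffField_extendVec (X x)) hX (by simp)
  simp only [extendVec_self] at h1 h2 ⊢
  simp only [extD]
  rw [lieBr_swap (X := extendVec (X x)), lieBr_swap (X := X), map_neg, map_neg]
  linarith

theorem extD_add_right {η : ∀ y : M, Tgt m y →L[ℝ] ℝ} (hη : DiffForm η x) (u v w : Tgt m x) :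
    extD η x u (v + w) = extD η x u v + extD η x u w := by
  have h := (tensorialAt_extD_right hη (extendVec u)).add
    (diffField_extendVec v) (diffField_extendVec w)
  have e1 := extD_eq hη (diffField_extendVec u)
    (DiffField.add (diffField_extendVec v) (diffField_extendVec w))
  have e2 := extD_eq hη (diffField_extendVec u) (diffField_extendVec v)
  have e3 := extD_eq hη (diffField_extendVec u) (diffField_extendVec w)
  simp only [extendVec_self] at e1 e2 e3
  rw [e1, e2, e3]
  simpa only [extendVec_self, Pi.add_apply] using! h

theorem extD_smul_right {η : ∀ y : M, Tgt m y →L[ℝ] ℝ} (hη : DiffForm η x) (c : ℝ)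
    (u v : Tgt m x) : extD η x u (c • v) = c * extD η x u v := by
  have hc : DiffFun (m := m) (fun _ : M => c) x := mdifferentiableAt_const
  have h := (tensorialAt_extD_right hη (extendVec u)).smul hc
    (diffField_extendVec v)
  have e1 := extD_eq hη (diffField_extendVec u) (DiffField.smul hc (diffField_extendVec v))
  have e2 := extD_eq hη (diffField_extendVec u) (diffField_extendVec v)
  simp only [extendVec_self] at e1 e2
  rw [e1, e2]
  simpa only [extendVec_self, Pi.smul_apply', smul_eq_mul] using! h

/-- The exterior derivative of a differentiable 1-form at a point as a bilinear form. -/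
def extDBilin (η : ∀ y : M, Tgt m y →L[ℝ] ℝ) (hη : DiffForm η x) :
    Tgt m x →ₗ[ℝ] Tgt m x →ₗ[ℝ] ℝ :=
  LinearMap.mk₂ ℝ (extD η x)
    (fun u v w => by
      rw [extD_swap, extD_add_right hη, neg_add, ← extD_swap, ← extD_swap])
    (fun c u v => by
      rw [extD_swap, extD_smul_right hη, ← mul_neg, ← extD_swap, smul_eq_mul])
    (extD_add_right hη) (fun c u v => by rw [extD_smul_right hη, smul_eq_mul])

theorem extD_add_form {η η' : ∀ y : M, Tgt m y →L[ℝ] ℝ} (hη : DiffForm η x) (hη' : DiffForm η' x)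
    (v w : Tgt m x) : extD (fun y => η y + η' y) x v w = extD η x v w + extD η' x v w := by
  simp only [extD, add_apply]
  rw [dirDeriv_add (hη _ (diffField_extendVec w)) (hη' _ (diffField_extendVec w)),
    dirDeriv_add (hη _ (diffField_extendVec v)) (hη' _ (diffField_extendVec v))]
  ring

theorem extD_smul_form {η : ∀ y : M, Tgt m y →L[ℝ] ℝ} {c : M → ℝ} (hc : DiffFun (m := m) c x)
    (hη : DiffForm η x) (v w : Tgt m x) : extD (fun y => c y • η y) x v w =
      c x * extD η x v w + dirDeriv c x v * η x w - dirDeriv c x w * η x v := by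
  simp only [extD, smul_apply, smul_eq_mul]
  rw [dirDeriv_mul hc (hη _ (diffField_extendVec w)),
    dirDeriv_mul hc (hη _ (diffField_extendVec v))]
  simp only [extendVec_self]
  ring

theorem extD_congr {η η' : ∀ y : M, Tgt m y →L[ℝ] ℝ} (h : ∀ᶠ y in 𝓝 x, η y = η' y)
    (v w : Tgt m x) : extD η x v w = extD η' x v w := by
  have h1 : ∀ X : VecField m M, (fun y => η y (X y)) =ᶠ[𝓝 x] fun y => η' y (X y) := by
    intro X
    filter_upwards [h] with y hy
    rw [hy]
  simp only [extD]
  rw [dirDeriv_congr (h1 _), dirDeriv_congr (h1 _), h.self_of_nhds]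

end Forms

/-! ### Iterated derivatives of functions -/

section Derivatives
variable {x : M} {X Y : VecField m M} {f : M → ℝ}

/-- A device for deducing statements about functions from statements about vector fields: f is
replaced by fW, and η reads f back off. The index 0 exists because the dimension 2m+1 is positive.
-/
theorem exists_smoothField_coeff (x : M) : ∃ (W : VecField m M) (η : ∀ y : M, Tgt m y →ₗ[ℝ] ℝ),
    (∀ᶠ y in 𝓝 x, SmoothField W y ∧ η y (W y) = 1) ∧
      ∀ Y, SmoothField Y x → SmoothFun (m := m) (fun y => η y (Y y)) x := by
  let e := trivializationAt (EuclideanSpace ℝ (Fin (2 * m + 1)))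
    (TangentSpace (𝓡 (2 * m + 1)) : M → Type _) x
  let b := (EuclideanSpace.basisFun (Fin (2 * m + 1)) ℝ).toBasis
  have hx : x ∈ e.baseSet := mem_baseSet_trivializationAt _ _ _
  refine ⟨e.localFrame b 0, e.localFrameCoeff (𝓡 (2 * m + 1)) b 0, ?_, ?_⟩
  · filter_upwards [e.open_baseSet.mem_nhds hx] with y hy
    refine ⟨contMDiffAt_localFrame_of_mem ∞ _ b 0 hy, ?_⟩
    rw [e.localFrameCoeff_apply_of_mem_baseSet b hy, e.localFrame_apply_of_mem_baseSet b hy]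
    simp
  · intro Y hY
    exact contMDiffAt_localFrameCoeff b hx hY 0

theorem SmoothFun.eventually_diff (hf : SmoothFun (m := m) f x) :
    ∀ᶠ y in 𝓝 x, DiffFun (m := m) f y := by
  have h1 : ContMDiffAt (𝓡 (2 * m + 1)) 𝓘(ℝ, ℝ) 1 f x :=
    hf.of_le (WithTop.coe_le_coe.2 (le_top : (1 : ℕ∞) ≤ ⊤))
  filter_upwards [(contMDiffAt_iff_contMDiffAt_nhds (by simp)).1 h1] with y hy
  exact hy.mdifferentiableAt (by simp)

/-- Brackets of smooth fields are smooth, and (Xf)W = [X, fW] - f[X, W]. -/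
theorem SmoothFun.dirDeriv (hf : SmoothFun (m := m) f x) (hX : SmoothField X x) :
    SmoothFun (m := m) (fun y => CR.dirDeriv f y (X y)) x := by
  obtain ⟨W, η, hW, hη⟩ := exists_smoothField_coeff (m := m) x
  have hWx := hW.self_of_nhds.1
  have h1 : SmoothField (fun y => lieBr X (fun z => f z • W z) y - f y • lieBr X W y) x :=
    (hX.lieBr (SmoothField.smul hf hWx)).sub (SmoothField.smul hf (hX.lieBr hWx))
  refine (hη _ h1).congr_of_eventuallyEq ?_
  filter_upwards [hW, hf.eventually_diff] with y hy hfy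
  rw [lieBr_smul_right hfy hy.1.diff]
  simp [hy.2]

/-- This is the W-component of the Jacobi identity for X, Y and fW. -/
theorem dirDeriv_lieBr (hf : SmoothFun (m := m) f x) (hX : SmoothField X x)
    (hY : SmoothField Y x) :
    dirDeriv f x (lieBr X Y x) = dirDeriv (fun y => dirDeriv f y (Y y)) x (X x) -
      dirDeriv (fun y => dirDeriv f y (X y)) x (Y x) := by
  obtain ⟨W, η, hW, hη⟩ := exists_smoothField_coeff (m := m) x
  have hWx := hW.self_of_nhds.1
  have key : ∀ {A B : VecField m M}, SmoothField A x → SmoothField B x →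
      lieBr A (lieBr B (fun z => f z • W z)) x =
        dirDeriv (fun y => dirDeriv f y (B y)) x (A x) • W x +
        dirDeriv f x (B x) • lieBr A W x + dirDeriv f x (A x) • lieBr B W x +
          f x • lieBr A (lieBr B W) x := by
    intro A B hA hB
    have h1 : ∀ᶠ y in 𝓝 x, lieBr B (fun z => f z • W z) y =
        dirDeriv f y (B y) • W y + f y • lieBr B W y := by
      filter_upwards [hW, hf.eventually_diff] with y hy hfy
      rw [lieBr_smul_right hfy hy.1.diff]
    have hBf := (hf.dirDeriv hB).diff
    rw [lieBr_congr (Filter.Eventually.of_forall fun _ => rfl) h1,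
      lieBr_add_right (DiffField.smul hBf hWx.diff)
        (DiffField.smul hf.diff (hB.lieBr hWx).diff),
      lieBr_smul_right hBf hWx.diff, lieBr_smul_right hf.diff (hB.lieBr hWx).diff]
    abel
  have hJ := lieBr_jacobi hX hY (SmoothField.smul hf hWx)
  -- The Jacobi identity for X, Y, W itself removes the terms without derivatives of f; the first
  -- order terms match in pairs, so only multiples of W survive.
  rw [key hX hY, key hY hX, lieBr_smul_right hf.diff hWx.diff, lieBr_jacobi hX hY hWx] at hJ
  have h2 := congrArg (η x) hJ
  simp only [map_add, map_smul, smul_eq_mul, hW.self_of_nhds.2] at h2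
  linarith

end Derivatives

/-! ### Frames of H and the smoothness of J -/

namespace AlmostCRStructure
variable (S : AlmostCRStructure m M) {x₀ x y : M} {X Y : VecField m M} {U : Set M}

theorem holFrame_mem (hy : y ∈ S.frameDomain x₀) (α : Fin m) : S.holFrame x₀ α y ∈ S.H y := by
  rw [(S.frame_spec x₀).2.2.2 y hy]
  exact Submodule.subset_span (Or.inl ⟨α, rfl⟩)

theorem smooth_transverse (hy : y ∈ S.frameDomain x₀) : SmoothField (S.transverse x₀) y :=
  (S.frame_spec x₀).2.2.1.contMDiffAt (S.frame_spec x₀).1 hy none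

theorem smooth_holFrame (hy : y ∈ S.frameDomain x₀) (α : Fin m) :
    SmoothField (S.holFrame x₀ α) y :=
  (S.frame_spec x₀).2.2.1.contMDiffAt (S.frame_spec x₀).1 hy (some (Sum.inl α))

theorem smooth_J_holFrame (hy : y ∈ S.frameDomain x₀) (α : Fin m) :
    SmoothField (S.JF (S.holFrame x₀ α)) y :=
  (S.frame_spec x₀).2.2.1.contMDiffAt (S.frame_spec x₀).1 hy (some (Sum.inr α))

/-- The coefficient along the transverse field of the frame. -/
abbrev coeffTrans (x₀ y : M) : Tgt m y →ₗ[ℝ] ℝ := (S.frame_spec x₀).2.2.1.coeff none y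

/-- The coefficient along `Z_α` of the frame. -/
abbrev coeffRe (x₀ : M) (α : Fin m) (y : M) : Tgt m y →ₗ[ℝ] ℝ :=
  (S.frame_spec x₀).2.2.1.coeff (some (Sum.inl α)) y

/-- The coefficient along `J Z_α` of the frame. -/
abbrev coeffIm (x₀ : M) (α : Fin m) (y : M) : Tgt m y →ₗ[ℝ] ℝ :=
  (S.frame_spec x₀).2.2.1.coeff (some (Sum.inr α)) y

theorem frame_expansion (hy : y ∈ S.frameDomain x₀) (v : Tgt m y) :
    v = S.coeffTrans x₀ y v • S.transverse x₀ y +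
      ∑ α, (S.coeffRe x₀ α y v • S.holFrame x₀ α y +
        S.coeffIm x₀ α y v • S.J y (S.holFrame x₀ α y)) := by
  have h := ((S.frame_spec x₀).2.2.1.toBasisAt hy).sum_repr v
  rw [Fintype.sum_option, Fintype.sum_sum_type, ← Finset.sum_add_distrib] at h
  simp only [IsLocalFrameOn.toBasisAt_coe, complexFrame] at h
  simp only [coeffTrans, coeffRe, coeffIm, IsLocalFrameOn.coeff, hy, dif_pos, Module.Basis.coord_apply]
  exact h.symm

theorem coeffTrans_eq_zero (hy : y ∈ S.frameDomain x₀) {v : Tgt m y} (hv : v ∈ S.H y) :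
    S.coeffTrans x₀ y v = 0 := by
  have hn := S.coeff_frame hy none
  rw [(S.frame_spec x₀).2.2.2 y hy] at hv
  have : Submodule.span ℝ (Set.range (fun α => S.holFrame x₀ α y) ∪
        Set.range (fun α => S.J y (S.holFrame x₀ α y))) ≤ LinearMap.ker (S.coeffTrans x₀ y) := by
    rw [Submodule.span_le]
    rintro w (⟨α, rfl⟩ | ⟨α, rfl⟩)
    · simpa [complexFrame] using hn (some (Sum.inl α))
    · simpa [complexFrame] using hn (some (Sum.inr α))
  exact this hv

theorem hol_expansion (hy : y ∈ S.frameDomain x₀) {v : Tgt m y} (hv : v ∈ S.H y) :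
    v = ∑ α, (S.coeffRe x₀ α y v • S.holFrame x₀ α y +
        S.coeffIm x₀ α y v • S.J y (S.holFrame x₀ α y)) := by
  have h := S.frame_expansion hy v
  rw [S.coeffTrans_eq_zero hy hv, zero_smul, zero_add] at h
  exact h

theorem coeffRe_J (x₀ : M) {v : Tgt m y} (hv : v ∈ S.H y) (α : Fin m) :
    S.coeffRe x₀ α y (S.J y v) = - S.coeffIm x₀ α y v := by
  have h := congrFun (S.coframe_J x₀ y v hv) α.succ
  simp only [coframe_succ, Pi.smul_apply, smul_eq_mul] at h
  have := congrArg Complex.re h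
  simpa using this

theorem coeffIm_J (x₀ : M) {v : Tgt m y} (hv : v ∈ S.H y) (α : Fin m) :
    S.coeffIm x₀ α y (S.J y v) = S.coeffRe x₀ α y v := by
  have h := congrFun (S.coframe_J x₀ y v hv) α.succ
  simp only [coframe_succ, Pi.smul_apply, smul_eq_mul] at h
  have := congrArg Complex.im h
  simpa using this

variable {S}

theorem IsSection.smoothField (hU : IsOpen U) (hX : S.IsSection U X) (hy : y ∈ U) :
    SmoothField X y := hX.smooth.contMDiffAt (hU.mem_nhds hy)

theorem isSection_of_smoothField (h : ∀ y ∈ U, SmoothField X y) (h' : ∀ y ∈ U, X y ∈ S.H y) :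
    S.IsSection U X := ⟨fun y hy => (h y hy).contMDiffWithinAt, h'⟩

theorem IsSection.mono {V : Set M} (hX : S.IsSection U X) (h : V ⊆ U) : S.IsSection V X :=
  ⟨hX.smooth.mono h, fun y hy => hX.mem y (h hy)⟩

variable (S)

theorem coeff_smooth (hy : y ∈ S.frameDomain x₀) (hX : SmoothField X y)
    (i : Option (Fin m ⊕ Fin m)) :
    SmoothFun (m := m) (fun z => (S.frame_spec x₀).2.2.1.coeff i z (X z)) y :=
  contMDiffAt_frameCoeff _ ((S.frame_spec x₀).1.mem_nhds hy) hX i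

/-- A frame coefficient is a form that is smooth on smooth fields, and such forms are differentiable
on differentiable fields. -/
theorem coeff_diff (hy : y ∈ S.frameDomain x₀) (hX : DiffField X y)
    (i : Option (Fin m ⊕ Fin m)) :
    DiffFun (m := m) (fun z => (S.frame_spec x₀).2.2.1.coeff i z (X z)) y := by
  have : SmoothForm (fun z => LinearMap.toContinuousLinearMap
      ((S.frame_spec x₀).2.2.1.coeff i z)) y := fun X hX => S.coeff_smooth hy hX i
  exact this.diffForm X hX

theorem SmoothField.sum {ι : Type*} {s : Finset ι} {X : ι → VecField m M}
    (h : ∀ i ∈ s, SmoothField (X i) y) : SmoothField (fun z => ∑ i ∈ s, X i z) y :=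
  ContMDiffAt.sum_section h

theorem DiffField.sum {ι : Type*} {s : Finset ι} {X : ι → VecField m M}
    (h : ∀ i ∈ s, DiffField (X i) y) : DiffField (fun z => ∑ i ∈ s, X i z) y :=
  MDifferentiableAt.sum_section h

/-- `J` in terms of the frame. -/
theorem J_expansion (hy : y ∈ S.frameDomain x₀) {v : Tgt m y} (hv : v ∈ S.H y) :
    S.J y v = ∑ α, (S.coeffRe x₀ α y v • S.J y (S.holFrame x₀ α y) -
        S.coeffIm x₀ α y v • S.holFrame x₀ α y) := by
  conv_lhs => rw [S.hol_expansion hy hv]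
  rw [map_sum]
  refine Finset.sum_congr rfl fun α _ => ?_
  rw [map_add, map_smul, map_smul, S.J_J _ _ (S.holFrame_mem hy α), smul_neg, sub_eq_add_neg]

/-- Off H the maps `S.J y` are arbitrary and need not depend smoothly on y, so X must lie in H near
x. There J only permutes the smooth frame fields, up to sign. -/
theorem smooth_J (hX : SmoothField X x) (hH : ∀ᶠ y in 𝓝 x, X y ∈ S.H y) :
    SmoothField (S.JF X) x := by
  obtain ⟨hU, hx, -, -⟩ := S.frame_spec x
  have h1 : SmoothField (fun z => ∑ α, (S.coeffRe x α z (X z) • S.J z (S.holFrame x α z) -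
        S.coeffIm x α z (X z) • S.holFrame x α z)) x := by
    refine SmoothField.sum fun α _ => SmoothField.sub ?_ ?_
    · exact SmoothField.smul (S.coeff_smooth hx hX _) (S.smooth_J_holFrame hx α)
    · exact SmoothField.smul (S.coeff_smooth hx hX _) (S.smooth_holFrame hx α)
  refine h1.congr ?_
  filter_upwards [hH, hU.mem_nhds hx] with z hz hzU
  exact S.J_expansion hzU hz

theorem diff_J (hX : DiffField X x) (hH : ∀ᶠ y in 𝓝 x, X y ∈ S.H y) :
    DiffField (S.JF X) x := by
  obtain ⟨hU, hx, -, -⟩ := S.frame_spec x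
  have h1 : DiffField (fun z => ∑ α, (S.coeffRe x α z (X z) • S.J z (S.holFrame x α z) -
        S.coeffIm x α z (X z) • S.holFrame x α z)) x := by
    refine DiffField.sum fun α _ => DiffField.sub ?_ ?_
    · exact DiffField.smul (S.coeff_diff hx hX _) (S.smooth_J_holFrame hx α).diff
    · exact DiffField.smul (S.coeff_diff hx hX _) (S.smooth_holFrame hx α).diff
  refine h1.congr ?_
  filter_upwards [hH, hU.mem_nhds hx] with z hz hzU
  exact S.J_expansion hzU hz

variable {S}

theorem IsSection.JF (hU : IsOpen U) (hX : S.IsSection U X) : S.IsSection U (S.JF X) :=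
  isSection_of_smoothField
    (fun _ hy => S.smooth_J (hX.smoothField hU hy)
      (Filter.eventually_of_mem (hU.mem_nhds hy) hX.mem))
    (fun y hy => S.J_mem y _ (hX.mem y hy))

variable (S)

/-- Every vector of `H` extends to a section of `H` over the frame domain. -/
theorem exists_section (x₀ : M) (hx : x ∈ S.frameDomain x₀) {v : Tgt m x} (hv : v ∈ S.H x) :
    ∃ X, S.IsSection (S.frameDomain x₀) X ∧ X x = v := by
  refine ⟨fun y => ∑ α, (S.coeffRe x₀ α x v • S.holFrame x₀ α y +
        S.coeffIm x₀ α x v • S.J y (S.holFrame x₀ α y)), isSection_of_smoothField ?_ ?_,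
    (S.hol_expansion hx hv).symm⟩
  · intro y hy
    refine SmoothField.sum fun α _ => SmoothField.add ?_ ?_
    · exact SmoothField.smul contMDiffAt_const (S.smooth_holFrame hy α)
    · exact SmoothField.smul contMDiffAt_const (S.smooth_J_holFrame hy α)
  · intro y hy
    exact Submodule.sum_mem _ fun α _ => Submodule.add_mem _
      (Submodule.smul_mem _ _ (S.holFrame_mem hy α))
      (Submodule.smul_mem _ _ (S.J_mem _ _ (S.holFrame_mem hy α)))

end AlmostCRStructure

/-- Riesz representation on H: a form nondegenerate on H embeds H into its dual, and the dimensions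
agree. It produces the Reeb field, the gradient and the connection. -/
theorem exists_mem_forall_eq {V : Type*} [AddCommGroup V] [Module ℝ V] [FiniteDimensional ℝ V]
    (H : Submodule ℝ V) (B : V →ₗ[ℝ] V →ₗ[ℝ] ℝ)
    (hB : ∀ v ∈ H, (∀ w ∈ H, B v w = 0) → v = 0) (φ : V →ₗ[ℝ] ℝ) :
    ∃ v ∈ H, ∀ w ∈ H, B v w = φ w := by
  let A : H →ₗ[ℝ] Module.Dual ℝ H := B.compl₁₂ H.subtype H.subtype
  have hA : Function.Injective A := by
    rw [injective_iff_map_eq_zero]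
    intro v hv
    exact Subtype.ext (hB v v.2 fun w hw => DFunLike.congr_fun hv ⟨w, hw⟩)
  have hA' : Function.Surjective A :=
    (LinearMap.injective_iff_surjective_of_finrank_eq_finrank
      (Subspace.dual_finrank_eq (K := ℝ) (V := H)).symm).1 hA
  obtain ⟨W, hW⟩ := hA' (φ.comp H.subtype)
  exact ⟨W, W.2, fun w hw => DFunLike.congr_fun hW ⟨w, hw⟩⟩

theorem SmoothField.eventually_diff {x : M} {X : VecField m M} (hX : SmoothField X x) :
    ∀ᶠ y in 𝓝 x, DiffField X y := by
  have h1 := ContMDiffAt.of_le hX (WithTop.coe_le_coe.2 (le_top : (1 : ℕ∞) ≤ ⊤))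
  filter_upwards [(contMDiffAt_iff_contMDiffAt_nhds (by simp)).1 h1] with y hy
  exact hy.mdifferentiableAt (by simp)

/-! ### Pointwise algebra of a pseudo-Hermitian form: Reeb field, projection, Levi form -/

namespace AlmostCRStructure
namespace PseudoHermitian
variable {S : AlmostCRStructure m M} (θ : S.PseudoHermitian) {x₀ x y : M} {X Y Z : VecField m M}
  {U : Set M}

theorem smoothForm (x : M) : SmoothForm θ.form x := smoothForm_of_contMDiff θ.smooth x

theorem diffForm (x : M) : DiffForm θ.form x := (θ.smoothForm x).diffForm

/-- The bilinear form `dθ` at a point. -/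
def dform (x : M) : Tgt m x →ₗ[ℝ] Tgt m x →ₗ[ℝ] ℝ := extDBilin θ.form (θ.diffForm x)

theorem dform_apply (v w : Tgt m x) : θ.dform x v w = extD θ.form x v w := rfl

theorem dform_swap (v w : Tgt m x) : θ.dform x v w = - θ.dform x w v := extD_swap _ _ _

theorem dform_pos {v : Tgt m x} (hv : v ∈ S.H x) (h : v ≠ 0) : 0 < θ.dform x v (S.J x v) :=
  θ.pos x v hv h

theorem form_transverse_ne_zero (hy : y ∈ S.frameDomain x₀) :
    θ.form y (S.transverse x₀ y) ≠ 0 := by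
  intro h
  apply θ.ne_zero y
  ext v
  rw [S.frame_expansion hy v, map_add, map_smul, h, smul_zero, zero_add]
  refine θ.vanish y _ (Submodule.sum_mem _ fun α _ => Submodule.add_mem _
      (Submodule.smul_mem _ _ (S.holFrame_mem hy α))
      (Submodule.smul_mem _ _ (S.J_mem _ _ (S.holFrame_mem hy α))))

theorem form_eq_zero_iff {v : Tgt m x} : θ.form x v = 0 ↔ v ∈ S.H x := by
  refine ⟨fun h => ?_, fun h => θ.vanish x v h⟩
  have hx := (S.frame_spec x).2.1
  have hs : ∑ α, (S.coeffRe x α x v • S.holFrame x α x +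
        S.coeffIm x α x v • S.J x (S.holFrame x α x)) ∈ S.H x :=
    Submodule.sum_mem _ fun α _ => Submodule.add_mem _
      (Submodule.smul_mem _ _ (S.holFrame_mem hx α))
      (Submodule.smul_mem _ _ (S.J_mem _ _ (S.holFrame_mem hx α)))
  have h1 := S.frame_expansion hx v
  have h2 := congrArg (θ.form x) h1
  rw [h, map_add, map_smul, θ.vanish x _ hs, add_zero, smul_eq_mul] at h2
  have h3 : S.coeffTrans x x v = 0 :=
    (mul_eq_zero.1 h2.symm).resolve_right (θ.form_transverse_ne_zero hx)
  rw [h1, h3, zero_smul, zero_add]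
  exact hs

/-- The functions θ(X) and θ(Y) vanish near x, so only the bracket term of the formula for dθ
survives. -/
theorem dform_section (hX : DiffField X x) (hY : DiffField Y x) (hX' : ∀ᶠ y in 𝓝 x, X y ∈ S.H y)
    (hY' : ∀ᶠ y in 𝓝 x, Y y ∈ S.H y) :
    θ.dform x (X x) (Y x) = - θ.form x (lieBr X Y x) := by
  have h0 : ∀ {A : VecField m M}, (∀ᶠ y in 𝓝 x, A y ∈ S.H y) →
      (fun y => θ.form y (A y)) =ᶠ[𝓝 x] fun _ => (0 : ℝ) := fun hA => by
    filter_upwards [hA] with y hy using θ.vanish y _ hy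
  rw [dform_apply, extD_eq (θ.diffForm x) hX hY, dirDeriv_congr (h0 hX'), dirDeriv_congr (h0 hY'),
    dirDeriv_const, dirDeriv_const]
  ring

/-- Nondegeneracy of `dθ` on `H`. -/
theorem eq_zero_of_dform {v : Tgt m x} (hv : v ∈ S.H x) (h : ∀ w ∈ S.H x, θ.dform x v w = 0) :
    v = 0 := by
  by_contra hne
  exact (θ.dform_pos hv hne).ne' (h _ (S.J_mem x v hv))

/-- Normalise a transverse vector to ξ₀ with θ(ξ₀) = 1 and subtract the W in H that has the same
dθ-pairings with H as ξ₀. Pairings with the remaining direction, ξ₀ - W itself, vanish by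
antisymmetry. -/
theorem exists_reeb (x : M) :
    ∃ T : Tgt m x, θ.form x T = 1 ∧ ∀ v, extD θ.form x T v = 0 := by
  have hx := (S.frame_spec x).2.1
  have hξ := θ.form_transverse_ne_zero hx
  set ξ₀ : Tgt m x := (θ.form x (S.transverse x x))⁻¹ • S.transverse x x with hξ₀
  have h1 : θ.form x ξ₀ = 1 := by rw [hξ₀, map_smul, smul_eq_mul, inv_mul_cancel₀ hξ]
  obtain ⟨W, hWH, hW⟩ := exists_mem_forall_eq (S.H x) (θ.dform x)
    (fun v hv h => θ.eq_zero_of_dform hv h) (θ.dform x ξ₀)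
  refine ⟨ξ₀ - W, by rw [map_sub, h1, θ.vanish x _ hWH, sub_zero], fun v => ?_⟩
  have hH : ∀ w ∈ S.H x, θ.dform x (ξ₀ - W) w = 0 := by
    intro w hw
    rw [map_sub, LinearMap.sub_apply, hW w hw, sub_self]
  have hT : θ.form x (ξ₀ - W) = 1 := by rw [map_sub, h1, θ.vanish x _ hWH, sub_zero]
  have hd : v - θ.form x v • (ξ₀ - W) ∈ S.H x := by
    rw [← θ.form_eq_zero_iff, map_sub, map_smul, hT, smul_eq_mul, mul_one, sub_self]
  have h2 := hH _ hd
  have h3 : θ.dform x (ξ₀ - W) (ξ₀ - W) = 0 := by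
    have := θ.dform_swap (ξ₀ - W) (ξ₀ - W)
    linarith
  rw [map_sub, map_smul, h3, smul_zero, sub_zero] at h2
  exact h2

theorem form_reeb (x : M) : θ.form x (θ.reeb x) = 1 :=
  (Classical.epsilon_spec (θ.exists_reeb x)).1

theorem dform_reeb_left (v : Tgt m x) : θ.dform x (θ.reeb x) v = 0 :=
  (Classical.epsilon_spec (θ.exists_reeb x)).2 v

theorem dform_reeb_right (v : Tgt m x) : θ.dform x v (θ.reeb x) = 0 := by
  rw [dform_swap, dform_reeb_left, neg_zero]

/-- The projection of `TM` to `H` along the Reeb field. -/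
def hproj (x : M) : Tgt m x →ₗ[ℝ] Tgt m x :=
  LinearMap.id - (θ.form x : Tgt m x →ₗ[ℝ] ℝ).smulRight (θ.reeb x)

theorem hproj_apply (v : Tgt m x) : θ.hproj x v = v - θ.form x v • θ.reeb x := rfl

theorem hproj_mem (v : Tgt m x) : θ.hproj x v ∈ S.H x := by
  rw [← θ.form_eq_zero_iff, hproj_apply, map_sub, map_smul, form_reeb, smul_eq_mul, mul_one, sub_self]

theorem hproj_of_mem {v : Tgt m x} (hv : v ∈ S.H x) : θ.hproj x v = v := by
  rw [hproj_apply, θ.vanish x v hv, zero_smul, sub_zero]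

theorem hproj_reeb : θ.hproj x (θ.reeb x) = 0 := by
  rw [hproj_apply, form_reeb, one_smul, sub_self]

theorem eq_hproj_add (v : Tgt m x) : v = θ.hproj x v + θ.form x v • θ.reeb x := by
  rw [hproj_apply, sub_add_cancel]

/-- The extension of `J` to `TM` which annihilates the Reeb field. -/
def phi (x : M) : Tgt m x →ₗ[ℝ] Tgt m x := S.J x ∘ₗ θ.hproj x

theorem phi_apply (v : Tgt m x) : θ.phi x v = S.J x (θ.hproj x v) := rfl

theorem phi_of_mem {v : Tgt m x} (hv : v ∈ S.H x) : θ.phi x v = S.J x v := by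
  rw [phi_apply, hproj_of_mem _ hv]

theorem phi_mem (v : Tgt m x) : θ.phi x v ∈ S.H x := S.J_mem _ _ (θ.hproj_mem v)

theorem phi_phi (v : Tgt m x) : θ.phi x (θ.phi x v) = - θ.hproj x v := by
  rw [phi_of_mem _ (θ.phi_mem v), phi_apply, S.J_J _ _ (θ.hproj_mem v)]

theorem phi_hproj (v : Tgt m x) : θ.phi x (θ.hproj x v) = θ.phi x v := by
  rw [phi_apply, hproj_of_mem _ (θ.hproj_mem v), phi_apply]

theorem hproj_phi (v : Tgt m x) : θ.hproj x (θ.phi x v) = θ.phi x v :=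
  θ.hproj_of_mem (θ.phi_mem v)

theorem phi_reeb : θ.phi x (θ.reeb x) = 0 := by rw [phi_apply, hproj_reeb, map_zero]

theorem dform_hproj_left (v w : Tgt m x) : θ.dform x (θ.hproj x v) w = θ.dform x v w := by
  rw [hproj_apply, map_sub, map_smul, LinearMap.sub_apply, LinearMap.smul_apply, dform_reeb_left,
    smul_zero, sub_zero]

theorem dform_hproj_right (v w : Tgt m x) : θ.dform x v (θ.hproj x w) = θ.dform x v w := by
  rw [dform_swap, dform_hproj_left, ← dform_swap]

/-- The Levi form as a bilinear form. -/
def leviForm (x : M) : Tgt m x →ₗ[ℝ] Tgt m x →ₗ[ℝ] ℝ  :=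
  LinearMap.mk₂ ℝ (fun v w => θ.dform x v (θ.phi x w))
    (fun u v w => by rw [map_add, LinearMap.add_apply])
    (fun c u v => by rw [map_smul, LinearMap.smul_apply])
    (fun u v w => by rw [map_add, map_add])
    (fun c u v => by rw [map_smul, map_smul])

theorem leviForm_apply (v w : Tgt m x) : θ.leviForm x v w = θ.levi x v w := rfl

theorem leviForm_eq (v w : Tgt m x) : θ.leviForm x v w = θ.dform x v (θ.phi x w) := rfl

theorem leviForm_phi_right (v w : Tgt m x) : θ.leviForm x v (θ.phi x w) = - θ.dform x v w := by
  rw [leviForm_eq, phi_phi, map_neg, dform_hproj_right]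

theorem leviForm_reeb_left (v : Tgt m x) : θ.leviForm x (θ.reeb x) v = 0 := by
  rw [leviForm_eq, dform_reeb_left]

theorem leviForm_reeb_right (v : Tgt m x) : θ.leviForm x v (θ.reeb x) = 0 := by
  rw [leviForm_eq, phi_reeb, map_zero]

theorem leviForm_hproj_left (v w : Tgt m x) :
    θ.leviForm x (θ.hproj x v) w = θ.leviForm x v w := by
  rw [leviForm_eq, dform_hproj_left, leviForm_eq]

theorem leviForm_hproj_right (v w : Tgt m x) :
    θ.leviForm x v (θ.hproj x w) = θ.leviForm x v w := by
  rw [leviForm_eq, phi_hproj, leviForm_eq]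

theorem leviForm_pos {v : Tgt m x} (hv : v ∈ S.H x) (h : v ≠ 0) : 0 < θ.leviForm x v v := by
  rw [leviForm_eq, phi_of_mem _ hv]
  exact θ.dform_pos hv h

theorem eq_of_leviForm {v w : Tgt m x} (hv : v ∈ S.H x) (hw : w ∈ S.H x)
    (h : ∀ z ∈ S.H x, θ.leviForm x v z = θ.leviForm x w z) : v = w := by
  by_contra hne
  have hd := (S.H x).sub_mem hv hw
  refine (θ.leviForm_pos hd (sub_ne_zero.2 hne)).ne' ?_
  have h1 := h _ hd
  rw [LinearMap.map_sub₂, h1, sub_self]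

section Integrable
variable (hS : S.IsPartiallyIntegrable)
include hS

/-- Partial integrability is unfolded here: [X,Y] and [JX,JY] have the same θ-component, and dθ on H
is minus the θ-component of the bracket. -/
theorem dform_J_J {v w : Tgt m x} (hv : v ∈ S.H x) (hw : w ∈ S.H x) :
    θ.dform x (S.J x v) (S.J x w) = θ.dform x v w := by
  obtain ⟨hU, hx, -, -⟩ := S.frame_spec x
  obtain ⟨X, hX, rfl⟩ := S.exists_section x hx hv
  obtain ⟨Y, hY, rfl⟩ := S.exists_section x hx hw
  have h := hS _ X Y hU hX hY x hx
  rw [← θ.form_eq_zero_iff, map_sub] at h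
  have hm : ∀ {A : VecField m M}, S.IsSection (S.frameDomain x) A →
      ∀ᶠ y in 𝓝 x, A y ∈ S.H y := fun hA =>
    Filter.eventually_of_mem (hU.mem_nhds hx) hA.mem
  have h1 := θ.dform_section (hX.smoothField hU hx).diff (hY.smoothField hU hx).diff (hm hX) (hm hY)
  have hJX := hX.JF hU
  have hJY := hY.JF hU
  have h2 := θ.dform_section (hJX.smoothField hU hx).diff (hJY.smoothField hU hx).diff
    (hm hJX) (hm hJY)
  rw [h1, h2]
  linarith

theorem dform_phi_phi (v w : Tgt m x) : θ.dform x (θ.phi x v) (θ.phi x w) = θ.dform x v w := by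
  rw [phi_apply, phi_apply, θ.dform_J_J hS (θ.hproj_mem v) (θ.hproj_mem w), dform_hproj_left,
    dform_hproj_right]

theorem leviForm_phi_left (v w : Tgt m x) : θ.leviForm x (θ.phi x v) w = θ.dform x v w := by
  rw [leviForm_eq, θ.dform_phi_phi hS]

/-- Symmetry is not built into the definition; it combines the φ-invariance of dθ, φ² = -h and
antisymmetry. -/
theorem leviForm_symm (v w : Tgt m x) : θ.leviForm x v w = θ.leviForm x w v := by
  rw [leviForm_eq, ← θ.dform_phi_phi hS, phi_phi, map_neg, dform_hproj_right, ← dform_swap,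
    leviForm_eq]

theorem leviForm_phi_phi (v w : Tgt m x) :
    θ.leviForm x (θ.phi x v) (θ.phi x w) = θ.leviForm x v w := by
  rw [leviForm_eq, θ.dform_phi_phi hS, leviForm_eq]

end Integrable

end PseudoHermitian
end AlmostCRStructure

/-! ### Smoothness of dθ, of the Reeb field and of φ -/

namespace AlmostCRStructure
namespace PseudoHermitian
variable {S : AlmostCRStructure m M} (θ : S.PseudoHermitian) {x₀ x y : M} {X Y Z : VecField m M}
  {U : Set M}

theorem smooth_dform (hX : SmoothField X x) (hY : SmoothField Y x) :
    SmoothFun (m := m) (fun y => θ.dform y (X y) (Y y)) x := by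
  have h1 : SmoothFun (m := m) (fun y => dirDeriv (fun z => θ.form z (Y z)) y (X y) -
      dirDeriv (fun z => θ.form z (X z)) y (Y y) - θ.form y (lieBr X Y y)) x :=
    (((θ.smoothForm x Y hY).dirDeriv hX).sub ((θ.smoothForm x X hX).dirDeriv hY)).sub
      (θ.smoothForm x _ (hX.lieBr hY))
  refine h1.congr_of_eventuallyEq ?_
  filter_upwards [hX.eventually_diff, hY.eventually_diff] with y hXy hYy
  exact extD_eq (θ.diffForm y) hXy hYy

/-- The real frame `(Z_α, J Z_α)` of `H`. -/
def _root_.CR.AlmostCRStructure.realFrame (S : AlmostCRStructure m M) (x₀ : M)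
    (j : Fin m ⊕ Fin m) : VecField m M :=
  complexFrame S.J (S.transverse x₀) (S.holFrame x₀) (some j)

theorem _root_.CR.AlmostCRStructure.realFrame_mem (S : AlmostCRStructure m M)
    (hy : y ∈ S.frameDomain x₀) (j : Fin m ⊕ Fin m) : S.realFrame x₀ j y ∈ S.H y := by
  rcases j with α | α
  · exact S.holFrame_mem hy α
  · exact S.J_mem _ _ (S.holFrame_mem hy α)

theorem _root_.CR.AlmostCRStructure.smooth_realFrame (S : AlmostCRStructure m M)
    (hy : y ∈ S.frameDomain x₀) (j : Fin m ⊕ Fin m) : SmoothField (S.realFrame x₀ j) y :=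
  (S.frame_spec x₀).2.2.1.contMDiffAt (S.frame_spec x₀).1 hy (some j)

theorem _root_.CR.AlmostCRStructure.realFrame_expansion (S : AlmostCRStructure m M)
    (hy : y ∈ S.frameDomain x₀) {v : Tgt m y} (hv : v ∈ S.H y) :
    v = ∑ j, (S.frame_spec x₀).2.2.1.coeff (some j) y v • S.realFrame x₀ j y := by
  rw [Fintype.sum_sum_type, ← Finset.sum_add_distrib]
  exact S.hol_expansion hy hv

theorem _root_.CR.AlmostCRStructure.coeff_realFrame_sum (S : AlmostCRStructure m M)
    (hy : y ∈ S.frameDomain x₀) (c : Fin m ⊕ Fin m → ℝ) (j : Fin m ⊕ Fin m) :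
    (S.frame_spec x₀).2.2.1.coeff (some j) y (∑ k, c k • S.realFrame x₀ k y) = c j := by
  rw [map_sum, Finset.sum_eq_single j]
  · rw [map_smul, realFrame, S.coeff_frame hy]
    simp
  · intro k _ hk
    rw [map_smul, realFrame, S.coeff_frame hy]
    simp [hk]
  · simp

theorem _root_.CR.SmoothFun.det {ι : Type*} [Fintype ι] [DecidableEq ι] {A : M → ι → ι → ℝ}
    (hA : ∀ i j, SmoothFun (m := m) (fun y => A y i j) x) :
    SmoothFun (m := m) (fun y => Matrix.det (Matrix.of (A y))) x := by
  have hdet : ContDiff ℝ ∞ (fun A : ι → ι → ℝ => Matrix.det (Matrix.of A)) := by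
    simp only [Matrix.det_apply, Matrix.of_apply]
    fun_prop
  exact (hdet.contMDiff.contMDiffAt).comp x
    (contMDiffAt_pi_space.2 fun k => contMDiffAt_pi_space.2 fun l => hA k l)

/-- A section of `H` is smooth if its pairings with a frame of `H` are smooth. -/
theorem smooth_of_dform (hx : x ∈ S.frameDomain x₀) (hX : ∀ᶠ y in 𝓝 x, X y ∈ S.H y)
    (h : ∀ j, SmoothFun (m := m) (fun y => θ.dform y (X y) (S.realFrame x₀ j y)) x) :
    SmoothField X x := by
  classical
  have hU := (S.frame_spec x₀).1.mem_nhds hx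
  let A : M → Fin m ⊕ Fin m → Fin m ⊕ Fin m → ℝ := fun y k j =>
    θ.dform y (S.realFrame x₀ j y) (S.realFrame x₀ k y)
  let b : M → Fin m ⊕ Fin m → ℝ := fun y k => θ.dform y (X y) (S.realFrame x₀ k y)
  let c : M → Fin m ⊕ Fin m → ℝ := fun y j => (S.frame_spec x₀).2.2.1.coeff (some j) y (X y)
  have hA : ∀ k j, SmoothFun (m := m) (fun y => A y k j) x := fun k j =>
    θ.smooth_dform (S.smooth_realFrame hx j) (S.smooth_realFrame hx k)
  -- A kernel vector of the Gram matrix would give a vector of H that is dθ-orthogonal to all of H.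
  have hdet : ∀ y ∈ S.frameDomain x₀, Matrix.det (Matrix.of (A y)) ≠ 0 := by
    intro y hy h0
    obtain ⟨v, hv, hv0⟩ := Matrix.exists_mulVec_eq_zero_iff.2 h0
    set V : Tgt m y := ∑ j, v j • S.realFrame x₀ j y with hV
    have hVH : V ∈ S.H y := Submodule.sum_mem _ fun j _ =>
      Submodule.smul_mem _ _ (S.realFrame_mem hy j)
    have h1 : ∀ k, θ.dform y V (S.realFrame x₀ k y) = 0 := by
      intro k
      have := congrFun hv0 k
      rw [hV, map_sum, LinearMap.sum_apply]
      simp only [Matrix.mulVec, dotProduct, Matrix.of_apply, A, Pi.zero_apply] at this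
      rw [← this]
      refine Finset.sum_congr rfl fun j _ => ?_
      rw [map_smul, LinearMap.smul_apply, smul_eq_mul, mul_comm]
    have h2 : V = 0 := θ.eq_zero_of_dform hVH fun w hw => by
      rw [S.realFrame_expansion hy hw, map_sum]
      exact Finset.sum_eq_zero fun k _ => by rw [map_smul, h1, smul_zero]
    apply hv
    funext j
    rw [← S.coeff_realFrame_sum hy v j, ← hV, h2, map_zero]
    rfl
  have hmul : ∀ y ∈ S.frameDomain x₀, X y ∈ S.H y → Matrix.mulVec (Matrix.of (A y)) (c y) = b y := by
    intro y hy hXy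
    funext k
    simp only [Matrix.mulVec, dotProduct, Matrix.of_apply, A, b]
    conv_rhs => rw [S.realFrame_expansion hy hXy, map_sum, LinearMap.sum_apply]
    refine Finset.sum_congr rfl fun j _ => ?_
    rw [map_smul, LinearMap.smul_apply, smul_eq_mul, mul_comm]
  have hc : ∀ j, SmoothFun (m := m) (fun y => c y j) x := by
    intro j
    -- By Cramer's rule the frame coefficients of X are quotients of determinants with smooth
    -- entries.
    have h1 : SmoothFun (m := m) (fun y => Matrix.det (Matrix.of
        (fun k l => if l = j then b y k else A y k l)) / Matrix.det (Matrix.of (A y))) x := by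
      refine ContMDiffAt.div₀ (SmoothFun.det fun k l => ?_) (SmoothFun.det hA) (hdet x hx)
      by_cases hl : l = j
      · simp only [hl, if_true]; exact h k
      · simp only [hl, if_false]; exact hA k l
    refine h1.congr_of_eventuallyEq ?_
    filter_upwards [hU, hX] with y hy hXy
    rw [eq_div_iff (hdet y hy)]
    have h2 : (Matrix.of (fun k l => if l = j then b y k else A y k l) :
        Matrix (Fin m ⊕ Fin m) (Fin m ⊕ Fin m) ℝ) = (Matrix.of (A y)).updateCol j (b y) := by
      ext k l
      by_cases hl : l = j <;> simp [hl]
    rw [h2, ← Matrix.cramer_apply, ← hmul y hy hXy, Matrix.cramer_eq_adjugate_mulVec,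
      Matrix.mulVec_mulVec, Matrix.adjugate_mul, Matrix.smul_mulVec, Matrix.one_mulVec,
      Pi.smul_apply, smul_eq_mul, mul_comm]
  have h1 : SmoothField (fun y => ∑ j, c y j • S.realFrame x₀ j y) x :=
    SmoothField.sum fun j _ => SmoothField.smul (hc j) (S.smooth_realFrame hx j)
  refine h1.congr ?_
  filter_upwards [hU, hX] with y hy hXy
  exact S.realFrame_expansion hy hXy

/-- The Reeb field is chosen pointwise. Its difference from a smooth transverse field normalised by
θ is a section of H whose dθ-pairings are those of the transverse field, hence smooth. -/
theorem smooth_reeb (x : M) : SmoothField θ.reeb x := by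
  obtain ⟨hU, hx, -, -⟩ := S.frame_spec x
  have hξ : SmoothField (fun y => (θ.form y (S.transverse x y))⁻¹ • S.transverse x y) x :=
    SmoothField.smul ((θ.smoothForm x _ (S.smooth_transverse hx)).inv₀
      (θ.form_transverse_ne_zero hx)) (S.smooth_transverse hx)
  have hW : SmoothField (fun y => (θ.form y (S.transverse x y))⁻¹ • S.transverse x y - θ.reeb y) x := by
    refine θ.smooth_of_dform hx ?_ fun j => ?_
    · filter_upwards [hU.mem_nhds hx] with y hy
      rw [← θ.form_eq_zero_iff, map_sub, map_smul, form_reeb, smul_eq_mul,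
        inv_mul_cancel₀ (θ.form_transverse_ne_zero hy), sub_self]
    · simp only [map_sub, LinearMap.sub_apply, dform_reeb_left, sub_zero]
      exact θ.smooth_dform hξ (S.smooth_realFrame hx j)
  refine (hξ.sub hW).congr (Filter.Eventually.of_forall fun y => ?_)
  simp only [sub_sub_cancel]

theorem smooth_hproj (hX : SmoothField X x) : SmoothField (fun y => θ.hproj y (X y)) x :=
  hX.sub (SmoothField.smul (θ.smoothForm x X hX) (θ.smooth_reeb x))

theorem diff_hproj (hX : DiffField X x) : DiffField (fun y => θ.hproj y (X y)) x :=
  hX.sub (DiffField.smul (θ.diffForm x X hX) (θ.smooth_reeb x).diff)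

theorem smooth_phi (hX : SmoothField X x) : SmoothField (fun y => θ.phi y (X y)) x :=
  S.smooth_J (θ.smooth_hproj hX) (Filter.Eventually.of_forall fun _ => θ.hproj_mem _)

theorem diff_phi (hX : DiffField X x) : DiffField (fun y => θ.phi y (X y)) x :=
  S.diff_J (θ.diff_hproj hX) (Filter.Eventually.of_forall fun _ => θ.hproj_mem _)

/-- The formula for dθ(X,Y) differentiates X and Y once already, so for merely differentiable fields
bilinearity and a smooth frame are used instead. -/
theorem diff_dform (hX : DiffField X x) (hY : DiffField Y x) :
    DiffFun (m := m) (fun y => θ.dform y (X y) (Y y)) x := by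
  obtain ⟨hU, hx, hf, -⟩ := S.frame_spec x
  let s := complexFrame S.J (S.transverse x) (S.holFrame x)
  have hs : ∀ i, SmoothField (s i) x := fun i => (S.frame_spec x).2.2.1.contMDiffAt hU hx i
  have h1 : DiffFun (m := m) (fun y => ∑ i, ∑ j, (S.frame_spec x).2.2.1.coeff i y (X y) *
      ((S.frame_spec x).2.2.1.coeff j y (Y y) * θ.dform y (s i y) (s j y))) x := by
    refine DiffFun.sum fun i _ => DiffFun.sum fun j _ => ?_
    exact (S.coeff_diff hx hX i).mul
      ((S.coeff_diff hx hY j).mul (θ.smooth_dform (hs i) (hs j)).diff)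
  refine h1.congr_of_eventuallyEq ?_
  filter_upwards [hU.mem_nhds hx] with y hy
  have hX' := (S.frame_spec x).2.2.1.coeff_sum_eq X hy
  have hY' := (S.frame_spec x).2.2.1.coeff_sum_eq Y hy
  conv_lhs => rw [hX', hY']
  rw [map_sum, Finset.sum_comm]
  refine Finset.sum_congr rfl fun j _ => ?_
  rw [map_sum, LinearMap.sum_apply]
  refine Finset.sum_congr rfl fun i _ => ?_
  rw [map_smul, map_smul, LinearMap.smul_apply, smul_eq_mul, smul_eq_mul]
  ring

theorem smooth_leviForm (hX : SmoothField X x) (hY : SmoothField Y x) :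
    SmoothFun (m := m) (fun y => θ.leviForm y (X y) (Y y)) x := by
  simp only [leviForm_eq]
  exact θ.smooth_dform hX (θ.smooth_phi hY)

theorem diff_leviForm (hX : DiffField X x) (hY : DiffField Y x) :
    DiffFun (m := m) (fun y => θ.leviForm y (X y) (Y y)) x := by
  simp only [leviForm_eq]
  exact θ.diff_dform hX (θ.diff_phi hY)

/-- A section of `H` is smooth if its Levi pairings with smooth sections of `H` are smooth. -/
theorem smooth_of_leviForm (hX : ∀ᶠ y in 𝓝 x, X y ∈ S.H y)
    (h : ∀ Y, S.IsSection (S.frameDomain x) Y →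
      SmoothFun (m := m) (fun y => θ.leviForm y (X y) (Y y)) x) : SmoothField X x := by
  obtain ⟨hU, hx, -, -⟩ := S.frame_spec x
  refine θ.smooth_of_dform hx hX fun j => ?_
  have hj : S.IsSection (S.frameDomain x) (S.realFrame x j) := isSection_of_smoothField
    (fun _ hy => S.smooth_realFrame hy j) (fun _ hy => S.realFrame_mem hy j)
  -- Since L_θ(X, φY) = -dθ(X, Y), Levi pairings are tested on the J-rotated frame.
  refine (h _ (hj.JF hU)).neg.congr_of_eventuallyEq ?_
  filter_upwards [hU.mem_nhds hx] with y hy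
  change _ = - θ.leviForm y (X y) (S.J y (S.realFrame x j y))
  rw [← θ.phi_of_mem (S.realFrame_mem hy j), leviForm_phi_right, neg_neg]

end PseudoHermitian
end AlmostCRStructure

/-! ### The Koszul expression and its tensoriality -/

namespace AlmostCRStructure
namespace PseudoHermitian
variable {S : AlmostCRStructure m M} (θ : S.PseudoHermitian) {x₀ x y : M} {V X Y Z Y' V' : VecField m M}
  {U : Set M} {f : M → ℝ}

/-- The horizontal part of a vector field. -/
abbrev hF (X : VecField m M) : VecField m M := fun y => θ.hproj y (X y)

/-- The field `JX` for the horizontal part of a vector field. -/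
abbrev phiF (X : VecField m M) : VecField m M := fun y => θ.phi y (X y)

theorem hF_add : θ.hF (fun y => X y + Y y) = fun y => θ.hF X y + θ.hF Y y := by
  funext y; exact map_add _ _ _

theorem phiF_add : θ.phiF (fun y => X y + Y y) = fun y => θ.phiF X y + θ.phiF Y y := by
  funext y; exact map_add _ _ _

theorem hF_smul : θ.hF (fun y => f y • X y) = fun y => f y • θ.hF X y := by
  funext y; exact map_smul _ _ _

theorem phiF_smul : θ.phiF (fun y => f y • X y) = fun y => f y • θ.phiF X y := by
  funext y; exact map_smul _ _ _

theorem hF_phiF : θ.hF (θ.phiF X) = θ.phiF X := by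
  funext y; exact θ.hproj_phi _

theorem phiF_phiF : θ.phiF (θ.phiF X) = fun y => - θ.hF X y := by
  funext y; exact θ.phi_phi _

/-- Twice the horizontal bracket determining the `(0,1)`-part of the Tanaka-Webster connection. -/
def mixedBr (V Y : VecField m M) (x : M) : Tgt m x :=
  θ.hproj x (lieBr (θ.hF V) (θ.hF Y) x + lieBr (θ.phiF V) (θ.phiF Y) x) +
    θ.phi x (lieBr (θ.phiF V) (θ.hF Y) x - lieBr (θ.hF V) (θ.phiF Y) x)

/-- Twice the derivative along the Reeb field of the Tanaka-Webster connection. -/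
def reebBr (Y : VecField m M) (x : M) : Tgt m x :=
  θ.hproj x (lieBr θ.reeb (θ.hF Y) x) - θ.phi x (lieBr θ.reeb (θ.phiF Y) x)

theorem mixedBr_add_left (hV : DiffField V x) (hV' : DiffField V' x) :
    θ.mixedBr (fun y => V y + V' y) Y x = θ.mixedBr V Y x + θ.mixedBr V' Y x := by
  simp only [mixedBr, hF_add, phiF_add]
  rw [lieBr_add_left (θ.diff_hproj hV) (θ.diff_hproj hV'),
    lieBr_add_left (θ.diff_phi hV) (θ.diff_phi hV'),
    lieBr_add_left (θ.diff_phi hV) (θ.diff_phi hV'),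
    lieBr_add_left (θ.diff_hproj hV) (θ.diff_hproj hV')]
  simp only [map_add, map_sub]
  abel

theorem mixedBr_add_right (hY : DiffField Y x) (hY' : DiffField Y' x) :
    θ.mixedBr V (fun y => Y y + Y' y) x = θ.mixedBr V Y x + θ.mixedBr V Y' x := by
  simp only [mixedBr, hF_add, phiF_add]
  rw [lieBr_add_right (θ.diff_hproj hY) (θ.diff_hproj hY'),
    lieBr_add_right (θ.diff_phi hY) (θ.diff_phi hY'),
    lieBr_add_right (θ.diff_phi hY) (θ.diff_phi hY'),
    lieBr_add_right (θ.diff_hproj hY) (θ.diff_hproj hY')]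
  simp only [map_add, map_sub]
  abel

theorem mixedBr_smul_left (hf : DiffFun (m := m) f x) (hV : DiffField V x) :
    θ.mixedBr (fun y => f y • V y) Y x = f x • θ.mixedBr V Y x := by
  simp only [mixedBr, hF_smul, phiF_smul]
  rw [lieBr_smul_left hf (θ.diff_hproj hV), lieBr_smul_left hf (θ.diff_phi hV),
    lieBr_smul_left hf (θ.diff_phi hV), lieBr_smul_left hf (θ.diff_hproj hV)]
  simp only [map_add, map_sub, map_smul, phi_phi, phi_hproj, hproj_phi,
    θ.hproj_of_mem (θ.hproj_mem (V x))]
  module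

theorem mixedBr_smul_right (hf : DiffFun (m := m) f x) (hY : DiffField Y x) :
    θ.mixedBr V (fun y => f y • Y y) x = f x • θ.mixedBr V Y x +
      (2 * dirDeriv f x (θ.hproj x (V x))) • θ.hproj x (Y x) +
      (2 * dirDeriv f x (θ.phi x (V x))) • θ.phi x (Y x) := by
  simp only [mixedBr, hF_smul, phiF_smul]
  rw [lieBr_smul_right hf (θ.diff_hproj hY), lieBr_smul_right hf (θ.diff_phi hY),
    lieBr_smul_right hf (θ.diff_phi hY), lieBr_smul_right hf (θ.diff_hproj hY)]
  simp only [map_add, map_sub, map_smul, phi_phi, phi_hproj, hproj_phi,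
    θ.hproj_of_mem (θ.hproj_mem (Y x))]
  module

theorem mixedBr_phi_right (hY : DiffField Y x) :
    θ.mixedBr V (θ.phiF Y) x = θ.phi x (θ.mixedBr V Y x) := by
  simp only [mixedBr, hF_phiF, phiF_phiF]
  rw [lieBr_neg_right (θ.diff_hproj hY), lieBr_neg_right (θ.diff_hproj hY)]
  simp only [map_add, map_sub, map_neg, phi_phi, phi_hproj]
  abel

theorem reebBr_add (hY : DiffField Y x) (hY' : DiffField Y' x) :
    θ.reebBr (fun y => Y y + Y' y) x = θ.reebBr Y x + θ.reebBr Y' x := by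
  simp only [reebBr, hF_add, phiF_add]
  rw [lieBr_add_right (θ.diff_hproj hY) (θ.diff_hproj hY'),
    lieBr_add_right (θ.diff_phi hY) (θ.diff_phi hY')]
  simp only [map_add]
  abel

theorem reebBr_smul (hf : DiffFun (m := m) f x) (hY : DiffField Y x) :
    θ.reebBr (fun y => f y • Y y) x = f x • θ.reebBr Y x +
      (2 * dirDeriv f x (θ.reeb x)) • θ.hproj x (Y x) := by
  simp only [reebBr, hF_smul, phiF_smul]
  rw [lieBr_smul_right hf (θ.diff_hproj hY), lieBr_smul_right hf (θ.diff_phi hY)]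
  simp only [map_add, map_smul, phi_phi, θ.hproj_of_mem (θ.hproj_mem (Y x))]
  module

theorem reebBr_phi (hY : DiffField Y x) : θ.reebBr (θ.phiF Y) x = θ.phi x (θ.reebBr Y x) := by
  simp only [reebBr, hF_phiF, phiF_phiF]
  rw [lieBr_neg_right (θ.diff_hproj hY)]
  simp only [map_sub, map_neg, phi_phi, phi_hproj]
  abel

/-- The Koszul-type expression for `L_θ(∇_V Y, Z)`. -/
def koszul (V Y Z : VecField m M) (x : M) : ℝ :=
  (1 / 2) * dirDeriv (fun y => θ.leviForm y (Y y) (Z y)) x (θ.hproj x (V x)) +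
  (1 / 2) * dirDeriv (fun y => θ.leviForm y (Y y) (θ.phiF Z y)) x (θ.phi x (V x)) +
  (1 / 4) * (θ.leviForm x (θ.mixedBr V Y x) (Z x) - θ.leviForm x (Y x) (θ.mixedBr V Z x)) +
  (1 / 2) * θ.form x (V x) * θ.leviForm x (θ.reebBr Y x) (Z x)

theorem koszul_add_left (hV : DiffField V x) (hV' : DiffField V' x) :
    θ.koszul (fun y => V y + V' y) Y Z x = θ.koszul V Y Z x + θ.koszul V' Y Z x := by
  simp only [koszul, mixedBr_add_left θ hV hV', map_add, LinearMap.add_apply]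
  ring

theorem koszul_smul_left (hf : DiffFun (m := m) f x) (hV : DiffField V x) :
    θ.koszul (fun y => f y • V y) Y Z x = f x * θ.koszul V Y Z x := by
  simp only [koszul, mixedBr_smul_left θ hf hV, map_smul, LinearMap.smul_apply, smul_eq_mul]
  ring

theorem koszul_add_mid (hY : DiffField Y x) (hY' : DiffField Y' x) (hZ : DiffField Z x) :
    θ.koszul V (fun y => Y y + Y' y) Z x = θ.koszul V Y Z x + θ.koszul V Y' Z x := by
  have hφ := θ.diff_phi hZ
  simp only [koszul, mixedBr_add_right θ hY hY', reebBr_add θ hY hY', map_add, LinearMap.add_apply]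
  rw [dirDeriv_add (θ.diff_leviForm hY hZ) (θ.diff_leviForm hY' hZ),
    dirDeriv_add (θ.diff_leviForm hY hφ) (θ.diff_leviForm hY' hφ)]
  ring

theorem koszul_add_right (hY : DiffField Y x) (hZ : DiffField Z x) (hY' : DiffField Y' x) :
    θ.koszul V Y (fun y => Z y + Y' y) x = θ.koszul V Y Z x + θ.koszul V Y Y' x := by
  simp only [koszul, mixedBr_add_right θ hZ hY', map_add]
  rw [dirDeriv_add (θ.diff_leviForm hY hZ) (θ.diff_leviForm hY hY'),
    dirDeriv_add (θ.diff_leviForm hY (θ.diff_phi hZ)) (θ.diff_leviForm hY (θ.diff_phi hY'))]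
  ring

/-- Of the derivatives of f, those along h(V) contribute one half from the metric term and one half
from `mixedBr`, and the one along T comes from `reebBr`. Those along φ(V) cancel because L_θ(Y, φZ)
= -L_θ(φY, Z). -/
theorem koszul_smul_mid (hS : S.IsPartiallyIntegrable) (hf : DiffFun (m := m) f x)
    (hY : DiffField Y x) (hZ : DiffField Z x) :
    θ.koszul V (fun y => f y • Y y) Z x =
      f x * θ.koszul V Y Z x + dirDeriv f x (V x) * θ.leviForm x (Y x) (Z x) := by
  have hφ := θ.diff_phi hZ
  have hv := congrArg (dirDeriv f x) (θ.eq_hproj_add (V x))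
  rw [dirDeriv_add_vec, dirDeriv_smul_vec, smul_eq_mul] at hv
  simp only [koszul, mixedBr_smul_right θ hf hY, reebBr_smul θ hf hY, map_add, LinearMap.add_apply,
    map_smul, LinearMap.smul_apply, smul_eq_mul]
  rw [dirDeriv_mul hf (θ.diff_leviForm hY hZ), dirDeriv_mul hf (θ.diff_leviForm hY hφ), hv,
    leviForm_hproj_left, θ.leviForm_phi_left hS, leviForm_phi_right]
  ring

/-- Here `mixedBr V Z` enters with a minus sign, so its derivatives of f cancel those of both metric
terms. -/
theorem koszul_smul_right (hf : DiffFun (m := m) f x)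
    (hY : DiffField Y x) (hZ : DiffField Z x) :
    θ.koszul V Y (fun y => f y • Z y) x = f x * θ.koszul V Y Z x := by
  have hφ := θ.diff_phi hZ
  simp only [koszul, mixedBr_smul_right θ hf hZ, map_add, map_smul, smul_eq_mul]
  rw [dirDeriv_mul hf (θ.diff_leviForm hY hZ), dirDeriv_mul hf (θ.diff_leviForm hY hφ),
    leviForm_hproj_right]
  ring

/-- This is ∇J = 0 in weak form, since φ is skew for L_θ. -/
theorem koszul_phi (hS : S.IsPartiallyIntegrable) (hY : DiffField Y x) (hZ : DiffField Z x) :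
    θ.koszul V (θ.phiF Y) Z x = - θ.koszul V Y (θ.phiF Z) x := by
  simp only [koszul, mixedBr_phi_right θ hY, mixedBr_phi_right θ hZ, reebBr_phi θ hY,
    dirDeriv_neg, θ.leviForm_phi_left hS, leviForm_phi_right]
  ring

theorem tensorialAt_koszul_left :
    TensorialAt (𝓡 (2 * m + 1)) (EuclideanSpace ℝ (Fin (2 * m + 1))) (A := ℝ)
      (fun V : VecField m M => θ.koszul V Y Z x) x where
  smul hf hV := θ.koszul_smul_left hf hV
  add hV hV' := θ.koszul_add_left hV hV'

theorem tensorialAt_koszul_right (hY : DiffField Y x) :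
    TensorialAt (𝓡 (2 * m + 1)) (EuclideanSpace ℝ (Fin (2 * m + 1))) (A := ℝ)
      (fun Z : VecField m M => θ.koszul V Y Z x) x where
  smul hf hZ := θ.koszul_smul_right hf hY hZ
  add hZ hZ' := θ.koszul_add_right hY hZ hZ'

/-- Riesz representation with a parameter; nondegeneracy makes the representative unique, hence
linear in the parameter. -/
theorem _root_.CR.exists_linearMap_forall_eq {V : Type*} [AddCommGroup V] [Module ℝ V]
    [FiniteDimensional ℝ V] (H : Submodule ℝ V) (B K : V →ₗ[ℝ] V →ₗ[ℝ] ℝ)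
    (hB : ∀ v ∈ H, (∀ w ∈ H, B v w = 0) → v = 0) :
    ∃ A : V →ₗ[ℝ] V, ∀ v, A v ∈ H ∧ ∀ w ∈ H, B (A v) w = K v w := by
  have h := fun φ => exists_mem_forall_eq H B hB φ
  choose g hg hg' using h
  have huniq : ∀ {u v : V}, u ∈ H → v ∈ H → (∀ w ∈ H, B u w = B v w) → u = v := by
    intro u v hu hv huv
    refine sub_eq_zero.1 (hB _ (H.sub_mem hu hv) fun w hw => ?_)
    rw [map_sub, LinearMap.sub_apply, huv w hw, sub_self]
  refine ⟨{ toFun := fun v => g (K v), map_add' := fun u v => ?_, map_smul' := fun c v => ?_ },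
    fun v => ⟨hg _, hg' _⟩⟩
  · refine huniq (hg _) (H.add_mem (hg _) (hg _)) fun w hw => ?_
    rw [hg' _ w hw, map_add, map_add, LinearMap.add_apply, LinearMap.add_apply, hg' _ w hw, hg' _ w hw]
  · refine huniq (hg _) (H.smul_mem _ (hg _)) fun w hw => ?_
    rw [hg' _ w hw, map_smul, map_smul, LinearMap.smul_apply, LinearMap.smul_apply, RingHom.id_apply,
      hg' _ w hw]

theorem eq_zero_of_leviForm {v : Tgt m x} (hv : v ∈ S.H x)
    (h : ∀ w ∈ S.H x, θ.leviForm x v w = 0) : v = 0 :=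
  θ.eq_of_leviForm hv (S.H x).zero_mem fun z hz => by rw [h z hz, map_zero, LinearMap.zero_apply]

/-- Tensoriality in V and Z turns the Koszul expression into a bilinear form at x, represented by an
H-valued map v ↦ ∇_v Y. -/
theorem exists_koszul_map (hY : DiffField Y x) : ∃ A : Tgt m x →L[ℝ] Tgt m x,
    (∀ v, A v ∈ S.H x) ∧ ∀ V Z : VecField m M, DiffField V x → DiffField Z x → Z x ∈ S.H x →
      θ.leviForm x (A (V x)) (Z x) = θ.koszul V Y Z x := by
  let K := TensorialAt.mkHom₂ (I := 𝓡 (2 * m + 1)) (F := EuclideanSpace ℝ (Fin (2 * m + 1)))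
    (F' := EuclideanSpace ℝ (Fin (2 * m + 1))) (A := ℝ) (fun V Z : VecField m M => θ.koszul V Y Z x) x
    (fun Z _ => θ.tensorialAt_koszul_left) (fun V _ => θ.tensorialAt_koszul_right hY)
  have hK : ∀ V Z : VecField m M, DiffField V x → DiffField Z x → K (V x) (Z x) =
      θ.koszul V Y Z x := fun V Z hV hZ => TensorialAt.mkHom₂_apply _ _ hV hZ
  let K' : Tgt m x →ₗ[ℝ] Tgt m x →ₗ[ℝ] ℝ := LinearMap.mk₂ ℝ (fun v w => K v w)
    (fun u v w => by rw [map_add, add_apply]) (fun c u v => by rw [map_smul, smul_apply])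
    (fun u v w => by rw [map_add]) (fun c u v => by rw [map_smul])
  obtain ⟨A, hA⟩ := exists_linearMap_forall_eq (S.H x) (θ.leviForm x) K'
    (fun v hv h => θ.eq_zero_of_leviForm hv h)
  refine ⟨LinearMap.toContinuousLinearMap A, fun v => (hA v).1, fun V Z hV hZ hZH => ?_⟩
  rw [← hK V Z hV hZ]
  exact (hA (V x)).2 (Z x) hZH

end PseudoHermitian
end AlmostCRStructure

/-! ### Closedness of dθ and brackets of horizontal fields -/

namespace AlmostCRStructure
namespace PseudoHermitian
variable {S : AlmostCRStructure m M} (θ : S.PseudoHermitian) {x₀ x y : M} {V X Y Z Y' V' : VecField m M}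
  {U : Set M} {f : M → ℝ}

/-- The identity `d(dθ) = 0`. -/
theorem extD_dform (hX : SmoothField X x) (hY : SmoothField Y x) (hZ : SmoothField Z x) :
    dirDeriv (fun y => θ.dform y (Y y) (Z y)) x (X x) +
      dirDeriv (fun y => θ.dform y (Z y) (X y)) x (Y x) +
      dirDeriv (fun y => θ.dform y (X y) (Y y)) x (Z x) =
    θ.dform x (lieBr X Y x) (Z x) + θ.dform x (lieBr Y Z x) (X x) +
      θ.dform x (lieBr Z X x) (Y x) := by
  have sm : ∀ {A : VecField m M}, SmoothField A x → SmoothFun (m := m) (fun y => θ.form y (A y)) x :=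
    fun hA => θ.smoothForm x _ hA
  have h1 : ∀ {A B C : VecField m M}, SmoothField A x → SmoothField B x → SmoothField C x →
      dirDeriv (fun y => θ.dform y (B y) (C y)) x (A x) =
        dirDeriv (fun y => dirDeriv (fun z => θ.form z (C z)) y (B y)) x (A x) -
        dirDeriv (fun y => dirDeriv (fun z => θ.form z (B z)) y (C y)) x (A x) -
        dirDeriv (fun y => θ.form y (lieBr B C y)) x (A x) := by
    intro A B C hA hB hC
    have h2 : (fun y => θ.dform y (B y) (C y)) =ᶠ[𝓝 x] fun y =>
        dirDeriv (fun z => θ.form z (C z)) y (B y) - dirDeriv (fun z => θ.form z (B z)) y (C y) -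
          θ.form y (lieBr B C y) := by
      filter_upwards [hB.eventually_diff, hC.eventually_diff] with y hBy hCy
      exact extD_eq (θ.diffForm y) hBy hCy
    have d1 := ((sm hC).dirDeriv hB).diff
    have d2 := ((sm hB).dirDeriv hC).diff
    have d3 := (sm (hB.lieBr hC)).diff
    have d12 : DiffFun (m := m) (fun y => dirDeriv (fun z => θ.form z (C z)) y (B y) -
        dirDeriv (fun z => θ.form z (B z)) y (C y)) x := d1.sub d2
    rw [dirDeriv_congr h2, dirDeriv_sub d12 d3, dirDeriv_sub d1 d2]
  have h3 : ∀ {A B C : VecField m M}, SmoothField A x → SmoothField B x → SmoothField C x →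
      θ.dform x (lieBr A B x) (C x) =
        dirDeriv (fun y => dirDeriv (fun z => θ.form z (C z)) y (B y)) x (A x) -
        dirDeriv (fun y => dirDeriv (fun z => θ.form z (C z)) y (A y)) x (B x) -
        dirDeriv (fun y => θ.form y (lieBr A B y)) x (C x) -
        θ.form x (lieBr (lieBr A B) C x) := by
    intro A B C hA hB hC
    rw [dform_apply, extD_eq (θ.diffForm x) (hA.lieBr hB).diff hC.diff, dirDeriv_lieBr (sm hC) hA hB]
  have hJ := congrArg (θ.form x) (lieBr_jacobi hX hY hZ)
  rw [map_add, lieBr_swap (X := X) (Y := lieBr Y Z), map_neg] at hJ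
  have hJ' : lieBr Y (lieBr X Z) x = lieBr (lieBr Z X) Y x := by
    rw [lieBr_congr (X' := Y) (Y' := fun y => - lieBr Z X y) (Filter.Eventually.of_forall fun _ => rfl)
      (Filter.Eventually.of_forall fun y => lieBr_swap), lieBr_neg_right (hZ.lieBr hX).diff,
      lieBr_swap (X := Y), neg_neg]
  rw [hJ'] at hJ
  -- After expansion the iterated derivatives and the derivatives of θ of brackets agree on the two
  -- sides; the remaining iterated brackets sum to zero by Jacobi.
  rw [h1 hX hY hZ, h1 hY hZ hX, h1 hZ hX hY, h3 hX hY hZ, h3 hY hZ hX, h3 hZ hX hY]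
  linarith

/-- The Lie derivative of dθ along T vanishes, because dθ is closed and ι_T dθ = 0. -/
theorem dirDeriv_reeb_dform (hX : SmoothField X x) (hY : SmoothField Y x) :
    dirDeriv (fun y => θ.dform y (X y) (Y y)) x (θ.reeb x) =
      θ.dform x (lieBr θ.reeb X x) (Y x) + θ.dform x (X x) (lieBr θ.reeb Y x) := by
  have h := θ.extD_dform (θ.smooth_reeb x) hX hY
  simp only [dform_reeb_left, dform_reeb_right, dirDeriv_const, add_zero] at h
  rw [h, lieBr_swap (X := Y), map_neg, LinearMap.neg_apply, θ.dform_swap _ (X x), neg_neg]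

theorem form_lieBr_reeb (hX : DiffField X x) (hX' : ∀ᶠ y in 𝓝 x, X y ∈ S.H y) :
    θ.form x (lieBr θ.reeb X x) = 0 := by
  have h := extD_eq (θ.diffForm x) (θ.smooth_reeb x).diff hX
  have h0 : (fun y => θ.form y (X y)) =ᶠ[𝓝 x] fun _ => (0 : ℝ) := by
    filter_upwards [hX'] with y hy using θ.vanish y _ hy
  rw [← dform_apply, dform_reeb_left, dirDeriv_congr h0, dirDeriv_const] at h
  simp only [form_reeb, dirDeriv_const] at h
  linarith

theorem lieBr_reeb_mem (hX : DiffField X x) (hX' : ∀ᶠ y in 𝓝 x, X y ∈ S.H y) :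
    lieBr θ.reeb X x ∈ S.H x :=
  θ.form_eq_zero_iff.1 (θ.form_lieBr_reeb hX hX')

theorem form_lieBr (hX : DiffField X x) (hY : DiffField Y x) (hX' : ∀ᶠ y in 𝓝 x, X y ∈ S.H y)
    (hY' : ∀ᶠ y in 𝓝 x, Y y ∈ S.H y) : θ.form x (lieBr X Y x) = - θ.dform x (X x) (Y x) := by
  rw [θ.dform_section hX hY hX' hY', neg_neg]

theorem hF_eventuallyEq (hX' : ∀ᶠ y in 𝓝 x, X y ∈ S.H y) : ∀ᶠ y in 𝓝 x, θ.hF X y = X y := by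
  filter_upwards [hX'] with y hy using θ.hproj_of_mem hy

theorem phiF_eventuallyEq (hX' : ∀ᶠ y in 𝓝 x, X y ∈ S.H y) :
    ∀ᶠ y in 𝓝 x, θ.phiF X y = S.JF X y := by
  filter_upwards [hX'] with y hy using θ.phi_of_mem hy

theorem mixedBr_section (hX' : ∀ᶠ y in 𝓝 x, X y ∈ S.H y) (hY' : ∀ᶠ y in 𝓝 x, Y y ∈ S.H y) :
    θ.mixedBr X Y x = θ.hproj x (lieBr X Y x + lieBr (θ.phiF X) (θ.phiF Y) x) +
      θ.phi x (lieBr (θ.phiF X) Y x - lieBr X (θ.phiF Y) x) := by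
  have e : ∀ {A : VecField m M}, ∀ᶠ y in 𝓝 x, A y = A y := Filter.Eventually.of_forall fun _ => rfl
  simp only [mixedBr]
  rw [lieBr_congr (θ.hF_eventuallyEq hX') (θ.hF_eventuallyEq hY'),
    lieBr_congr e (θ.hF_eventuallyEq hY'), lieBr_congr (θ.hF_eventuallyEq hX') e]

theorem reebBr_section (hY : DiffField Y x) (hY' : ∀ᶠ y in 𝓝 x, Y y ∈ S.H y) :
    θ.reebBr Y x = lieBr θ.reeb Y x - θ.phi x (lieBr θ.reeb (θ.phiF Y) x) := by
  simp only [reebBr]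
  rw [lieBr_congr (Filter.Eventually.of_forall fun _ => rfl) (θ.hF_eventuallyEq hY'),
    θ.hproj_of_mem (θ.lieBr_reeb_mem hY hY')]

/-- The θ-components of [X,Y] - [JX,JY] and of [JX,Y] + [X,JY] vanish by the J-invariance of dθ.
Thus J is applied to a vector of H and can be replaced by φ. -/
theorem nijenhuis_section (hS : S.IsPartiallyIntegrable) (hX : DiffField X x) (hY : DiffField Y x)
    (hX' : ∀ᶠ y in 𝓝 x, X y ∈ S.H y) (hY' : ∀ᶠ y in 𝓝 x, Y y ∈ S.H y) :
    S.nijenhuis X Y x ∈ S.H x ∧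
    S.nijenhuis X Y x = lieBr X Y x - lieBr (θ.phiF X) (θ.phiF Y) x +
      θ.phi x (lieBr (θ.phiF X) Y x + lieBr X (θ.phiF Y) x) := by
  have e : ∀ {A : VecField m M}, ∀ᶠ y in 𝓝 x, A y = A y := Filter.Eventually.of_forall fun _ => rfl
  have hφ : ∀ {A : VecField m M}, ∀ᶠ y in 𝓝 x, θ.phiF A y ∈ S.H y :=
    Filter.Eventually.of_forall fun _ => θ.phi_mem _
  have h1 : lieBr (θ.phiF X) Y x + lieBr X (θ.phiF Y) x ∈ S.H x := by
    rw [← θ.form_eq_zero_iff, map_add, θ.form_lieBr (θ.diff_phi hX) hY hφ hY',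
      θ.form_lieBr hX (θ.diff_phi hY) hX' hφ, ← θ.dform_phi_phi hS (θ.phiF X x), phi_phi, map_neg,
      LinearMap.neg_apply, dform_hproj_left]
    ring
  have h2 : lieBr X Y x - lieBr (θ.phiF X) (θ.phiF Y) x ∈ S.H x := by
    rw [← θ.form_eq_zero_iff, map_sub, θ.form_lieBr hX hY hX' hY',
      θ.form_lieBr (θ.diff_phi hX) (θ.diff_phi hY) hφ hφ, θ.dform_phi_phi hS]
    simp
  have h3 : S.nijenhuis X Y x = lieBr X Y x - lieBr (θ.phiF X) (θ.phiF Y) x +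
      θ.phi x (lieBr (θ.phiF X) Y x + lieBr X (θ.phiF Y) x) := by
    rw [θ.phi_of_mem h1]
    simp only [nijenhuis]
    rw [lieBr_congr (θ.phiF_eventuallyEq hX') (θ.phiF_eventuallyEq hY'),
      lieBr_congr (θ.phiF_eventuallyEq hX') (e (A := Y)),
      lieBr_congr (e (A := X)) (θ.phiF_eventuallyEq hY')]
  refine ⟨?_, h3⟩
  rw [h3]
  exact (S.H x).add_mem h2 (θ.phi_mem _)

end PseudoHermitian
end AlmostCRStructure

/-! ### Existence of the Tanaka-Webster connection -/

namespace AlmostCRStructure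
namespace PseudoHermitian
variable {S : AlmostCRStructure m M} (θ : S.PseudoHermitian) {x₀ x y : M} {V X Y Z Y' V' : VecField m M}
  {U : Set M} {f : M → ℝ}

theorem ext_levi {u v : Tgt m x} (h : θ.form x u = θ.form x v)
    (h' : ∀ z ∈ S.H x, θ.leviForm x u z = θ.leviForm x v z) : u = v := by
  have h1 : θ.hproj x u = θ.hproj x v := θ.eq_of_leviForm (θ.hproj_mem u) (θ.hproj_mem v) fun z hz => by
    rw [leviForm_hproj_left, leviForm_hproj_left, h' z hz]
  rw [θ.eq_hproj_add u, θ.eq_hproj_add v, h1, h]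

/-- To compare vectors with Levi form, it is enough to test on sections of `H`. -/
theorem ext_levi_section {u v : Tgt m x} (h : θ.form x u = θ.form x v)
    (h' : ∀ Z, S.IsSection (S.frameDomain x) Z → θ.leviForm x u (Z x) = θ.leviForm x v (Z x)) :
    u = v := by
  refine θ.ext_levi h fun z hz => ?_
  obtain ⟨Z, hZ, rfl⟩ := S.exists_section x (S.frame_spec x).2.1 hz
  exact h' Z hZ

open Classical in
/-- A connection on `TM` defined by the Koszul-type formula. -/
def koszulConn (Y : VecField m M) (x : M) : Tgt m x →L[ℝ] Tgt m x :=
  -- The horizontal part is given by the Koszul expression and the Reeb part by V(θ(Y)), so that T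
  -- becomes parallel. The value 0 at points of non-differentiability is harmless, the axioms of a
  -- covariant derivative being tested only on differentiable fields.
  if hY : DiffField Y x then
    (θ.exists_koszul_map hY).choose +
      (mvfderiv (𝓡 (2 * m + 1)) (fun y => θ.form y (Y y)) x).smulRight (θ.reeb x)
  else 0

theorem form_koszulConn (hY : DiffField Y x) (v : Tgt m x) :
    θ.form x (θ.koszulConn Y x v) = dirDeriv (fun y => θ.form y (Y y)) x v := by
  rw [koszulConn, dif_pos hY, add_apply, map_add,
    θ.vanish _ _ ((θ.exists_koszul_map hY).choose_spec.1 v), zero_add,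
    ContinuousLinearMap.smulRight_apply, map_smul, form_reeb, smul_eq_mul, mul_one]

theorem leviForm_koszulConn (hY : DiffField Y x) (hV : DiffField V x) (hZ : DiffField Z x)
    (hZ' : Z x ∈ S.H x) :
    θ.leviForm x (θ.koszulConn Y x (V x)) (Z x) = θ.koszul V Y Z x := by
  rw [koszulConn, dif_pos hY, add_apply, map_add, LinearMap.add_apply,
    (θ.exists_koszul_map hY).choose_spec.2 V Z hV hZ hZ', ContinuousLinearMap.smulRight_apply,
    map_smul, LinearMap.smul_apply, leviForm_reeb_left, smul_zero, add_zero]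

theorem isCovariantDerivativeOn_koszulConn (hS : S.IsPartiallyIntegrable) :
    IsCovariantDerivativeOn (EuclideanSpace ℝ (Fin (2 * m + 1)))
      (V := fun x : M => TangentSpace (𝓡 (2 * m + 1)) x) θ.koszulConn Set.univ where
  add {Y Y' x} hY hY' _ := by
    have hs : DiffField (Y + Y') x := DiffField.add hY hY'
    ext1 v
    refine θ.ext_levi_section ?_ fun Z hZ => ?_
    · have e := dirDeriv_add (θ.diffForm x _ hY) (θ.diffForm x _ hY') v
      rw [add_apply, map_add, θ.form_koszulConn hs, θ.form_koszulConn hY, θ.form_koszulConn hY', ← e]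
      simp only [Pi.add_apply, map_add]
    · obtain ⟨hU, hx, -, -⟩ := S.frame_spec x
      have dZ := (hZ.smoothField hU hx).diff
      have dV := diffField_extendVec v
      have e := θ.koszul_add_mid (V := extendVec v) hY hY' dZ
      rw [← extendVec_self v, add_apply, map_add, LinearMap.add_apply,
        θ.leviForm_koszulConn hs dV dZ (hZ.mem x hx), θ.leviForm_koszulConn hY dV dZ (hZ.mem x hx),
        θ.leviForm_koszulConn hY' dV dZ (hZ.mem x hx)]
      exact e
  leibniz {Y g x} hY hg _ := by
    have hs : DiffField (g • Y) x := DiffField.smul hg hY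
    ext1 v
    refine θ.ext_levi_section ?_ fun Z hZ => ?_
    · have e := dirDeriv_mul hg (θ.diffForm x _ hY) v
      rw [add_apply, map_add, θ.form_koszulConn hs, smul_apply, map_smul, θ.form_koszulConn hY,
        ContinuousLinearMap.smulRight_apply, map_smul]
      simp only [Pi.smul_apply', map_smul, smul_eq_mul]
      rw [e]
      simp only [dirDeriv]
      ring
    · obtain ⟨hU, hx, -, -⟩ := S.frame_spec x
      have dZ := (hZ.smoothField hU hx).diff
      have dV := diffField_extendVec v
      have e := θ.koszul_smul_mid (V := extendVec v) hS hg hY dZ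
      rw [← extendVec_self v, add_apply, map_add, LinearMap.add_apply,
        θ.leviForm_koszulConn hs dV dZ (hZ.mem x hx), smul_apply, map_smul, LinearMap.smul_apply,
        θ.leviForm_koszulConn hY dV dZ (hZ.mem x hx), ContinuousLinearMap.smulRight_apply, map_smul,
        LinearMap.smul_apply]
      exact e

theorem dform_phi_left (hS : S.IsPartiallyIntegrable) (v w : Tgt m x) :
    θ.dform x (θ.phi x v) w = - θ.dform x v (θ.phi x w) := by
  rw [← θ.dform_phi_phi hS, phi_phi, map_neg, LinearMap.neg_apply, dform_hproj_left]

/-- The Koszul expression for sections of `H`. -/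
theorem koszul_section (hS : S.IsPartiallyIntegrable) (hV' : ∀ᶠ y in 𝓝 x, V y ∈ S.H y)
    (hY' : ∀ᶠ y in 𝓝 x, Y y ∈ S.H y) (hZ' : ∀ᶠ y in 𝓝 x, Z y ∈ S.H y) :
    4 * θ.koszul V Y Z x =
      2 * dirDeriv (fun y => θ.dform y (Y y) (θ.phiF Z y)) x (V x) -
      2 * dirDeriv (fun y => θ.dform y (Y y) (Z y)) x (θ.phi x (V x)) +
      θ.dform x (lieBr V Y x + lieBr (θ.phiF V) (θ.phiF Y) x) (θ.phi x (Z x)) +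
      θ.dform x (lieBr (θ.phiF V) Y x - lieBr V (θ.phiF Y) x) (Z x) -
      θ.dform x (lieBr V Z x + lieBr (θ.phiF V) (θ.phiF Z) x) (θ.phi x (Y x)) -
      θ.dform x (lieBr (θ.phiF V) Z x - lieBr V (θ.phiF Z) x) (Y x) := by
  have hv := hV'.self_of_nhds
  have e1 : θ.leviForm x (θ.mixedBr V Y x) (Z x) =
      θ.dform x (lieBr V Y x + lieBr (θ.phiF V) (θ.phiF Y) x) (θ.phi x (Z x)) +
      θ.dform x (lieBr (θ.phiF V) Y x - lieBr V (θ.phiF Y) x) (Z x) := by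
    rw [θ.mixedBr_section hV' hY', map_add, LinearMap.add_apply, leviForm_hproj_left, leviForm_eq,
      θ.leviForm_phi_left hS]
  have e2 : θ.leviForm x (Y x) (θ.mixedBr V Z x) =
      θ.dform x (lieBr V Z x + lieBr (θ.phiF V) (θ.phiF Z) x) (θ.phi x (Y x)) +
      θ.dform x (lieBr (θ.phiF V) Z x - lieBr V (θ.phiF Z) x) (Y x) := by
    rw [θ.leviForm_symm hS, θ.mixedBr_section hV' hZ', map_add, LinearMap.add_apply,
      leviForm_hproj_left, leviForm_eq, θ.leviForm_phi_left hS]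
  have e3 : (fun y => θ.leviForm y (Y y) (θ.phiF Z y)) = fun y => - θ.dform y (Y y) (Z y) :=
    funext fun y => θ.leviForm_phi_right _ _
  simp only [koszul]
  rw [e1, e2, e3, dirDeriv_neg, θ.hproj_of_mem hv, θ.vanish x _ hv]
  simp only [leviForm_eq]
  ring

/-- The derivative terms are removed by d(dθ) = 0 on the four triples (X,Y,φZ), (X,φY,Z), (φX,Y,Z)
and (φX,φY,φZ). The brackets left over form the bracket and Nijenhuis terms. -/
theorem koszul_torsion (hS : S.IsPartiallyIntegrable) (hX : SmoothField X x) (hY : SmoothField Y x)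
    (hZ : SmoothField Z x) (hX' : ∀ᶠ y in 𝓝 x, X y ∈ S.H y)
    (hY' : ∀ᶠ y in 𝓝 x, Y y ∈ S.H y) (hZ' : ∀ᶠ y in 𝓝 x, Z y ∈ S.H y) :
    θ.koszul X Y Z x - θ.koszul Y X Z x = θ.leviForm x (lieBr X Y x) (Z x) -
      (1 / 4) * θ.leviForm x (S.nijenhuis X Y x) (Z x) := by
  have k1 := θ.koszul_section hS hX' hY' hZ'
  have k2 := θ.koszul_section hS hY' hX' hZ'
  have n := (θ.nijenhuis_section hS hX.diff hY.diff hX' hY').2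
  have pX := θ.smooth_phi hX
  have pY := θ.smooth_phi hY
  have pZ := θ.smooth_phi hZ
  have e1 := θ.extD_dform hX hY pZ
  have e2 := θ.extD_dform hX pY hZ
  have e3 := θ.extD_dform pX hY hZ
  have e4 := θ.extD_dform pX pY pZ
  have sw : ∀ A B : VecField m M, (fun y => θ.dform y (A y) (B y)) =
      fun y => - θ.dform y (B y) (A y) := fun A B => funext fun y => θ.dform_swap _ _
  rw [sw (θ.phiF Z) X] at e1
  rw [sw Z X] at e2
  rw [sw Z (θ.phiF X)] at e3
  rw [sw (θ.phiF Z) (θ.phiF X)] at e4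
  simp only [θ.dform_phi_left hS, phi_phi, map_neg, dform_hproj_right, dirDeriv_neg, neg_neg] at e1 e2 e3 e4
  have q : ∀ A B : VecField m M, lieBr A B x = - lieBr B A x := fun A B => lieBr_swap
  rw [q Y X, q (θ.phiF Y) (θ.phiF X), q (θ.phiF Y) X, q Y (θ.phiF X)] at k2
  rw [q (θ.phiF Z) X] at e1
  rw [q Z X] at e2
  rw [q Z (θ.phiF X)] at e3
  rw [q (θ.phiF Z) (θ.phiF X)] at e4
  rw [n]
  simp only [map_add, map_sub, map_neg, LinearMap.add_apply, LinearMap.sub_apply, LinearMap.neg_apply,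
    θ.leviForm_phi_left hS, leviForm_eq] at *
  linarith

theorem lieBr_zero_right : lieBr X (fun _ => 0) x = 0 :=
  congrFun (VectorField.mlieBracket_zero_right (I := 𝓡 (2 * m + 1)) (W := X)) x

theorem lieBr_zero_left : lieBr (fun _ => 0) X x = 0 := by
  rw [lieBr_swap, lieBr_zero_right, neg_zero]

theorem hF_reeb : θ.hF θ.reeb = fun _ => 0 := funext fun _ => θ.hproj_reeb

theorem phiF_reeb : θ.phiF θ.reeb = fun _ => 0 := funext fun _ => θ.phi_reeb

theorem mixedBr_reeb_left : θ.mixedBr θ.reeb Y x = 0 := by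
  simp only [mixedBr, hF_reeb, phiF_reeb, lieBr_zero_left, add_zero, sub_zero, map_zero]

theorem mixedBr_reeb_right : θ.mixedBr V θ.reeb x = 0 := by
  simp only [mixedBr, hF_reeb, phiF_reeb, lieBr_zero_right, add_zero, sub_zero, map_zero]

theorem koszul_reeb_left :
    θ.koszul θ.reeb Y Z x = (1 / 2) * θ.leviForm x (θ.reebBr Y x) (Z x) := by
  simp only [koszul, mixedBr_reeb_left, hproj_reeb, phi_reeb, map_zero, LinearMap.zero_apply,
    form_reeb]
  ring

theorem koszul_reeb_mid : θ.koszul V θ.reeb Z x = 0 := by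
  have e : θ.reebBr θ.reeb x = 0 := by
    simp only [reebBr, hF_reeb, phiF_reeb, lieBr_zero_right, sub_zero, map_zero]
  simp only [koszul, mixedBr_reeb_right, e, leviForm_reeb_left, dirDeriv_const, map_zero,
    LinearMap.zero_apply]
  ring

/-- Symmetrising in Y and Z kills the `mixedBr` terms, by symmetry of L_θ, and the φ(V)-derivatives,
by skewness of φ. The Reeb terms add up to T(L_θ(Y,Z)) because dθ is invariant under T. -/
theorem koszul_metric (hS : S.IsPartiallyIntegrable) (hY : SmoothField Y x) (hZ : SmoothField Z x)
    (hY' : ∀ᶠ y in 𝓝 x, Y y ∈ S.H y) (hZ' : ∀ᶠ y in 𝓝 x, Z y ∈ S.H y) :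
    θ.koszul V Y Z x + θ.koszul V Z Y x =
      dirDeriv (fun y => θ.leviForm y (Y y) (Z y)) x (V x) := by
  have hv := congrArg (dirDeriv (fun y => θ.leviForm y (Y y) (Z y)) x) (θ.eq_hproj_add (V x))
  rw [dirDeriv_add_vec, dirDeriv_smul_vec, smul_eq_mul] at hv
  have e1 : (fun y => θ.leviForm y (Z y) (Y y)) = fun y => θ.leviForm y (Y y) (Z y) :=
    funext fun y => θ.leviForm_symm hS _ _
  have e2 : (fun y => θ.leviForm y (Z y) (θ.phiF Y y)) = fun y => - θ.leviForm y (Y y) (θ.phiF Z y) :=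
    funext fun y => by rw [leviForm_phi_right, leviForm_phi_right, dform_swap]
  have t1 := θ.dirDeriv_reeb_dform hY (θ.smooth_phi hZ)
  have t2 := θ.dirDeriv_reeb_dform hZ (θ.smooth_phi hY)
  have t1' : dirDeriv (fun y => θ.leviForm y (Y y) (Z y)) x (θ.reeb x) = _ := t1
  have t2' : dirDeriv (fun y => θ.leviForm y (Z y) (Y y)) x (θ.reeb x) = _ := t2
  rw [e1] at t2'
  simp only [koszul]
  rw [hv, e1, e2, dirDeriv_neg, θ.reebBr_section hY.diff hY', θ.reebBr_section hZ.diff hZ',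
    θ.leviForm_symm hS (Z x) (θ.mixedBr V Y x), θ.leviForm_symm hS (Y x) (θ.mixedBr V Z x)]
  simp only [map_sub, LinearMap.sub_apply, θ.leviForm_phi_left hS, leviForm_eq] at *
  rw [θ.dform_swap (Y x)] at t1'
  rw [θ.dform_swap (Z x)] at t2'
  linear_combination -(1 / 4) * θ.form x (V x) * 2 * t1' - (1 / 4) * θ.form x (V x) * 2 * t2'

/-- Each defining property is tested against sections Z of H, where it becomes an identity for
`koszul`; the Reeb components are compared separately through θ. -/
theorem isTanakaWebster_koszulConn (hS : S.IsPartiallyIntegrable) :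
    θ.IsTanakaWebster θ.koszulConn := by
  have hcov := θ.isCovariantDerivativeOn_koszulConn hS
  have ev : ∀ {U : Set M} {Y : VecField m M} {x : M}, IsOpen U → S.IsSection U Y → x ∈ U →
      ∀ᶠ y in 𝓝 x, Y y ∈ S.H y := fun hU hY hx => Filter.eventually_of_mem (hU.mem_nhds hx) hY.mem
  have hmem : ∀ U Y, IsOpen U → S.IsSection U Y → ∀ x ∈ U, ∀ v, θ.koszulConn Y x v ∈ S.H x := by
    intro U Y hU hY x hx v
    have h0 : (fun y => θ.form y (Y y)) =ᶠ[𝓝 x] fun _ => (0 : ℝ) := by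
      filter_upwards [ev hU hY hx] with y hy using θ.vanish y _ hy
    rw [← θ.form_eq_zero_iff, θ.form_koszulConn (hY.smoothField hU hx).diff, dirDeriv_congr h0,
      dirDeriv_const]
  have hreeb : ∀ x, θ.koszulConn θ.reeb x = 0 := by
    intro x
    have hT := (θ.smooth_reeb x).diff
    ext1 v
    refine θ.ext_levi_section ?_ fun Z hZ => ?_
    · rw [θ.form_koszulConn hT]
      simp only [form_reeb, dirDeriv_const, zero_apply, map_zero]
    · obtain ⟨hU, hx, -, -⟩ := S.frame_spec x
      rw [← extendVec_self v, θ.leviForm_koszulConn hT (diffField_extendVec v)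
        (hZ.smoothField hU hx).diff (hZ.mem x hx), koszul_reeb_mid, zero_apply, map_zero,
        LinearMap.zero_apply]
  refine ⟨hcov, hmem, ?_, hreeb, ?_, ?_, ?_⟩
  · intro U Y hU hY x hx v
    have dY := (hY.smoothField hU hx).diff
    have dp := θ.diff_phi dY
    rw [hcov.congr_of_eventuallyEq ((hY.JF hU).smoothField hU hx).diff dp Filter.univ_mem
      ((θ.phiF_eventuallyEq (ev hU hY hx)).mono fun _ h => h.symm)]
    have hm := hmem U Y hU hY x hx v
    refine θ.ext_levi_section ?_ fun Z hZ => ?_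
    · rw [θ.form_koszulConn dp, θ.vanish x _ (S.J_mem _ _ hm)]
      have h0 : (fun y => θ.form y (θ.phi y (Y y))) = fun _ => (0 : ℝ) :=
        funext fun y => θ.vanish y _ (θ.phi_mem _)
      rw [h0, dirDeriv_const]
    · obtain ⟨hU, hx, -, -⟩ := S.frame_spec x
      have dZ := (hZ.smoothField hU hx).diff
      have e1 := θ.leviForm_koszulConn dp (diffField_extendVec v) dZ (hZ.mem x hx)
      have e2 := θ.leviForm_koszulConn dY (diffField_extendVec v) (θ.diff_phi dZ) (θ.phi_mem _)
      rw [extendVec_self, θ.koszul_phi hS dY dZ] at e1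
      rw [extendVec_self, leviForm_phi_right] at e2
      rw [e1, ← e2, neg_neg, ← θ.phi_of_mem hm, θ.leviForm_phi_left hS]
  · intro U Y Z hU hY hZ x hx v
    have dY := hY.smoothField hU hx
    have dZ := hZ.smoothField hU hx
    have e := θ.koszul_metric (V := extendVec v) hS dY dZ (ev hU hY hx) (ev hU hZ hx)
    rw [← θ.leviForm_koszulConn dY.diff (diffField_extendVec v) dZ.diff (hZ.mem x hx),
      ← θ.leviForm_koszulConn dZ.diff (diffField_extendVec v) dY.diff (hY.mem x hx),
      extendVec_self] at e
    rw [← leviForm_apply, ← leviForm_apply, θ.leviForm_symm hS (Y x), e]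
    rfl
  · intro U X Y hU hX hY x hx
    have dX := hX.smoothField hU hx
    have dY := hY.smoothField hU hx
    have eX := ev hU hX hx
    have eY := ev hU hY hx
    refine θ.ext_levi_section ?_ fun Z hZ => ?_
    · rw [map_sub, map_sub, map_sub, θ.vanish x _ (hmem U Y hU hY x hx _),
        θ.vanish x _ (hmem U X hU hX x hx _), θ.form_lieBr dX.diff dY.diff eX eY, map_smul, map_smul,
        θ.vanish x _ (θ.nijenhuis_section hS dX.diff dY.diff eX eY).1, form_reeb, ← leviForm_apply,
        ← θ.phi_of_mem (hX.mem x hx), θ.leviForm_phi_left hS]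
      simp
    · obtain ⟨hU', hx', -, -⟩ := S.frame_spec x
      have dZ := hZ.smoothField hU' hx'
      have e := θ.koszul_torsion hS dX dY dZ eX eY (ev hU' hZ hx')
      rw [← θ.leviForm_koszulConn dY.diff dX.diff dZ.diff (hZ.mem x hx'),
        ← θ.leviForm_koszulConn dX.diff dY.diff dZ.diff (hZ.mem x hx')] at e
      simp only [map_sub, map_smul, LinearMap.sub_apply, LinearMap.smul_apply, leviForm_reeb_left,
        smul_eq_mul]
      linarith
  · intro U X hU hX x hx
    have dX := hX.smoothField hU hx
    have eX := ev hU hX hx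
    have pX := ev hU (hX.JF hU) hx
    have hJ : S.J x (lieBr θ.reeb (S.JF X) x) = θ.phi x (lieBr θ.reeb (θ.phiF X) x) := by
      rw [lieBr_congr (Filter.Eventually.of_forall fun _ => rfl) (θ.phiF_eventuallyEq eX),
        θ.phi_of_mem (θ.lieBr_reeb_mem ((hX.JF hU).smoothField hU hx).diff pX)]
    have hR := θ.reebBr_section dX.diff eX
    have hD : θ.koszulConn X x (θ.reeb x) = (1 / 2 : ℝ) • θ.reebBr X x := by
      refine θ.ext_levi_section ?_ fun Z hZ => ?_
      · rw [θ.vanish x _ (hmem U X hU hX x hx _), hR, map_smul, map_sub,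
          θ.form_lieBr_reeb dX.diff eX, θ.vanish x _ (θ.phi_mem _)]
        simp
      · obtain ⟨hU', hx', -, -⟩ := S.frame_spec x
        have dZ := hZ.smoothField hU' hx'
        rw [θ.leviForm_koszulConn dX.diff (θ.smooth_reeb x).diff dZ.diff (hZ.mem x hx'),
          koszul_reeb_left, map_smul, LinearMap.smul_apply, smul_eq_mul]
    rw [hD, hR, hreeb, hJ, zero_apply]
    module

/-- `tanakaWebster` is picked by `Classical.epsilon`, so it has its properties only because some
connection has them. -/
theorem isTanakaWebster (hS : S.IsPartiallyIntegrable) : θ.IsTanakaWebster θ.tanakaWebster :=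
  Classical.epsilon_spec ⟨_, θ.isTanakaWebster_koszulConn hS⟩

end PseudoHermitian
end AlmostCRStructure

/-! ### Uniqueness and smoothness of the Tanaka-Webster connection -/

namespace AlmostCRStructure

theorem IsSection.eventually_mem {S : AlmostCRStructure m M} {U : Set M} {Y : VecField m M} {x : M}
    (hU : IsOpen U) (hY : S.IsSection U Y) (hx : x ∈ U) : ∀ᶠ y in 𝓝 x, Y y ∈ S.H y :=
  Filter.eventually_of_mem (hU.mem_nhds hx) hY.mem

namespace PseudoHermitian
variable {S : AlmostCRStructure m M} (θ : S.PseudoHermitian) {x₀ x y : M} {V X Y Z Y' V' : VecField m M}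
  {U : Set M} {f : M → ℝ}

theorem isSection_phi (hU : IsOpen U) (hY : S.IsSection U Y) : S.IsSection U (θ.phiF Y) :=
  isSection_of_smoothField (fun _ hy => θ.smooth_phi (hY.smoothField hU hy)) fun _ _ => θ.phi_mem _

/-- The Nijenhuis tensor is J-antilinear in each argument: φ² = -1 on H only rearranges its four
brackets. -/
theorem nijenhuis_phi (hS : S.IsPartiallyIntegrable) (hX : DiffField X x) (hY : DiffField Y x)
    (hX' : ∀ᶠ y in 𝓝 x, X y ∈ S.H y) (hY' : ∀ᶠ y in 𝓝 x, Y y ∈ S.H y) :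
    S.nijenhuis (θ.phiF X) Y x = S.nijenhuis X (θ.phiF Y) x ∧
    S.nijenhuis (θ.phiF X) (θ.phiF Y) x = - S.nijenhuis X Y x ∧
    θ.phi x (S.nijenhuis X (θ.phiF Y) x) = S.nijenhuis X Y x := by
  have hφ : ∀ {A : VecField m M}, ∀ᶠ y in 𝓝 x, θ.phiF A y ∈ S.H y :=
    Filter.Eventually.of_forall fun _ => θ.phi_mem _
  have pX := θ.diff_phi hX
  have pY := θ.diff_phi hY
  have e : ∀ {A : VecField m M}, ∀ᶠ y in 𝓝 x, A y = A y := Filter.Eventually.of_forall fun _ => rfl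
  have hXX : ∀ᶠ y in 𝓝 x, θ.phiF (θ.phiF X) y = - X y := by
    filter_upwards [hX'] with y hy
    rw [← θ.hproj_of_mem hy, ← phi_phi]
  have hYY : ∀ᶠ y in 𝓝 x, θ.phiF (θ.phiF Y) y = - Y y := by
    filter_upwards [hY'] with y hy
    rw [← θ.hproj_of_mem hy, ← phi_phi]
  obtain ⟨m1, n1⟩ := θ.nijenhuis_section hS hX hY hX' hY'
  have n2 := (θ.nijenhuis_section hS pX hY hφ hY').2
  have n3 := (θ.nijenhuis_section hS hX pY hX' hφ).2
  have n4 := (θ.nijenhuis_section hS pX pY hφ hφ).2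
  have l1 : ∀ B, lieBr (θ.phiF (θ.phiF X)) B x = - lieBr X B x := fun B => by
    rw [lieBr_congr hXX (e (A := B)), lieBr_neg_left hX]
  have l2 : ∀ B, lieBr B (θ.phiF (θ.phiF Y)) x = - lieBr B Y x := fun B => by
    rw [lieBr_congr (e (A := B)) hYY, lieBr_neg_right hY]
  rw [l1, l1] at n2
  rw [l2, l2] at n3
  rw [l1, l1, l2, l2] at n4
  refine ⟨?_, ?_, ?_⟩
  · rw [n2, n3]
    simp only [map_add, map_neg]
    abel
  · rw [n4, n1]
    simp only [map_add, map_neg]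
    abel
  · rw [← θ.hproj_of_mem m1, n1, n3]
    simp only [map_add, map_sub, map_neg, phi_phi, hproj_phi]
    abel

namespace IsTanakaWebster
variable {θ} {D : VecField m M → ∀ x : M, Tgt m x →L[ℝ] Tgt m x} (hD : θ.IsTanakaWebster D)

include hD

theorem congr (hX : DiffField X x) (hY : DiffField Y x) (h : ∀ᶠ y in 𝓝 x, X y = Y y) :
    D X x = D Y x := hD.isCov.congr_of_eventuallyEq hX hY Filter.univ_mem h

theorem phi_comm (hU : IsOpen U) (hY : S.IsSection U Y) (hx : x ∈ U) (v : Tgt m x) :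
    D (θ.phiF Y) x v = θ.phi x (D Y x v) := by
  rw [θ.phi_of_mem (hD.mem U Y hU hY x hx v), ← hD.comm_J U Y hU hY x hx v,
    hD.congr ((hY.JF hU).smoothField hU hx).diff (θ.diff_phi (hY.smoothField hU hx).diff)
      ((θ.phiF_eventuallyEq (hY.eventually_mem hU hx)).mono fun _ h => h.symm)]

/-- In the combination (V,Y) + (φV,φY) + φ(φV,Y) - φ(V,φY) of torsion identities, all derivatives of
V and all Nijenhuis terms cancel, which leaves brackets only. -/
theorem add_phi_eq_mixedBr (hS : S.IsPartiallyIntegrable) (hU : IsOpen U) (hV : S.IsSection U V)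
    (hY : S.IsSection U Y) (hx : x ∈ U) :
    (2 : ℝ) • D Y x (V x) + (2 : ℝ) • θ.phi x (D Y x (θ.phi x (V x))) = θ.mixedBr V Y x := by
  have pV := θ.isSection_phi hU hV
  have pY := θ.isSection_phi hU hY
  have t1 := congrArg (θ.hproj x) (hD.torsion U V Y hU hV hY x hx)
  have t2 := congrArg (θ.hproj x) (hD.torsion U _ _ hU pV pY x hx)
  have t3 := congrArg (θ.phi x) (hD.torsion U _ _ hU pV hY x hx)
  have t4 := congrArg (θ.phi x) (hD.torsion U _ _ hU hV pY x hx)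
  obtain ⟨n1, n2, -⟩ := θ.nijenhuis_phi hS (hV.smoothField hU hx).diff (hY.smoothField hU hx).diff
    (hV.eventually_mem hU hx) (hY.eventually_mem hU hx)
  rw [n2] at t2
  rw [n1] at t3
  rw [hD.phi_comm hU hV hx, hD.phi_comm hU hY hx] at t2
  rw [hD.phi_comm hU hV hx] at t3
  rw [hD.phi_comm hU hY hx] at t4
  have mY := fun v => θ.hproj_of_mem (hD.mem U Y hU hY x hx v)
  have mV := fun v => θ.hproj_of_mem (hD.mem U V hU hV x hx v)
  rw [θ.mixedBr_section (hV.eventually_mem hU hx) (hY.eventually_mem hU hx)]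
  simp only [map_sub, map_add, map_smul, map_neg, phi_phi, hproj_phi, mY, mV, hproj_reeb, phi_reeb,
    smul_zero, zero_sub] at t1 t2 t3 t4 ⊢
  linear_combination (norm := module) t1 + t2 + t3 - t4

/-- The source of the Koszul expression: metricity for (Y,Z) along V and for (Y,φZ) along φV,
together with `add_phi_eq_mixedBr` for Y and for Z, can be solved for L_θ(∇_V Y, Z). -/
theorem leviForm_eq_koszul (hS : S.IsPartiallyIntegrable) (hU : IsOpen U) (hV : S.IsSection U V)
    (hY : S.IsSection U Y) (hZ : S.IsSection U Z) (hx : x ∈ U) :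
    θ.leviForm x (D Y x (V x)) (Z x) = θ.koszul V Y Z x := by
  have b1 := hD.add_phi_eq_mixedBr hS hU hV hY hx
  have b2 := hD.add_phi_eq_mixedBr hS hU hV hZ hx
  have m1 : dirDeriv (fun y => θ.leviForm y (Y y) (Z y)) x (V x) = 
    θ.leviForm x (D Y x (V x)) (Z x) + θ.leviForm x (Y x) (D Z x (V x)) :=
    hD.metric U Y Z hU hY hZ x hx (V x)
  have m2 : dirDeriv (fun y => θ.leviForm y (Y y) (θ.phiF Z y)) x (θ.phi x (V x)) = 
    θ.leviForm x (D Y x (θ.phi x (V x))) (θ.phi x (Z x)) +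
      θ.leviForm x (Y x) (D (θ.phiF Z) x (θ.phi x (V x))) :=
    hD.metric U Y _ hU hY (θ.isSection_phi hU hZ) x hx _
  rw [hD.phi_comm hU hZ hx] at m2
  have hv := hV.mem x hx
  simp only [koszul]
  rw [← b1, ← b2, θ.hproj_of_mem hv, θ.vanish x _ hv, m1, m2]
  simp only [map_add, map_smul, LinearMap.add_apply, LinearMap.smul_apply, smul_eq_mul,
    θ.leviForm_phi_left hS, leviForm_phi_right]
  ring

theorem apply_reeb (hU : IsOpen U) (hY : S.IsSection U Y) (hx : x ∈ U) :
    D Y x (θ.reeb x) = (1 / 2 : ℝ) • θ.reebBr Y x := by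
  have h := hD.torsion_reeb U Y hU hY x hx
  have eY := hY.eventually_mem hU hx
  rw [hD.reeb_parallel, zero_apply, sub_zero] at h
  have hJ : S.J x (lieBr θ.reeb (S.JF Y) x) = θ.phi x (lieBr θ.reeb (θ.phiF Y) x) := by
    rw [lieBr_congr (Filter.Eventually.of_forall fun _ => rfl) (θ.phiF_eventuallyEq eY),
      θ.phi_of_mem (θ.lieBr_reeb_mem ((hY.JF hU).smoothField hU hx).diff
        ((hY.JF hU).eventually_mem hU hx))]
  rw [hJ] at h
  rw [θ.reebBr_section (hY.smoothField hU hx).diff eY]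
  linear_combination (norm := module) h

/-- Uniqueness of the Tanaka-Webster connection on sections of `H`. -/
theorem eq_koszulConn (hS : S.IsPartiallyIntegrable) (hU : IsOpen U) (hY : S.IsSection U Y)
    (hx : x ∈ U) : D Y x = θ.koszulConn Y x := by
  have hK := θ.isTanakaWebster_koszulConn hS
  obtain ⟨hU', hx', -, -⟩ := S.frame_spec x
  have hUU := hU.inter hU'
  have hxx : x ∈ U ∩ S.frameDomain x := ⟨hx, hx'⟩
  have hYY := hY.mono (Set.inter_subset_left (t := S.frameDomain x))
  ext1 v
  rw [θ.eq_hproj_add v, map_add, map_add, map_smul, map_smul, hD.apply_reeb hU hY hx,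
    hK.apply_reeb hU hY hx]
  congr 1
  obtain ⟨V, hV, hVv⟩ := S.exists_section x hx' (θ.hproj_mem v)
  rw [← hVv]
  refine θ.ext_levi_section ?_ fun Z hZ => ?_
  · rw [θ.vanish x _ (hD.mem U Y hU hY x hx _), θ.vanish x _ (hK.mem U Y hU hY x hx _)]
  · rw [hD.leviForm_eq_koszul hS hUU (hV.mono Set.inter_subset_right) hYY
        (hZ.mono Set.inter_subset_right) hxx,
      hK.leviForm_eq_koszul hS hUU (hV.mono Set.inter_subset_right) hYY
        (hZ.mono Set.inter_subset_right) hxx]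

end IsTanakaWebster

theorem smooth_mixedBr (hV : SmoothField V x) (hY : SmoothField Y x) :
    SmoothField (θ.mixedBr V Y) x :=
  (θ.smooth_hproj (((θ.smooth_hproj hV).lieBr (θ.smooth_hproj hY)).add
    ((θ.smooth_phi hV).lieBr (θ.smooth_phi hY)))).add
  (θ.smooth_phi (((θ.smooth_phi hV).lieBr (θ.smooth_hproj hY)).sub
    ((θ.smooth_hproj hV).lieBr (θ.smooth_phi hY))))

theorem smooth_reebBr (hY : SmoothField Y x) : SmoothField (θ.reebBr Y) x :=
  (θ.smooth_hproj ((θ.smooth_reeb x).lieBr (θ.smooth_hproj hY))).sub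
    (θ.smooth_phi ((θ.smooth_reeb x).lieBr (θ.smooth_phi hY)))

theorem smooth_koszul (hV : SmoothField V x) (hY : SmoothField Y x) (hZ : SmoothField Z x) :
    SmoothFun (m := m) (θ.koszul V Y Z) x := by
  have c : ∀ r : ℝ, SmoothFun (m := m) (fun _ : M => r) x := fun r => contMDiffAt_const
  have h1 := (θ.smooth_leviForm hY hZ).dirDeriv (θ.smooth_hproj hV)
  have h2 := (θ.smooth_leviForm hY (θ.smooth_phi hZ)).dirDeriv (θ.smooth_phi hV)
  have h3 := (θ.smooth_leviForm (θ.smooth_mixedBr hV hY) hZ).sub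
    (θ.smooth_leviForm hY (θ.smooth_mixedBr hV hZ))
  have h4 := θ.smooth_leviForm (θ.smooth_reebBr hY) hZ
  exact ((((c _).mul h1).add ((c _).mul h2)).add ((c _).mul h3)).add
    ((((c _).mul (θ.smoothForm x V hV))).mul h4)

/-- No smoothness is demanded of a Tanaka-Webster connection. It follows from uniqueness, because
the Koszul expression is smooth. -/
theorem smooth_tanakaWebster (hS : S.IsPartiallyIntegrable) (hU : IsOpen U) (hY : S.IsSection U Y)
    (hx : x ∈ U) (hV : SmoothField V x) : SmoothField (fun y => θ.tanakaWebster Y y (V y)) x := by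
  have hD := θ.isTanakaWebster hS
  have hU' := hU.mem_nhds hx
  refine θ.smooth_of_leviForm ?_ fun Z hZ => ?_
  · filter_upwards [hU'] with y hy using hD.mem U Y hU hY y hy _
  · obtain ⟨hW, hxW, -, -⟩ := S.frame_spec x
    refine (θ.smooth_koszul hV (hY.smoothField hU hx) (hZ.smoothField hW hxW)).congr_of_eventuallyEq ?_
    filter_upwards [hU', hW.mem_nhds hxW, hV.eventually_diff] with y hy hyW hVy
    rw [hD.eq_koszulConn hS hU hY hy, θ.leviForm_koszulConn (hY.smoothField hU hy).diff hVy
      (hZ.smoothField hW hyW).diff (hZ.mem y hyW)]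

end PseudoHermitian
end AlmostCRStructure

/-! ### Traces of H-valued endomorphisms and unitary bases -/

theorem trace_eq_sum {V ι : Type*} [AddCommGroup V] [Module ℝ V] [FiniteDimensional ℝ V] [Fintype ι]
    (A : V →ₗ[ℝ] V) (φ : ι → V →ₗ[ℝ] ℝ) (f : ι → V) (h : ∀ v, A v = ∑ i, φ i v • f i) :
    LinearMap.trace ℝ V A = ∑ i, φ i (f i) := by
  have hA : A = ∑ i, (φ i).smulRight (f i) := by
    ext v
    rw [h, LinearMap.sum_apply]
    rfl
  rw [hA, map_sum]
  exact Finset.sum_congr rfl fun i _ => LinearMap.trace_smulRight _ _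

namespace AlmostCRStructure
variable (S : AlmostCRStructure m M) {x₀ x y : M}

/-- The coefficients with respect to the frame of `H`. -/
abbrev realCoeff (x₀ : M) (j : Fin m ⊕ Fin m) (y : M) : Tgt m y →ₗ[ℝ] ℝ :=
  (S.frame_spec x₀).2.2.1.coeff (some j) y

theorem realCoeff_realFrame (hy : y ∈ S.frameDomain x₀) (j k : Fin m ⊕ Fin m) :
    S.realCoeff x₀ j y (S.realFrame x₀ k y) = if j = k then 1 else 0 := by
  have h := S.coeff_realFrame_sum hy (Pi.single k 1) j
  rw [Finset.sum_eq_single k (fun i _ hi => by simp [hi]) (by simp)] at h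
  simpa [Pi.single_apply] using h

theorem trace_eq_sum_frame (hy : y ∈ S.frameDomain x₀) (A : Tgt m y →ₗ[ℝ] Tgt m y)
    (hA : ∀ v, A v ∈ S.H y) :
    LinearMap.trace ℝ _ A = ∑ j, S.realCoeff x₀ j y (A (S.realFrame x₀ j y)) :=
  trace_eq_sum A (fun j => S.realCoeff x₀ j y ∘ₗ A) _ fun v => S.realFrame_expansion hy (hA v)

theorem finrank_H (x : M) : Module.finrank ℝ (S.H x) = 2 * m := by
  have hx := (S.frame_spec x).2.1
  have hli : LinearIndependent ℝ fun j => S.realFrame x j x := by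
    have h := ((S.frame_spec x).2.2.1.linearIndependent hx).comp some (Option.some_injective _)
    exact h
  have hs : S.H x = Submodule.span ℝ (Set.range fun j => S.realFrame x j x) := by
    refine le_antisymm (fun v hv => ?_) (Submodule.span_le.2 ?_)
    · rw [S.realFrame_expansion hx hv]
      exact Submodule.sum_mem _ fun j _ =>
        Submodule.smul_mem _ _ (Submodule.subset_span ⟨j, rfl⟩)
    · rintro _ ⟨j, rfl⟩
      exact S.realFrame_mem hx j
  rw [hs, finrank_span_eq_card hli, Fintype.card_sum, Fintype.card_fin]
  ring

namespace PseudoHermitian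
variable {S} (θ : S.PseudoHermitian)

/-- `e₁, …, e_k, J e₁, …, J e_k` are orthonormal in `(H_x, L_θ)`. -/
structure IsUnitaryFamily (x : M) {k : ℕ} (e : Fin k → Tgt m x) : Prop where
  mem : ∀ α, e α ∈ S.H x
  levi_self : ∀ α β, θ.leviForm x (e α) (e β) = if α = β then 1 else 0
  levi_phi : ∀ α β, θ.leviForm x (e α) (θ.phi x (e β)) = 0

theorem isUnitaryFamily_iff {e : Fin m → Tgt m x} : θ.IsUnitaryFamily x e ↔ θ.IsUnitaryBasis x e := by
  refine ⟨fun h => ⟨h.mem, h.levi_self, fun α β => ?_⟩, fun h => ⟨h.mem, h.levi_self, fun α β => ?_⟩⟩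
  · rw [← θ.phi_of_mem (h.mem β)]
    exact h.levi_phi α β
  · rw [θ.phi_of_mem (h.mem β)]
    exact h.levi_J α β

/-- The vectors `e₁, …, e_k, J e₁, …, J e_k`. -/
def realify {k : ℕ} (e : Fin k → Tgt m x) : Fin k ⊕ Fin k → Tgt m x :=
  Sum.elim e fun α => θ.phi x (e α)

namespace IsUnitaryFamily
variable {θ} {k : ℕ} {e : Fin k → Tgt m x} (he : θ.IsUnitaryFamily x e)
  (hS : S.IsPartiallyIntegrable)

include he

theorem realify_mem (i : Fin k ⊕ Fin k) : θ.realify e i ∈ S.H x := by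
  rcases i with α | α
  · exact he.mem α
  · exact θ.phi_mem _

include hS

theorem levi_realify (i j : Fin k ⊕ Fin k) :
    θ.leviForm x (θ.realify e i) (θ.realify e j) = if i = j then 1 else 0 := by
  rcases i with α | α <;> rcases j with β | β
  · simpa [realify] using he.levi_self α β
  · simpa [realify] using he.levi_phi α β
  · simpa [realify, θ.leviForm_symm hS (θ.phi x (e α))] using he.levi_phi β α
  · simpa [realify, θ.leviForm_phi_phi hS] using he.levi_self α β

theorem levi_sum_realify (c : Fin k ⊕ Fin k → ℝ) (j : Fin k ⊕ Fin k) :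
    θ.leviForm x (∑ i, c i • θ.realify e i) (θ.realify e j) = c j := by
  simp only [map_sum, map_smul, LinearMap.sum_apply, LinearMap.smul_apply, he.levi_realify hS]
  simp

theorem linearIndependent_realify : LinearIndependent ℝ (θ.realify e) := by
  rw [Fintype.linearIndependent_iff]
  intro c hc j
  rw [← he.levi_sum_realify hS c j, hc, map_zero, LinearMap.zero_apply]

theorem finrank_span : Module.finrank ℝ (Submodule.span ℝ (Set.range (θ.realify e))) = 2 * k := by
  rw [finrank_span_eq_card (he.linearIndependent_realify hS), Fintype.card_sum, Fintype.card_fin]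
  ring

/-- One Gram-Schmidt step: H has dimension 2m > 2k, so some vector of H has a nonzero component
orthogonal to all e_i and Je_i; it is normalised. -/
theorem exists_extend (hk : k < m) : ∃ u ∈ S.H x, θ.leviForm x u u = 1 ∧
    ∀ i, θ.leviForm x u (θ.realify e i) = 0 := by
  obtain ⟨u, hu, hne⟩ : ∃ u ∈ S.H x, u ∉ Submodule.span ℝ (Set.range (θ.realify e)) := by
    by_contra! h
    have h1 := Submodule.finrank_mono (show S.H x ≤ _ from h)
    rw [S.finrank_H, he.finrank_span hS] at h1
    omega
  set r := u - ∑ i, θ.leviForm x u (θ.realify e i) • θ.realify e i with hr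
  have hsum : ∑ i, θ.leviForm x u (θ.realify e i) • θ.realify e i ∈
      Submodule.span ℝ (Set.range (θ.realify e)) :=
    Submodule.sum_mem _ fun j _ => Submodule.smul_mem _ _ (Submodule.subset_span ⟨j, rfl⟩)
  have hrH : r ∈ S.H x := (S.H x).sub_mem hu
    ((S.H x).sum_mem fun i _ => (S.H x).smul_mem _ (he.realify_mem i))
  have hr0 : r ≠ 0 := fun h => hne (by rw [sub_eq_zero.1 h]; exact hsum)
  have hro : ∀ i, θ.leviForm x r (θ.realify e i) = 0 := fun i => by
    rw [hr, map_sub, LinearMap.sub_apply, he.levi_sum_realify hS, sub_self]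
  have hp := θ.leviForm_pos hrH hr0
  refine ⟨(√(θ.leviForm x r r))⁻¹ • r, (S.H x).smul_mem _ hrH, ?_, fun i => ?_⟩
  · simp only [map_smul, LinearMap.smul_apply, smul_eq_mul]
    have h1 := Real.mul_self_sqrt hp.le
    have h2 := Real.sqrt_pos.2 hp
    field_simp
    nlinarith
  · rw [map_smul, LinearMap.smul_apply, hro, smul_zero]

end IsUnitaryFamily

/-- Induction on k. A new vector u is automatically orthogonal to Ju, since L_θ(u, φu) = -dθ(u,u) =
0, and e_α ⊥ Ju because φ is skew. -/
theorem exists_isUnitaryFamily (hS : S.IsPartiallyIntegrable) (x : M) :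
    ∀ k ≤ m, ∃ e : Fin k → Tgt m x, θ.IsUnitaryFamily x e := by
  intro k
  induction k with
  | zero => exact fun _ => ⟨Fin.elim0, fun α => α.elim0, fun α => α.elim0, fun α => α.elim0⟩
  | succ k ih =>
    intro hk
    obtain ⟨e, he⟩ := ih (by omega)
    obtain ⟨u, hu, h1, h2⟩ := he.exists_extend hS (by omega)
    have h2' : ∀ α, θ.leviForm x u (e α) = 0 := fun α => h2 (Sum.inl α)
    have h2'' : ∀ α, θ.leviForm x u (θ.phi x (e α)) = 0 := fun α => h2 (Sum.inr α)
    have huu : θ.leviForm x u (θ.phi x u) = 0 := by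
      have := θ.dform_swap u u
      rw [leviForm_phi_right]
      linarith
    refine ⟨Fin.cons u e, fun α => ?_, fun α β => ?_, fun α β => ?_⟩
    · refine Fin.cases hu (fun α => ?_) α
      exact he.mem α
    · refine Fin.cases ?_ (fun α => ?_) α <;> refine Fin.cases ?_ (fun β => ?_) β
      · simpa using h1
      · simpa [Fin.succ_ne_zero, eq_comm] using h2' β
      · rw [θ.leviForm_symm hS]
        simpa [Fin.succ_ne_zero, eq_comm] using h2' α
      · simpa using he.levi_self α β
    · refine Fin.cases ?_ (fun α => ?_) α <;> refine Fin.cases ?_ (fun β => ?_) β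
      · simpa using huu
      · simpa using h2'' β
      · have := h2'' α
        rw [leviForm_phi_right, dform_swap] at this
        rw [Fin.cons_succ, Fin.cons_zero, leviForm_phi_right]
        linarith
      · simpa using he.levi_phi α β

theorem isUnitaryFamily_unitaryBasis (hS : S.IsPartiallyIntegrable) (x : M) :
    θ.IsUnitaryFamily x (θ.unitaryBasis x) := by
  obtain ⟨e, he⟩ := θ.exists_isUnitaryFamily hS x m le_rfl
  exact θ.isUnitaryFamily_iff.2 (Classical.epsilon_spec ⟨e, θ.isUnitaryFamily_iff.1 he⟩)

namespace IsUnitaryFamily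
variable {θ} {e : Fin m → Tgt m x} (he : θ.IsUnitaryFamily x e) (hS : S.IsPartiallyIntegrable)

include he hS

theorem expansion {v : Tgt m x} (hv : v ∈ S.H x) :
    v = ∑ i, θ.leviForm x v (θ.realify e i) • θ.realify e i := by
  have hs : S.H x = Submodule.span ℝ (Set.range (θ.realify e)) := by
    refine (Submodule.eq_of_le_of_finrank_eq (Submodule.span_le.2 ?_) ?_).symm
    · rintro _ ⟨i, rfl⟩
      exact he.realify_mem i
    · rw [he.finrank_span hS, S.finrank_H]
  rw [hs] at hv
  obtain ⟨c, rfl⟩ := (Submodule.mem_span_range_iff_exists_fun ℝ).1 hv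
  exact Finset.sum_congr rfl fun i _ => by rw [he.levi_sum_realify hS]

theorem trace_eq (A : Tgt m x →ₗ[ℝ] Tgt m x) (hA : ∀ v, A v ∈ S.H x) :
    LinearMap.trace ℝ _ A =
      ∑ α, (θ.leviForm x (A (e α)) (e α) + θ.leviForm x (A (θ.phi x (e α))) (θ.phi x (e α))) := by
  rw [trace_eq_sum A (fun i => (θ.leviForm x).flip (θ.realify e i) ∘ₗ A) _
    fun v => he.expansion hS (hA v), Fintype.sum_sum_type, ← Finset.sum_add_distrib]
  rfl

end IsUnitaryFamily

theorem trace_hproj (x : M) : LinearMap.trace ℝ _ (θ.hproj x) = 2 * m := by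
  have hx := (S.frame_spec x).2.1
  rw [S.trace_eq_sum_frame hx _ fun v => θ.hproj_mem v]
  simp only [θ.hproj_of_mem (S.realFrame_mem hx _), S.realCoeff_realFrame hx, if_true,
    Finset.sum_const, Finset.card_univ, Fintype.card_sum, Fintype.card_fin, nsmul_eq_mul]
  push_cast
  ring

theorem trace_phi (x : M) : LinearMap.trace ℝ _ (θ.phi x) = 0 := by
  have hx := (S.frame_spec x).2.1
  rw [S.trace_eq_sum_frame hx _ fun v => θ.phi_mem v, Fintype.sum_sum_type]
  have h1 : ∀ α, S.realCoeff x (Sum.inl α) x (θ.phi x (S.realFrame x (Sum.inl α) x)) = 0 := fun α => by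
    have hm := S.realFrame_mem hx (Sum.inl α)
    rw [θ.phi_of_mem hm]
    refine (S.coeffRe_J x hm α).trans ?_
    rw [S.realCoeff_realFrame hx (Sum.inr α)]
    simp
  have h2 : ∀ α, S.realCoeff x (Sum.inr α) x (θ.phi x (S.realFrame x (Sum.inr α) x)) = 0 := fun α => by
    have hm := S.realFrame_mem hx (Sum.inr α)
    rw [θ.phi_of_mem hm]
    refine (S.coeffIm_J x hm α).trans ?_
    rw [S.realCoeff_realFrame hx (Sum.inl α)]
    simp
  simp only [h1, h2, Finset.sum_const_zero, add_zero]

end PseudoHermitian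
end AlmostCRStructure

/-! ### Connection and curvature matrices in a frame of H -/

namespace AlmostCRStructure
variable (S : AlmostCRStructure m M) {x₀ x y : M}

theorem realCoeff_J {v : Tgt m y} (hv : v ∈ S.H y) :
    (fun j => S.realCoeff x₀ j y (S.J y v)) =
      (Matrix.J (Fin m) ℝ).mulVec fun j => S.realCoeff x₀ j y v := by
  funext j
  rcases j with α | α
  · rw [show S.realCoeff x₀ (Sum.inl α) y (S.J y v) = - S.realCoeff x₀ (Sum.inr α) y v from
      S.coeffRe_J x₀ hv α]
    simp [Matrix.J, Matrix.mulVec, dotProduct, Matrix.one_apply]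
  · rw [show S.realCoeff x₀ (Sum.inr α) y (S.J y v) = S.realCoeff x₀ (Sum.inl α) y v from
      S.coeffIm_J x₀ hv α]
    simp [Matrix.J, Matrix.mulVec, dotProduct, Matrix.one_apply]

namespace PseudoHermitian
variable {S} (θ : S.PseudoHermitian) {V W Z : VecField m M}

/-- The coordinates of the horizontal part of a vector. -/
def hcoord (x₀ y : M) (v : Tgt m y) (j : Fin m ⊕ Fin m) : ℝ := S.realCoeff x₀ j y (θ.hproj y v)

theorem hcoord_of_mem {v : Tgt m y} (hv : v ∈ S.H y) (j : Fin m ⊕ Fin m) :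
    θ.hcoord x₀ y v j = S.realCoeff x₀ j y v := by
  rw [hcoord, θ.hproj_of_mem hv]

theorem hcoord_phi (v : Tgt m y) :
    θ.hcoord x₀ y (θ.phi y v) = (Matrix.J (Fin m) ℝ).mulVec (θ.hcoord x₀ y v) := by
  have h := S.realCoeff_J (x₀ := x₀) (θ.hproj_mem v)
  funext j
  rw [θ.hcoord_of_mem (θ.phi_mem v)]
  exact congrFun h j

theorem hproj_eq_sum (hy : y ∈ S.frameDomain x₀) (v : Tgt m y) :
    θ.hproj y v = ∑ j, θ.hcoord x₀ y v j • S.realFrame x₀ j y :=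
  S.realFrame_expansion hy (θ.hproj_mem v)

theorem smooth_hcoord (hy : y ∈ S.frameDomain x₀) (hZ : SmoothField Z y) (j : Fin m ⊕ Fin m) :
    SmoothFun (m := m) (fun z => θ.hcoord x₀ z (Z z) j) y :=
  S.coeff_smooth hy (θ.smooth_hproj hZ) _

theorem diff_hcoord (hy : y ∈ S.frameDomain x₀) (hZ : DiffField Z y) (j : Fin m ⊕ Fin m) :
    DiffFun (m := m) (fun z => θ.hcoord x₀ z (Z z) j) y :=
  S.coeff_diff hy (θ.diff_hproj hZ) _

theorem isSection_realFrame (j : Fin m ⊕ Fin m) :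
    S.IsSection (S.frameDomain x₀) (S.realFrame x₀ j) :=
  isSection_of_smoothField (fun _ hy => S.smooth_realFrame hy j) (fun _ hy => S.realFrame_mem hy j)

theorem IsTanakaWebster.smul {θ : S.PseudoHermitian}
    {D : VecField m M → ∀ x : M, Tgt m x →L[ℝ] Tgt m x} (hD : θ.IsTanakaWebster D) {f : M → ℝ}
    (hf : DiffFun (m := m) f y) (hZ : DiffField Z y) (v : Tgt m y) :
    D (fun z => f z • Z z) y v = f y • D Z y v + dirDeriv f y v • Z y :=
  DFunLike.congr_fun (hD.isCov.leibniz hZ hf) v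

theorem IsTanakaWebster.sum {θ : S.PseudoHermitian}
    {D : VecField m M → ∀ x : M, Tgt m x →L[ℝ] Tgt m x} (hD : θ.IsTanakaWebster D) {ι : Type*}
    {s : Finset ι} {X : ι → VecField m M} (h : ∀ i ∈ s, DiffField (X i) y) (v : Tgt m y) :
    D (fun z => ∑ i ∈ s, X i z) y v = ∑ i ∈ s, D (X i) y v := by
  classical
  induction s using Finset.induction_on with
  | empty => exact DFunLike.congr_fun (hD.isCov.zero (x := y)) v
  | insert a s ha ih =>
    have h1 := h a (Finset.mem_insert_self a s)
    have h2 : ∀ i ∈ s, DiffField (X i) y := fun i hi => h i (Finset.mem_insert_of_mem hi)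
    simp only [Finset.sum_insert ha]
    rw [← ih h2]
    exact DFunLike.congr_fun (hD.isCov.add h1 (DiffField.sum h2)) v

/-- The derivative of a vector field in terms of its coordinates. -/
theorem tanakaWebster_expansion (hS : S.IsPartiallyIntegrable) (hy : y ∈ S.frameDomain x₀)
    (hZ : DiffField Z y) (v : Tgt m y) :
    θ.tanakaWebster Z y v = ∑ k, (θ.hcoord x₀ y (Z y) k • θ.tanakaWebster (S.realFrame x₀ k) y v +
      dirDeriv (fun z => θ.hcoord x₀ z (Z z) k) y v • S.realFrame x₀ k y) +
      dirDeriv (fun z => θ.form z (Z z)) y v • θ.reeb y := by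
  have hD := θ.isTanakaWebster hS
  have hU := (S.frame_spec x₀).1.mem_nhds hy
  have d1 : ∀ k, DiffField (fun z => θ.hcoord x₀ z (Z z) k • S.realFrame x₀ k z) y := fun k =>
    DiffField.smul (θ.diff_hcoord hy hZ k) (S.smooth_realFrame hy k).diff
  have d2 : DiffField (fun z => ∑ k, θ.hcoord x₀ z (Z z) k • S.realFrame x₀ k z) y :=
    DiffField.sum fun k _ => d1 k
  have d3 : DiffField (fun z => θ.form z (Z z) • θ.reeb z) y :=
    DiffField.smul (θ.diffForm y Z hZ) (θ.smooth_reeb y).diff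
  have e : ∀ᶠ z in 𝓝 y, Z z = ∑ k, θ.hcoord x₀ z (Z z) k • S.realFrame x₀ k z +
      θ.form z (Z z) • θ.reeb z := by
    filter_upwards [hU] with z hz
    rw [← θ.hproj_eq_sum hz, ← θ.eq_hproj_add]
  rw [hD.congr hZ (d2.add d3) e]
  have h1 := DFunLike.congr_fun (hD.isCov.add d2 d3) v
  refine h1.trans ?_
  rw [add_apply, hD.sum fun k _ => d1 k, hD.smul (θ.diffForm y Z hZ) (θ.smooth_reeb y).diff,
    hD.reeb_parallel, zero_apply, smul_zero, zero_add]
  congr 1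
  exact Finset.sum_congr rfl fun k _ =>
    hD.smul (θ.diff_hcoord hy hZ k) (S.smooth_realFrame hy k).diff v

/-- The connection forms of the Tanaka-Webster connection in the frame of `H`. -/
def connForm (x₀ : M) (j k : Fin m ⊕ Fin m) (y : M) : Tgt m y →L[ℝ] ℝ :=
  (LinearMap.toContinuousLinearMap (S.realCoeff x₀ j y)).comp
    (θ.tanakaWebster (S.realFrame x₀ k) y)

theorem connForm_apply (j k : Fin m ⊕ Fin m) (v : Tgt m y) :
    θ.connForm x₀ j k y v = S.realCoeff x₀ j y (θ.tanakaWebster (S.realFrame x₀ k) y v) := rfl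

theorem smooth_connForm (hS : S.IsPartiallyIntegrable) (hy : y ∈ S.frameDomain x₀)
    (j k : Fin m ⊕ Fin m) : SmoothForm (θ.connForm x₀ j k) y := fun _ hX =>
  S.coeff_smooth hy (θ.smooth_tanakaWebster hS (S.frame_spec x₀).1 (isSection_realFrame k) hy hX) _

theorem hcoord_tanakaWebster (hS : S.IsPartiallyIntegrable) (hy : y ∈ S.frameDomain x₀)
    (hZ : DiffField Z y) (v : Tgt m y) (j : Fin m ⊕ Fin m) :
    θ.hcoord x₀ y (θ.tanakaWebster Z y v) j =
      ∑ k, θ.connForm x₀ j k y v * θ.hcoord x₀ y (Z y) k +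
        dirDeriv (fun z => θ.hcoord x₀ z (Z z) j) y v := by
  have hD := θ.isTanakaWebster hS
  have hU := (S.frame_spec x₀).1
  rw [θ.tanakaWebster_expansion hS hy hZ, hcoord]
  simp only [map_add, map_sum, map_smul, hproj_reeb, map_zero, Finset.sum_add_distrib,
    smul_eq_mul, θ.hproj_of_mem (S.realFrame_mem hy _), S.realCoeff_realFrame hy,
    θ.hproj_of_mem (hD.mem _ _ hU (isSection_realFrame _) y hy v), connForm_apply]
  simp [mul_comm]

/-- The curvature is defined with `extendVec`, whose fields need not be sections of H. The frame
expansion extends smoothness to arbitrary fields Z. -/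
theorem smooth_tanakaWebster_field (hS : S.IsPartiallyIntegrable) (hx : x ∈ S.frameDomain x₀)
    (hW : SmoothField W x) (hZ : SmoothField Z x) :
    SmoothField (fun y => θ.tanakaWebster Z y (W y)) x := by
  have hU := (S.frame_spec x₀).1
  have h1 : SmoothField (fun y => ∑ k,
      (θ.hcoord x₀ y (Z y) k • θ.tanakaWebster (S.realFrame x₀ k) y (W y) +
      dirDeriv (fun z => θ.hcoord x₀ z (Z z) k) y (W y) • S.realFrame x₀ k y) +
      dirDeriv (fun z => θ.form z (Z z)) y (W y) • θ.reeb y) x := by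
    refine SmoothField.add (SmoothField.sum fun k _ => SmoothField.add ?_ ?_) ?_
    · exact SmoothField.smul (θ.smooth_hcoord hx hZ k)
        (θ.smooth_tanakaWebster hS hU (isSection_realFrame k) hx hW)
    · exact SmoothField.smul ((θ.smooth_hcoord hx hZ k).dirDeriv hW) (S.smooth_realFrame hx k)
    · exact SmoothField.smul ((θ.smoothForm x Z hZ).dirDeriv hW) (θ.smooth_reeb x)
  refine h1.congr ?_
  filter_upwards [hU.mem_nhds hx, hZ.eventually_diff] with y hy hZy
  exact θ.tanakaWebster_expansion hS hy hZy _

theorem hcoord_tanakaWebster_tanakaWebster (hS : S.IsPartiallyIntegrable)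
    (hx : x ∈ S.frameDomain x₀) (hW : SmoothField W x) (hZ : SmoothField Z x) (v : Tgt m x)
    (j : Fin m ⊕ Fin m) :
    θ.hcoord x₀ x (θ.tanakaWebster (fun y => θ.tanakaWebster Z y (W y)) x v) j =
      ∑ k, θ.connForm x₀ j k x v * (∑ l, θ.connForm x₀ k l x (W x) * θ.hcoord x₀ x (Z x) l +
        dirDeriv (fun z => θ.hcoord x₀ z (Z z) k) x (W x)) +
      (∑ k, (θ.connForm x₀ j k x (W x) * dirDeriv (fun z => θ.hcoord x₀ z (Z z) k) x v +
        θ.hcoord x₀ x (Z x) k * dirDeriv (fun z => θ.connForm x₀ j k z (W z)) x v) +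
      dirDeriv (fun y => dirDeriv (fun z => θ.hcoord x₀ z (Z z) j) y (W y)) x v) := by
  have hU := (S.frame_spec x₀).1
  have hDW := θ.smooth_tanakaWebster_field hS hx hW hZ
  have e : (fun y => θ.hcoord x₀ y (θ.tanakaWebster Z y (W y)) j) =ᶠ[𝓝 x] fun y =>
      ∑ k, θ.connForm x₀ j k y (W y) * θ.hcoord x₀ y (Z y) k +
        dirDeriv (fun z => θ.hcoord x₀ z (Z z) j) y (W y) := by
    filter_upwards [hU.mem_nhds hx, hZ.eventually_diff] with y hy hZy
    exact θ.hcoord_tanakaWebster hS hy hZy _ j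
  have s1 : ∀ k, DiffFun (m := m) (fun y => θ.connForm x₀ j k y (W y)) x := fun k =>
    (θ.smooth_connForm hS hx j k W hW).diff
  have s2 : ∀ k, DiffFun (m := m) (fun y => θ.hcoord x₀ y (Z y) k) x := fun k =>
    (θ.smooth_hcoord hx hZ k).diff
  have s12 : ∀ k, DiffFun (m := m)
      (fun y => θ.connForm x₀ j k y (W y) * θ.hcoord x₀ y (Z y) k) x := fun k => (s1 k).mul (s2 k)
  have s3 : DiffFun (m := m) (fun y => dirDeriv (fun z => θ.hcoord x₀ z (Z z) j) y (W y)) x :=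
    ((θ.smooth_hcoord hx hZ j).dirDeriv hW).diff
  rw [θ.hcoord_tanakaWebster hS hx hDW.diff, dirDeriv_congr e,
    dirDeriv_add (DiffFun.sum fun k _ => s12 k) s3, dirDeriv_sum fun k _ => s12 k]
  congr 1
  · exact Finset.sum_congr rfl fun k _ => by rw [θ.hcoord_tanakaWebster hS hx hZ.diff]
  · congr 1
    exact Finset.sum_congr rfl fun k _ => dirDeriv_mul (s1 k) (s2 k) v

/-- The matrix of connection forms, evaluated on a vector. -/
def connMat (x₀ y : M) (v : Tgt m y) : Matrix (Fin m ⊕ Fin m) (Fin m ⊕ Fin m) ℝ :=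
  Matrix.of fun j k => θ.connForm x₀ j k y v

/-- The curvature matrix `dω + ω ∧ ω`. -/
def curvMat (x₀ x : M) (v w : Tgt m x) : Matrix (Fin m ⊕ Fin m) (Fin m ⊕ Fin m) ℝ :=
  Matrix.of (fun j k => extD (θ.connForm x₀ j k) x v w) +
    (θ.connMat x₀ x v * θ.connMat x₀ x w - θ.connMat x₀ x w * θ.connMat x₀ x v)

theorem hcoord_sub (u v : Tgt m y) (j : Fin m ⊕ Fin m) :
    θ.hcoord x₀ y (u - v) j = θ.hcoord x₀ y u j - θ.hcoord x₀ y v j := by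
  simp only [hcoord, map_sub]

/-- Cartan's structure equation. The second derivatives of the coordinates of z cancel against the
derivative along [v,w], by `dirDeriv_lieBr`. -/
theorem hcoord_curvature (hS : S.IsPartiallyIntegrable) (hx : x ∈ S.frameDomain x₀)
    (v w z : Tgt m x) : θ.hcoord x₀ x (θ.curvature x v w z) =
      (θ.curvMat x₀ x v w).mulVec (θ.hcoord x₀ x z) := by
  funext j
  have sv := smoothField_extendVec v
  have sw := smoothField_extendVec w
  have sz := smoothField_extendVec z
  have hb := dirDeriv_lieBr (θ.smooth_hcoord hx sz j) sv sw
  rw [curvature, hcoord_sub, hcoord_sub, θ.hcoord_tanakaWebster_tanakaWebster hS hx sw sz,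
    θ.hcoord_tanakaWebster_tanakaWebster hS hx sv sz, θ.hcoord_tanakaWebster hS hx sz.diff, hb]
  simp only [extendVec_self]
  have e1 : (θ.curvMat x₀ x v w).mulVec (θ.hcoord x₀ x z) j =
      ∑ k, extD (θ.connForm x₀ j k) x v w * θ.hcoord x₀ x z k +
      (∑ k, θ.connForm x₀ j k x v * ∑ l, θ.connForm x₀ k l x w * θ.hcoord x₀ x z l -
        ∑ k, θ.connForm x₀ j k x w * ∑ l, θ.connForm x₀ k l x v * θ.hcoord x₀ x z l) := by
    rw [curvMat, Matrix.add_mulVec, Matrix.sub_mulVec, ← Matrix.mulVec_mulVec,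
      ← Matrix.mulVec_mulVec]
    rfl
  rw [e1]
  simp only [extD, sub_mul, mul_add, Finset.sum_add_distrib, Finset.sum_sub_distrib]
  simp only [mul_comm (θ.hcoord x₀ x z _)]
  ring

end PseudoHermitian
end AlmostCRStructure

/-! ### The gauge form and the Webster scalar curvature -/

namespace AlmostCRStructure
namespace PseudoHermitian
variable {S : AlmostCRStructure m M} (θ : S.PseudoHermitian) {x₀ x y : M} {V W Z : VecField m M}

/-- ∇J = 0 makes the connection matrix complex linear, that is, of block form [[a,-b],[b,a]]. -/
theorem connForm_inr (hS : S.IsPartiallyIntegrable) (hy : y ∈ S.frameDomain x₀) (α β : Fin m) :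
    θ.connForm x₀ (Sum.inl α) (Sum.inr β) y = - θ.connForm x₀ (Sum.inr α) (Sum.inl β) y ∧
    θ.connForm x₀ (Sum.inr α) (Sum.inr β) y = θ.connForm x₀ (Sum.inl α) (Sum.inl β) y := by
  have hD := θ.isTanakaWebster hS
  have hU := (S.frame_spec x₀).1
  have h : ∀ v, θ.tanakaWebster (S.realFrame x₀ (Sum.inr β)) y v =
      S.J y (θ.tanakaWebster (S.realFrame x₀ (Sum.inl β)) y v) :=
    hD.comm_J _ _ hU (isSection_realFrame (Sum.inl β)) y hy
  have hm := hD.mem _ _ hU (isSection_realFrame (Sum.inl β)) y hy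
  refine ⟨?_, ?_⟩
  · ext v
    rw [connForm_apply, h, neg_apply, connForm_apply]
    exact S.coeffRe_J x₀ (hm v) α
  · ext v
    rw [connForm_apply, h, connForm_apply]
    exact S.coeffIm_J x₀ (hm v) α

theorem _root_.CR.commute_J {A : Matrix (Fin m ⊕ Fin m) (Fin m ⊕ Fin m) ℝ}
    (h1 : ∀ α β, A (Sum.inl α) (Sum.inr β) = - A (Sum.inr α) (Sum.inl β))
    (h2 : ∀ α β, A (Sum.inr α) (Sum.inr β) = A (Sum.inl α) (Sum.inl β)) :
    Commute (Matrix.J (Fin m) ℝ) A := by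
  change _ * _ = _ * _
  ext j k
  rcases j with α | α <;> rcases k with β | β <;>
    simp [Matrix.J, Matrix.mul_apply, Matrix.one_apply, h1, h2]

theorem _root_.CR.extD_neg_form (η : ∀ y : M, Tgt m y →L[ℝ] ℝ) (v w : Tgt m x) :
    extD (fun y => - η y) x v w = - extD η x v w := by
  simp only [extD, neg_apply, dirDeriv_neg]
  ring

theorem extD_connForm_inr (hS : S.IsPartiallyIntegrable) (hx : x ∈ S.frameDomain x₀)
    (v w : Tgt m x) (α β : Fin m) :
    extD (θ.connForm x₀ (Sum.inl α) (Sum.inr β)) x v w =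
      - extD (θ.connForm x₀ (Sum.inr α) (Sum.inl β)) x v w ∧
    extD (θ.connForm x₀ (Sum.inr α) (Sum.inr β)) x v w =
      extD (θ.connForm x₀ (Sum.inl α) (Sum.inl β)) x v w := by
  have hU := (S.frame_spec x₀).1.mem_nhds hx
  refine ⟨?_, ?_⟩
  · rw [← extD_neg_form]
    refine extD_congr ?_ v w
    filter_upwards [hU] with y hy using (θ.connForm_inr hS hy α β).1
  · refine extD_congr ?_ v w
    filter_upwards [hU] with y hy using (θ.connForm_inr hS hy α β).2

theorem commute_connMat (hS : S.IsPartiallyIntegrable) (hy : y ∈ S.frameDomain x₀) (v : Tgt m y) :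
    Commute (Matrix.J (Fin m) ℝ) (θ.connMat x₀ y v) :=
  commute_J (fun α β => DFunLike.congr_fun (θ.connForm_inr hS hy α β).1 v)
    (fun α β => DFunLike.congr_fun (θ.connForm_inr hS hy α β).2 v)

theorem commute_curvMat (hS : S.IsPartiallyIntegrable) (hx : x ∈ S.frameDomain x₀) (v w : Tgt m x) :
    Commute (Matrix.J (Fin m) ℝ) (θ.curvMat x₀ x v w) := by
  have hv := θ.commute_connMat hS hx v
  have hw := θ.commute_connMat hS hx w
  exact (commute_J (fun α β => (θ.extD_connForm_inr hS hx v w α β).1)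
    (fun α β => (θ.extD_connForm_inr hS hx v w α β).2)).add_right
    ((hv.mul_right hw).sub_right (hw.mul_right hv))

/-- The gauge form `-Im ∑_α ω_α^α` as a differential form. -/
def gaugeCLM (x₀ y : M) : Tgt m y →L[ℝ] ℝ := - ∑ α, θ.connForm x₀ (Sum.inr α) (Sum.inl α) y

theorem gaugeCLM_apply (v : Tgt m y) :
    θ.gaugeCLM x₀ y v = - ∑ α, θ.connForm x₀ (Sum.inr α) (Sum.inl α) y v := by
  rw [gaugeCLM, neg_apply, sum_apply]

theorem smooth_gaugeCLM (hS : S.IsPartiallyIntegrable) (hy : y ∈ S.frameDomain x₀) :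
    SmoothForm (θ.gaugeCLM x₀) y := by
  intro X hX
  have h : SmoothFun (m := m) (fun z => - ∑ α, θ.connForm x₀ (Sum.inr α) (Sum.inl α) z (X z)) y :=
    ContMDiffAt.neg (ContMDiffAt.sum fun α _ => θ.smooth_connForm hS hy _ _ X hX)
  exact h.congr_of_eventuallyEq (Filter.Eventually.of_forall fun z => θ.gaugeCLM_apply _)

theorem extD_gaugeCLM (hS : S.IsPartiallyIntegrable) (hx : x ∈ S.frameDomain x₀) (v w : Tgt m x) :
    extD (θ.gaugeCLM x₀) x v w = - ∑ α, extD (θ.connForm x₀ (Sum.inr α) (Sum.inl α)) x v w := by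
  have d : ∀ (u : Tgt m x) (α : Fin m), DiffFun (m := m)
      (fun y => θ.connForm x₀ (Sum.inr α) (Sum.inl α) y (extendVec u y)) x := fun u α =>
    (θ.smooth_connForm hS hx _ _ _ (smoothField_extendVec u)).diff
  simp only [extD, gaugeCLM_apply, dirDeriv_neg]
  rw [dirDeriv_sum fun α _ => d w α, dirDeriv_sum fun α _ => d v α]
  simp only [Finset.sum_sub_distrib]
  ring

/-- As J commutes with ω, the trace of J[ω(v),ω(w)] vanishes by cyclicity. In tr(J dω) both
off-diagonal blocks contribute equally, whence the factor 2. -/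
theorem trace_J_mul_curvMat (hS : S.IsPartiallyIntegrable) (hx : x ∈ S.frameDomain x₀)
    (v w : Tgt m x) :
    (Matrix.J (Fin m) ℝ * θ.curvMat x₀ x v w).trace = 2 * extD (θ.gaugeCLM x₀) x v w := by
  have hv := θ.commute_connMat hS hx v
  have h1 : (Matrix.J (Fin m) ℝ * (θ.connMat x₀ x v * θ.connMat x₀ x w)).trace =
      (Matrix.J (Fin m) ℝ * (θ.connMat x₀ x w * θ.connMat x₀ x v)).trace := by
    rw [← mul_assoc, hv.eq, mul_assoc, Matrix.trace_mul_comm, mul_assoc]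
  rw [curvMat, mul_add, mul_sub, Matrix.trace_add, Matrix.trace_sub, h1, sub_self, add_zero,
    θ.extD_gaugeCLM hS hx]
  simp only [Matrix.trace, Matrix.diag, Matrix.mul_apply, Fintype.sum_sum_type, Matrix.J,
    Matrix.of_apply]
  simp [Matrix.one_apply, (θ.extD_connForm_inr hS hx v w _ _).1]
  ring

/-- The curvature endomorphism `R(v,w)` of `H`, extended by zero on the Reeb field. -/
def curvEnd (x : M) (v w : Tgt m x) : Tgt m x →ₗ[ℝ] Tgt m x :=
  ∑ j, ∑ k, (θ.curvMat x x v w j k) • ((S.realCoeff x k x ∘ₗ θ.hproj x).smulRight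
    (S.realFrame x j x))

theorem curvEnd_apply (v w z : Tgt m x) : θ.curvEnd x v w z =
    ∑ j, (θ.curvMat x x v w).mulVec (θ.hcoord x x z) j • S.realFrame x j x := by
  simp only [curvEnd, LinearMap.sum_apply, LinearMap.smul_apply, LinearMap.smulRight_apply, smul_smul,
    Matrix.mulVec, dotProduct, Finset.sum_smul]
  rfl

theorem hproj_curvature (hS : S.IsPartiallyIntegrable) (v w z : Tgt m x) :
    θ.hproj x (θ.curvature x v w z) = θ.curvEnd x v w z := by
  have hx := (S.frame_spec x).2.1
  rw [θ.hproj_eq_sum hx, θ.hcoord_curvature hS hx, curvEnd_apply]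

theorem curvEnd_mem (hS : S.IsPartiallyIntegrable) (v w z : Tgt m x) :
    θ.curvEnd x v w z ∈ S.H x := by
  rw [← θ.hproj_curvature hS]
  exact θ.hproj_mem _

theorem hcoord_curvEnd (hS : S.IsPartiallyIntegrable) (v w z : Tgt m x) :
    θ.hcoord x x (θ.curvEnd x v w z) = (θ.curvMat x x v w).mulVec (θ.hcoord x x z) := by
  have hx := (S.frame_spec x).2.1
  rw [← θ.hproj_curvature hS, ← θ.hcoord_curvature hS hx]
  funext j
  rw [hcoord, hcoord, θ.hproj_of_mem (θ.hproj_mem _)]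

theorem curvEnd_phi (hS : S.IsPartiallyIntegrable) (v w z : Tgt m x) :
    θ.curvEnd x v w (θ.phi x z) = θ.phi x (θ.curvEnd x v w z) := by
  have hx := (S.frame_spec x).2.1
  have h : θ.hcoord x x (θ.curvEnd x v w (θ.phi x z)) =
      θ.hcoord x x (θ.phi x (θ.curvEnd x v w z)) := by
    rw [θ.hcoord_curvEnd hS, θ.hcoord_phi, θ.hcoord_phi, θ.hcoord_curvEnd hS, Matrix.mulVec_mulVec,
      Matrix.mulVec_mulVec, (θ.commute_curvMat hS hx v w).eq]
  have h1 := θ.hproj_eq_sum hx (θ.curvEnd x v w (θ.phi x z))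
  rw [h, ← θ.hproj_eq_sum hx, θ.hproj_of_mem (θ.curvEnd_mem hS _ _ _), hproj_phi] at h1
  exact h1

theorem trace_phi_curvEnd (hS : S.IsPartiallyIntegrable) (v w : Tgt m x) :
    LinearMap.trace ℝ _ (θ.phi x ∘ₗ θ.curvEnd x v w) = 2 * extD (θ.gaugeCLM x) x v w := by
  have hx := (S.frame_spec x).2.1
  rw [S.trace_eq_sum_frame hx (θ.phi x ∘ₗ θ.curvEnd x v w) fun u => θ.phi_mem _, ← θ.trace_J_mul_curvMat hS hx, Matrix.trace]
  refine Finset.sum_congr rfl fun j _ => ?_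
  rw [LinearMap.comp_apply, ← θ.hcoord_of_mem (θ.phi_mem _), θ.hcoord_phi, θ.hcoord_curvEnd hS,
    Matrix.mulVec_mulVec]
  have e : θ.hcoord x x (S.realFrame x j x) = Pi.single j 1 := by
    funext k
    rw [θ.hcoord_of_mem (S.realFrame_mem hx j), S.realCoeff_realFrame hx, Pi.single_apply]
  rw [e, Matrix.mulVec_single_one]
  rfl

/-- The real trace of φR(v,w) counts e_β and Je_β equally because R commutes with φ. This cancels
the factor 2 and shows that the sum does not depend on the unitary basis. -/
theorem sum_levi_curvature (hS : S.IsPartiallyIntegrable) {e : Fin m → Tgt m x}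
    (he : θ.IsUnitaryFamily x e) (v w : Tgt m x) :
    ∑ β, θ.levi x (θ.curvature x v w (e β)) (S.J x (e β)) = - extD (θ.gaugeCLM x) x v w := by
  have h := θ.trace_phi_curvEnd hS v w
  rw [he.trace_eq hS (θ.phi x ∘ₗ θ.curvEnd x v w) fun u => θ.phi_mem _] at h
  have h1 : ∀ β, θ.levi x (θ.curvature x v w (e β)) (S.J x (e β)) =
      - θ.leviForm x (θ.phi x (θ.curvEnd x v w (e β))) (e β) := fun β => by
    rw [← leviForm_apply, ← leviForm_hproj_left, θ.hproj_curvature hS, ← θ.phi_of_mem (he.mem β),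
      leviForm_phi_right, θ.leviForm_phi_left hS]
  have h2 : ∀ β, θ.leviForm x ((θ.phi x ∘ₗ θ.curvEnd x v w) (θ.phi x (e β))) (θ.phi x (e β)) =
      θ.leviForm x (θ.phi x (θ.curvEnd x v w (e β))) (e β) := fun β => by
    rw [LinearMap.comp_apply, θ.curvEnd_phi hS, θ.leviForm_phi_phi hS]
  simp only [LinearMap.comp_apply] at h h2
  simp only [h2] at h
  rw [Finset.sum_add_distrib] at h
  simp only [h1, Finset.sum_neg_distrib]
  linarith

/-- The Webster scalar curvature is the trace of the curvature of the gauge form. -/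
theorem scal_eq (hS : S.IsPartiallyIntegrable) (x : M) :
    θ.scal x = ∑ α, extD (θ.gaugeCLM x) x (θ.unitaryBasis x α) (θ.phi x (θ.unitaryBasis x α)) := by
  have he := θ.isUnitaryFamily_unitaryBasis hS x
  have h : ∀ v w : Tgt m x, θ.ric x v w = Complex.I * ((- extD (θ.gaugeCLM x) x v w : ℝ) : ℂ) :=
    fun v w => by
      rw [← θ.sum_levi_curvature hS he v w, ric]
      push_cast
      rfl
  simp only [scal, h, ← Finset.mul_sum, ← mul_assoc, Complex.I_mul_I, ← Complex.ofReal_sum]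
  rw [← Complex.ofReal_one, ← Complex.ofReal_neg, ← Complex.ofReal_mul, Complex.ofReal_re,
    Finset.sum_neg_distrib]
  simp only [θ.phi_of_mem (he.mem _)]
  ring

/-- The section `frameForm x₀` is constantly 1 on the frame, so ∇σ is minus the complex trace of the
connection in that frame. -/
theorem gaugeForm_eq (hy : y ∈ S.frameDomain x₀) (v : Tgt m y) :
    θ.gaugeForm x₀ y v = θ.gaugeCLM x₀ y v := by
  have hU := (S.frame_spec x₀).1.mem_nhds hy
  have h1 : ∀ z ∈ S.frameDomain x₀, (S.frameForm x₀ z).1 (fun k => S.quotFrame x₀ k z) = 1 :=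
    fun z hz => S.evalFrame_frameForm hz
  have h2 : (fun z => (S.frameForm x₀ z).1 (fun k => S.quotFrame x₀ k z)) =ᶠ[𝓝 y]
      fun _ => (1 : ℂ) := by
    filter_upwards [hU] with z hz using h1 z hz
  have h3 : ∀ (j : Fin (m + 1)) (u : Tgt m y), (S.frameForm x₀ y).1
      (Function.update (fun i => S.quotFrame x₀ i y) j u) = S.coframe x₀ y u j := by
    intro j u
    rw [frameForm_apply]
    have e : (Matrix.of fun k => S.coframe x₀ y
        (Function.update (fun i => S.quotFrame x₀ i y) j u k)) =
        Matrix.updateRow (1 : Matrix (Fin (m + 1)) (Fin (m + 1)) ℂ) j (S.coframe x₀ y u) := by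
      ext k l
      rw [Matrix.of_apply, Matrix.updateRow_apply]
      by_cases hk : k = j
      · subst hk
        simp
      · rw [Function.update_of_ne hk, if_neg hk, S.coframe_quotFrame hy, Matrix.one_apply,
          Pi.single_apply]
        simp [eq_comm]
    rw [e, ← Matrix.cramer_transpose_apply]
    simp
  rw [gaugeForm, covDerivForm, h1 y hy, div_one, dirDeriv_congr h2, dirDeriv_const, zero_sub,
    gaugeCLM_apply]
  simp only [h3]
  -- The transverse slot contributes a real number, hence nothing to the imaginary part.
  rw [Fin.sum_univ_succ, coframe_zero, Complex.neg_im, Complex.add_im, Complex.ofReal_im, zero_add,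
    Complex.im_sum]
  congr 1
  refine Finset.sum_congr rfl fun α _ => ?_
  rw [coframe_succ]
  simp
  rfl

end PseudoHermitian
end AlmostCRStructure

/-! ### Conformal change of the Reeb field, of φ and of the Koszul expression -/

namespace AlmostCRStructure
namespace PseudoHermitian
variable {S : AlmostCRStructure m M} (θ θ' : S.PseudoHermitian) {x₀ x y : M} {V Y Z W : VecField m M}
  {U : Set M} {f : M → ℝ}

theorem exists_grad (f : M → ℝ) (x : M) : ∃ g ∈ S.H x, ∀ w ∈ S.H x,
    θ.leviForm x g w = dirDeriv f x w :=
  exists_mem_forall_eq (S.H x) (θ.leviForm x) (fun _ hv h => θ.eq_zero_of_leviForm hv h)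
    (mvfderiv (𝓡 (2 * m + 1)) f x : Tgt m x →L[ℝ] ℝ).toLinearMap

/-- The horizontal gradient of a function. -/
def grad (f : M → ℝ) : VecField m M := fun x => (θ.exists_grad f x).choose

theorem grad_mem (f : M → ℝ) (x : M) : θ.grad f x ∈ S.H x := (θ.exists_grad f x).choose_spec.1

theorem leviForm_grad (f : M → ℝ) {w : Tgt m x} (hw : w ∈ S.H x) :
    θ.leviForm x (θ.grad f x) w = dirDeriv f x w := (θ.exists_grad f x).choose_spec.2 w hw

theorem smooth_grad (hf : SmoothFun (m := m) f x) : SmoothField (θ.grad f) x := by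
  refine θ.smooth_of_leviForm (Filter.Eventually.of_forall (θ.grad_mem f)) fun Y hY => ?_
  obtain ⟨hU, hx, -, -⟩ := S.frame_spec x
  refine (hf.dirDeriv (hY.smoothField hU hx)).congr_of_eventuallyEq ?_
  filter_upwards [hU.mem_nhds hx] with y hy using θ.leviForm_grad f (hY.mem y hy)

/-- The horizontal part of the change of the Reeb field, `-2 J grad f`. -/
def twist (f : M → ℝ) : VecField m M := fun x => (-2 : ℝ) • θ.phi x (θ.grad f x)

theorem twist_mem (f : M → ℝ) (x : M) : θ.twist f x ∈ S.H x := (S.H x).smul_mem _ (θ.phi_mem _)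

theorem smooth_twist (hf : SmoothFun (m := m) f x) : SmoothField (θ.twist f) x :=
  SmoothField.smul (f := fun _ => (-2 : ℝ)) contMDiffAt_const (θ.smooth_phi (θ.smooth_grad hf))

theorem isSection_twist (hf : ∀ y ∈ U, SmoothFun (m := m) f y) : S.IsSection U (θ.twist f) :=
  isSection_of_smoothField (fun y hy => θ.smooth_twist (hf y hy)) fun y _ => θ.twist_mem f y

theorem phi_twist : θ.phi x (θ.twist f x) = (2 : ℝ) • θ.grad f x := by
  rw [twist, map_smul, phi_phi, θ.hproj_of_mem (θ.grad_mem f x)]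
  module

theorem leviForm_twist_left (hS : S.IsPartiallyIntegrable) (v : Tgt m x) :
    θ.leviForm x (θ.twist f x) v = 2 * θ.leviForm x (θ.grad f x) (θ.phi x v) := by
  rw [twist, map_smul, LinearMap.smul_apply, θ.leviForm_phi_left hS, leviForm_phi_right, smul_eq_mul]
  ring

theorem leviForm_grad_phi_grad : θ.leviForm x (θ.grad f x) (θ.phi x (θ.grad f x)) = 0 := by
  have := θ.dform_swap (θ.grad f x) (θ.grad f x)
  rw [leviForm_phi_right]
  linarith

theorem dirDeriv_twist : dirDeriv f x (θ.twist f x) = 0 := by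
  rw [← θ.leviForm_grad f (θ.twist_mem f x), twist, map_smul, leviForm_grad_phi_grad, smul_zero]

theorem eq_reeb {u : Tgt m x} (h1 : θ.form x u = 1) (h2 : ∀ v, θ.dform x u v = 0) :
    u = θ.reeb x := by
  refine sub_eq_zero.1 (θ.eq_zero_of_dform ?_ fun w _ => ?_)
  · rw [← θ.form_eq_zero_iff, map_sub, h1, form_reeb, sub_self]
  · rw [map_sub, LinearMap.sub_apply, h2, dform_reeb_left, sub_zero]

/-- `θ' = e^{2f} θ` for a smooth function `f`. -/
structure IsConformal (f : M → ℝ) : Prop where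
  smooth : ContMDiff (𝓡 (2 * m + 1)) 𝓘(ℝ, ℝ) ∞ f
  form_eq : ∀ x, θ'.form x = Real.exp (2 * f x) • θ.form x

theorem _root_.CR.SmoothFun.exp_mul (hf : SmoothFun (m := m) f x) (c : ℝ) :
    SmoothFun (m := m) (fun y => Real.exp (c * f y)) x :=
  (Real.contDiff_exp.contMDiff.contMDiffAt).comp x
    (ContMDiffAt.mul (f := fun _ => c) contMDiffAt_const hf)

theorem _root_.CR.dirDeriv_exp_mul (hf : DiffFun (m := m) f x) (c : ℝ) (v : Tgt m x) :
    dirDeriv (fun y => Real.exp (c * f y)) x v = c * Real.exp (c * f x) * dirDeriv f x v := by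
  have h1 : HasDerivAt (fun t => Real.exp (c * t)) (Real.exp (c * f x) * (c * 1)) (f x) :=
    ((hasDerivAt_id _).const_mul c).exp
  have h2 := h1.hasFDerivAt.hasMFDerivAt.comp x hf.hasMFDerivAt
  have h3 : mfderiv (𝓡 (2 * m + 1)) 𝓘(ℝ, ℝ) (fun y => Real.exp (c * f y)) x = _ := h2.mfderiv
  have h4 : ∀ t : ℝ, t * (Real.exp (c * f x) * (c * 1)) = c * Real.exp (c * f x) * t := by
    intro t
    ring
  simp only [dirDeriv, mvfderiv, ContinuousLinearMap.comp_apply, h3]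
  exact h4 _

namespace IsConformal
variable {θ θ'} (hc : θ.IsConformal θ' f) (hS : S.IsPartiallyIntegrable)

include hc

theorem dform_eq (v w : Tgt m x) : θ'.dform x v w = Real.exp (2 * f x) *
    (θ.dform x v w + 2 * (dirDeriv f x v * θ.form x w - dirDeriv f x w * θ.form x v)) := by
  have hf : SmoothFun (m := m) f x := hc.smooth x
  have h1 : θ'.form = fun y => Real.exp (2 * f y) • θ.form y := funext hc.form_eq
  rw [dform_apply, h1, extD_smul_form (SmoothFun.exp_mul hf 2).diff (θ.diffForm x),
    dirDeriv_exp_mul hf.diff, dirDeriv_exp_mul hf.diff, dform_apply]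
  ring

theorem dform_of_mem {v w : Tgt m x} (hv : v ∈ S.H x) (hw : w ∈ S.H x) :
    θ'.dform x v w = Real.exp (2 * f x) * θ.dform x v w := by
  rw [hc.dform_eq, θ.vanish x v hv, θ.vanish x w hw]
  ring

theorem leviForm_of_mem {v w : Tgt m x} (hv : v ∈ S.H x) (hw : w ∈ S.H x) :
    θ'.leviForm x v w = Real.exp (2 * f x) * θ.leviForm x v w := by
  rw [PseudoHermitian.leviForm_eq, hc.dform_of_mem hv (θ'.phi_mem w), PseudoHermitian.leviForm_eq,
    θ'.phi_of_mem hw, θ.phi_of_mem hw]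

include hS

/-- The candidate satisfies the two equations characterising T'. The vector W is chosen so that
dθ(W,·) = 2df on H, which cancels the term -2df of d(e^{2f}θ)(T,·), while df(W) = 0. -/
theorem reeb_eq (x : M) :
    θ'.reeb x = Real.exp (-2 * f x) • (θ.reeb x + θ.twist f x) := by
  have hE : Real.exp (2 * f x) * Real.exp (-2 * f x) = 1 := by rw [← Real.exp_add]; simp
  refine (θ'.eq_reeb ?_ fun v => ?_).symm
  · rw [hc.form_eq, smul_apply, map_smul, map_add, form_reeb, θ.vanish x _ (θ.twist_mem f x)]
    simpa using hE
  · rw [map_smul, LinearMap.smul_apply, hc.dform_eq, map_add, LinearMap.add_apply, dform_reeb_left,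
      map_add, form_reeb, θ.vanish x _ (θ.twist_mem f x), dirDeriv_add_vec, dirDeriv_twist,
      ← θ.leviForm_phi_left hS, phi_twist, map_smul, LinearMap.smul_apply,
      ← θ.leviForm_hproj_right, θ.leviForm_grad f (θ.hproj_mem v)]
    have hv := congrArg (dirDeriv f x) (θ.eq_hproj_add v)
    rw [dirDeriv_add_vec, dirDeriv_smul_vec] at hv
    rw [hv]
    simp only [smul_eq_mul]
    ring

theorem hproj_eq (v : Tgt m x) : θ'.hproj x v = θ.hproj x v - θ.form x v • θ.twist f x := by
  have hE : Real.exp (2 * f x) * Real.exp (-2 * f x) = 1 := by rw [← Real.exp_add]; simp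
  rw [hproj_apply, hproj_apply, hc.form_eq, hc.reeb_eq hS, smul_apply, smul_smul, smul_eq_mul,
    mul_right_comm, hE]
  module

theorem phi_eq (v : Tgt m x) : θ'.phi x v = θ.phi x v - (2 * θ.form x v) • θ.grad f x := by
  rw [phi_apply, ← θ.phi_of_mem (θ'.hproj_mem v), hc.hproj_eq hS, map_sub, map_smul, phi_hproj,
    phi_twist]
  module

theorem leviForm_eq (v w : Tgt m x) : θ'.leviForm x v w =
    Real.exp (2 * f x) * θ.leviForm x (θ'.hproj x v) (θ'.hproj x w) := by
  rw [← leviForm_hproj_left, PseudoHermitian.leviForm_eq, hc.dform_of_mem (θ'.hproj_mem v) (θ'.phi_mem w),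
    PseudoHermitian.leviForm_eq, θ.phi_of_mem (θ'.hproj_mem w), θ'.phi_apply w]

/-- For sections of H the brackets are the same for θ and θ'; only the projections differ. The
change is therefore governed by the θ-components of the brackets, which are values of dθ. -/
theorem mixedBr_eq (hV : DiffField V x) (hY : DiffField Y x) (hV' : ∀ᶠ y in 𝓝 x, V y ∈ S.H y)
    (hY' : ∀ᶠ y in 𝓝 x, Y y ∈ S.H y) :
    θ'.mixedBr V Y x = θ.mixedBr V Y x - (4 * θ.dform x (V x) (Y x)) • θ.phi x (θ.grad f x) -
      (4 * θ.leviForm x (V x) (Y x)) • θ.grad f x := by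
  have hφ : ∀ {A : VecField m M}, ∀ᶠ y in 𝓝 x, θ.phiF A y ∈ S.H y :=
    Filter.Eventually.of_forall fun _ => θ.phi_mem _
  have e : ∀ {A : VecField m M}, ∀ᶠ y in 𝓝 x, A y = A y := Filter.Eventually.of_forall fun _ => rfl
  have e' : ∀ {A : VecField m M}, (∀ᶠ y in 𝓝 x, A y ∈ S.H y) →
      ∀ᶠ y in 𝓝 x, θ'.phiF A y = θ.phiF A y := fun hA => by
    filter_upwards [hA] with y hy
    exact (θ'.phi_of_mem hy).trans (θ.phi_of_mem hy).symm
  rw [θ'.mixedBr_section hV' hY', θ.mixedBr_section hV' hY', lieBr_congr (e' hV') (e' hY'),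
    lieBr_congr (e' hV') (e (A := Y)), lieBr_congr (e (A := V)) (e' hY'), hc.hproj_eq hS, hc.phi_eq hS]
  have h1 : θ.form x (lieBr V Y x + lieBr (θ.phiF V) (θ.phiF Y) x) = - (2 * θ.dform x (V x) (Y x)) := by
    rw [map_add, θ.form_lieBr hV hY hV' hY', θ.form_lieBr (θ.diff_phi hV) (θ.diff_phi hY) hφ hφ,
      θ.dform_phi_phi hS]
    ring
  have h2 : θ.form x (lieBr (θ.phiF V) Y x - lieBr V (θ.phiF Y) x) =
      2 * θ.leviForm x (V x) (Y x) := by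
    rw [map_sub, θ.form_lieBr (θ.diff_phi hV) hY hφ hY', θ.form_lieBr hV (θ.diff_phi hY) hV' hφ,
      θ.dform_phi_left hS, PseudoHermitian.leviForm_eq]
    ring
  rw [h1, h2, twist]
  module

theorem koszul_eq (hV : DiffField V x) (hY : DiffField Y x) (hZ : DiffField Z x)
    (hV' : ∀ᶠ y in 𝓝 x, V y ∈ S.H y) (hY' : ∀ᶠ y in 𝓝 x, Y y ∈ S.H y)
    (hZ' : ∀ᶠ y in 𝓝 x, Z y ∈ S.H y) :
    θ'.koszul V Y Z x = Real.exp (2 * f x) * (θ.koszul V Y Z x +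
      dirDeriv f x (V x) * θ.leviForm x (Y x) (Z x) +
      dirDeriv f x (θ.phi x (V x)) * θ.leviForm x (Y x) (θ.phi x (Z x)) -
      θ.dform x (V x) (Y x) * θ.leviForm x (θ.phi x (θ.grad f x)) (Z x) -
      θ.leviForm x (V x) (Y x) * θ.leviForm x (θ.grad f x) (Z x) +
      θ.dform x (V x) (Z x) * θ.leviForm x (Y x) (θ.phi x (θ.grad f x)) +
      θ.leviForm x (V x) (Z x) * θ.leviForm x (Y x) (θ.grad f x)) := by
  have hf : SmoothFun (m := m) f x := hc.smooth x
  have hE := SmoothFun.exp_mul hf 2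
  have e1 : (fun y => θ'.leviForm y (Y y) (Z y)) =ᶠ[𝓝 x]
      fun y => Real.exp (2 * f y) * θ.leviForm y (Y y) (Z y) := by
    filter_upwards [hY', hZ'] with y h1 h2 using hc.leviForm_of_mem h1 h2
  have e2 : (fun y => θ'.leviForm y (Y y) (θ'.phiF Z y)) =ᶠ[𝓝 x]
      fun y => Real.exp (2 * f y) * θ.leviForm y (Y y) (θ.phiF Z y) := by
    filter_upwards [hY', hZ'] with y h1 h2
    rw [hc.leviForm_of_mem h1 (θ'.phi_mem _), θ'.phi_of_mem h2, ← θ.phi_of_mem h2]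
  have hv := hV'.self_of_nhds
  have hy := hY'.self_of_nhds
  have hz := hZ'.self_of_nhds
  have hmix : ∀ A B : VecField m M, θ'.mixedBr A B x ∈ S.H x := fun A B =>
    (S.H x).add_mem (θ'.hproj_mem _) (θ'.phi_mem _)
  simp only [koszul]
  rw [dirDeriv_congr e1, dirDeriv_congr e2, dirDeriv_mul hE.diff (θ.diff_leviForm hY hZ),
    dirDeriv_mul hE.diff (θ.diff_leviForm hY (θ.diff_phi hZ)), hc.leviForm_of_mem (hmix V Y) hz,
    hc.leviForm_of_mem hy (hmix V Z), hc.mixedBr_eq hS hV hY hV' hY', hc.mixedBr_eq hS hV hZ hV' hZ',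
    θ'.hproj_of_mem hv, θ.hproj_of_mem hv, θ'.phi_of_mem hv, θ.phi_of_mem hv, θ.vanish x _ hv,
    θ'.vanish x _ hv, dirDeriv_exp_mul hf.diff, dirDeriv_exp_mul hf.diff]
  simp only [map_sub, map_smul, LinearMap.sub_apply, LinearMap.smul_apply, smul_eq_mul]
  ring

end IsConformal
end PseudoHermitian
end AlmostCRStructure

/-! ### Conformal change of the Tanaka-Webster connection -/

namespace AlmostCRStructure
namespace PseudoHermitian
namespace IsConformal
variable {S : AlmostCRStructure m M} {θ θ' : S.PseudoHermitian} {x₀ x y : M} {V Y Z W : VecField m M}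
  {U : Set M} {f : M → ℝ} (hc : θ.IsConformal θ' f) (hS : S.IsPartiallyIntegrable)

include hc hS

/-- The change of the Tanaka-Webster connection in horizontal directions. -/
theorem tanakaWebster_eq (hU : IsOpen U) (hY : S.IsSection U Y) (hx : x ∈ U) {v : Tgt m x}
    (hv : v ∈ S.H x) :
    θ'.tanakaWebster Y x v = θ.tanakaWebster Y x v + (θ.leviForm x (θ.grad f x) v • Y x -
      θ.leviForm x (θ.grad f x) (θ.phi x v) • θ.phi x (Y x) +
      θ.leviForm x (θ.grad f x) (Y x) • v -
      θ.leviForm x (θ.grad f x) (θ.phi x (Y x)) • θ.phi x v -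
      θ.leviForm x v (Y x) • θ.grad f x +
      θ.leviForm x v (θ.phi x (Y x)) • θ.phi x (θ.grad f x)) := by
  obtain ⟨hU', hx', -, -⟩ := S.frame_spec x
  have hD := θ.isTanakaWebster hS
  have hD' := θ'.isTanakaWebster hS
  have hUU := hU.inter hU'
  have hxx : x ∈ U ∩ S.frameDomain x := ⟨hx, hx'⟩
  have hYY := hY.mono (Set.inter_subset_left (t := S.frameDomain x))
  obtain ⟨V, hV, rfl⟩ := S.exists_section x hx' hv
  have hVV := hV.mono (Set.inter_subset_right (s := U))
  have hy := hY.mem x hx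
  have hg := θ.grad_mem f x
  refine θ.eq_of_leviForm (hD'.mem U Y hU hY x hx _) ?_ fun z hz => ?_
  · refine (S.H x).add_mem (hD.mem U Y hU hY x hx _) ?_
    exact (S.H x).add_mem ((S.H x).sub_mem ((S.H x).sub_mem ((S.H x).add_mem ((S.H x).sub_mem
      ((S.H x).smul_mem _ hy) ((S.H x).smul_mem _ (θ.phi_mem _))) ((S.H x).smul_mem _ hv))
      ((S.H x).smul_mem _ (θ.phi_mem _))) ((S.H x).smul_mem _ hg)) ((S.H x).smul_mem _ (θ.phi_mem _))
  · obtain ⟨Z, hZ, rfl⟩ := S.exists_section x hx' hz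
    have hZZ := hZ.mono (Set.inter_subset_right (s := U))
    have k := hc.koszul_eq hS (hV.smoothField hU' hx').diff (hY.smoothField hU hx).diff
      (hZ.smoothField hU' hx').diff (hV.eventually_mem hU' hx') (hY.eventually_mem hU hx)
      (hZ.eventually_mem hU' hx')
    rw [← hD.leviForm_eq_koszul hS hUU hVV hYY hZZ hxx, ← hD'.leviForm_eq_koszul hS hUU hVV hYY hZZ hxx,
      hc.leviForm_of_mem (hD'.mem U Y hU hY x hx _) hz] at k
    have k' := mul_left_cancel₀ (Real.exp_pos _).ne' k
    rw [k', ← θ.leviForm_grad f hv, ← θ.leviForm_grad f (θ.phi_mem (V x))]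
    simp only [map_add, map_sub, map_smul, LinearMap.add_apply, LinearMap.sub_apply,
      LinearMap.smul_apply, smul_eq_mul, θ.leviForm_phi_left hS, leviForm_phi_right]
    rw [θ.leviForm_symm hS (Y x) (θ.grad f x), θ.dform_swap (Y x) (θ.grad f x)]
    ring

/-- The change of the Tanaka-Webster connection in the direction of the new Reeb field. -/
theorem tanakaWebster_reeb (hU : IsOpen U) (hY : S.IsSection U Y) (hx : x ∈ U) :
    θ'.tanakaWebster Y x (θ.reeb x + θ.twist f x) = θ.tanakaWebster Y x (θ.reeb x + θ.twist f x) +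
      (-(1 / 2 : ℝ) • (θ.tanakaWebster (θ.twist f) x (Y x) -
        θ.phi x (θ.tanakaWebster (θ.twist f) x (θ.phi x (Y x)))) +
      θ.leviForm x (θ.grad f x) (Y x) • θ.twist f x -
      θ.leviForm x (θ.grad f x) (θ.phi x (Y x)) • θ.phi x (θ.twist f x)) := by
  have hD := θ.isTanakaWebster hS
  have hD' := θ'.isTanakaWebster hS
  have hf : SmoothFun (m := m) f x := hc.smooth x
  have hE : Real.exp (2 * f x) * Real.exp (-2 * f x) = 1 := by rw [← Real.exp_add]; simp
  have hy := hY.mem x hx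
  have sY := hY.smoothField hU hx
  have pY := θ.isSection_phi hU hY
  have eY := hY.eventually_mem hU hx
  have hW : S.IsSection U (θ.twist f) := θ.isSection_twist fun y _ => hc.smooth y
  have e : ∀ {A : VecField m M}, ∀ᶠ y in 𝓝 x, A y = A y := Filter.Eventually.of_forall fun _ => rfl
  have hN : DiffField (fun y => θ.reeb y + θ.twist f y) x :=
    (θ.smooth_reeb x).diff.add (θ.smooth_twist hf).diff
  have hbr : ∀ A : VecField m M, A x ∈ S.H x → lieBr θ'.reeb A x = Real.exp (-2 * f x) •
      ((2 * θ.leviForm x (θ.grad f x) (A x)) • (θ.reeb x + θ.twist f x) + lieBr θ.reeb A x +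
        lieBr (θ.twist f) A x) := by
    intro A hA
    rw [lieBr_congr (Filter.Eventually.of_forall fun y => hc.reeb_eq hS y) (e (A := A)),
      lieBr_smul_left (SmoothFun.exp_mul hf (-2)).diff hN, dirDeriv_exp_mul hf.diff,
      lieBr_add_left (θ.smooth_reeb x).diff (θ.smooth_twist hf).diff, θ.leviForm_grad f hA]
    module
  have b1 := congrArg (θ.hproj x) (hbr Y hy)
  have b2 := congrArg (θ.phi x) (hbr (θ.phiF Y) (θ.phi_mem _))
  have hR := hD'.apply_reeb hU hY hx
  have eφ : ∀ᶠ y in 𝓝 x, θ'.phiF Y y = θ.phiF Y y := by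
    filter_upwards [eY] with y h1
    exact (θ'.phi_of_mem h1).trans (θ.phi_of_mem h1).symm
  rw [θ'.reebBr_section sY.diff eY, lieBr_congr (e (A := θ'.reeb)) eφ,
    θ'.phi_of_mem (θ'.lieBr_reeb_mem (pY.smoothField hU hx).diff (pY.eventually_mem hU hx)),
    ← θ.phi_of_mem (θ'.lieBr_reeb_mem (pY.smoothField hU hx).diff (pY.eventually_mem hU hx)), b2,
    ← θ.hproj_of_mem (θ'.lieBr_reeb_mem sY.diff eY), b1, hc.reeb_eq hS] at hR
  -- Multiplying by e^{2f} replaces T' by T + W, so that ∇' along T + W is expressed by brackets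
  -- with T and with W.
  have hR' := congrArg (fun u => Real.exp (2 * f x) • u) hR
  have hT := hD.apply_reeb hU hY hx
  rw [θ.reebBr_section sY.diff eY, ← θ.hproj_of_mem (θ.lieBr_reeb_mem sY.diff eY)] at hT
  have t1 := congrArg (θ.hproj x) (hD.torsion U _ _ hU hW hY x hx)
  have t2 := congrArg (θ.phi x) (hD.torsion U _ _ hU hW pY x hx)
  obtain ⟨-, -, n⟩ := θ.nijenhuis_phi hS (hW.smoothField hU hx).diff sY.diff
    (hW.eventually_mem hU hx) eY
  have nm := (θ.nijenhuis_section hS (hW.smoothField hU hx).diff sY.diff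
    (hW.eventually_mem hU hx) eY).1
  rw [hD.phi_comm hU hY hx] at t2
  have mY := fun v => θ.hproj_of_mem (hD.mem U Y hU hY x hx v)
  have mW := fun v => θ.hproj_of_mem (hD.mem U _ hU hW x hx v)
  have mt := θ.hproj_of_mem (θ.twist_mem f x)
  simp only [map_sub, map_add, map_smul, phi_phi, n, mY, mW, hproj_reeb, phi_reeb,
    smul_zero, zero_sub, zero_add, θ.hproj_of_mem nm, mt, smul_smul] at t1 t2 hR' hT ⊢
  have hE2 : Real.exp (2 * f x) * (1 / 2) * Real.exp (-2 * f x) = 1 / 2 := by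
    linear_combination (1 / 2) * hE
  simp only [smul_sub, smul_smul, hE, hE2, one_smul] at hR'
  -- The brackets with T are those of `hT`. The brackets of W with Y and φY are replaced through the
  -- torsion of ∇, and the two Nijenhuis terms cancel by `n`.
  linear_combination (norm := module) hR' - hT - (1 / 2 : ℝ) • t1 + (1 / 2 : ℝ) • t2

end IsConformal
end PseudoHermitian
end AlmostCRStructure

/-! ### Conformal change of the gauge form -/

namespace AlmostCRStructure
namespace PseudoHermitian
variable {S : AlmostCRStructure m M} (θ θ' : S.PseudoHermitian) {x₀ x y : M} {V Y Z W : VecField m M}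
  {U : Set M} {f : M → ℝ}

/-- This exhibits γ as half of the real trace of Jω, so its conformal change is a basis-free trace.
-/
theorem two_mul_gaugeCLM (hS : S.IsPartiallyIntegrable) (hy : y ∈ S.frameDomain x₀) (v : Tgt m y) :
    2 * θ.gaugeCLM x₀ y v =
      ∑ j, S.realCoeff x₀ j y (S.J y (θ.tanakaWebster (S.realFrame x₀ j) y v)) := by
  have hm := fun j => (θ.isTanakaWebster hS).mem _ _ (S.frame_spec x₀).1 (isSection_realFrame j) y hy v
  have h1 : ∀ α, S.realCoeff x₀ (Sum.inl α) y
      (S.J y (θ.tanakaWebster (S.realFrame x₀ (Sum.inl α)) y v)) =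
      - θ.connForm x₀ (Sum.inr α) (Sum.inl α) y v := fun α => S.coeffRe_J x₀ (hm (Sum.inl α)) α
  have h2 : ∀ α, S.realCoeff x₀ (Sum.inr α) y
      (S.J y (θ.tanakaWebster (S.realFrame x₀ (Sum.inr α)) y v)) =
      - θ.connForm x₀ (Sum.inr α) (Sum.inl α) y v := fun α =>
    (S.coeffIm_J x₀ (hm (Sum.inr α)) α).trans
      (DFunLike.congr_fun (θ.connForm_inr hS hy α α).1 v)
  rw [Fintype.sum_sum_type, gaugeCLM_apply]
  simp only [h1, h2, Finset.sum_neg_distrib]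
  ring

theorem two_mul_gaugeCLM_sub (hS : S.IsPartiallyIntegrable) (hy : y ∈ S.frameDomain x₀) (v : Tgt m y)
    (A : Tgt m y →ₗ[ℝ] Tgt m y) (hA : ∀ u, A u ∈ S.H y)
    (h : ∀ j, S.J y (θ'.tanakaWebster (S.realFrame x₀ j) y v) =
      S.J y (θ.tanakaWebster (S.realFrame x₀ j) y v) + A (S.realFrame x₀ j y)) :
    2 * (θ'.gaugeCLM x₀ y v - θ.gaugeCLM x₀ y v) = LinearMap.trace ℝ _ A := by
  rw [mul_sub, θ'.two_mul_gaugeCLM hS hy, θ.two_mul_gaugeCLM hS hy, S.trace_eq_sum_frame hy A hA,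
    ← Finset.sum_sub_distrib]
  refine Finset.sum_congr rfl fun j _ => ?_
  rw [h, map_add, add_sub_cancel_left]

/-- The horizontal derivative of the field `-2 J grad f`. -/
def twistDeriv (f : M → ℝ) (x : M) : Tgt m x →ₗ[ℝ] Tgt m x :=
  (θ.tanakaWebster (θ.twist f) x).toLinearMap ∘ₗ θ.hproj x

theorem twistDeriv_apply (v : Tgt m x) :
    θ.twistDeriv f x v = θ.tanakaWebster (θ.twist f) x (θ.hproj x v) := rfl

theorem twistDeriv_mem (hS : S.IsPartiallyIntegrable)
    (hf : ContMDiff (𝓡 (2 * m + 1)) 𝓘(ℝ, ℝ) ∞ f) (v : Tgt m x) : θ.twistDeriv f x v ∈ S.H x :=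
  (θ.isTanakaWebster hS).mem Set.univ _ isOpen_univ (θ.isSection_twist fun y _ => hf y) x trivial _

/-- The form `L_θ(-2 J grad f, ·)`. -/
def twistForm (f : M → ℝ) (x : M) : Tgt m x →L[ℝ] ℝ :=
  LinearMap.toContinuousLinearMap (θ.leviForm x (θ.twist f x))

theorem twistForm_apply (v : Tgt m x) : θ.twistForm f x v = θ.leviForm x (θ.twist f x) v := rfl

theorem smooth_twistForm (hf : SmoothFun (m := m) f x) : SmoothForm (θ.twistForm f) x :=
  fun _ hX => θ.smooth_leviForm (θ.smooth_twist hf) hX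

/-- The exterior derivative is rewritten with ∇ by metricity. The torsion of (X, φX) does not
contribute: its Reeb part lies in the kernel of L_θ and its Nijenhuis part vanishes. -/
theorem extD_twistForm (hS : S.IsPartiallyIntegrable)
    (hf : ContMDiff (𝓡 (2 * m + 1)) 𝓘(ℝ, ℝ) ∞ f) {v : Tgt m x} (hv : v ∈ S.H x) :
    extD (θ.twistForm f) x v (θ.phi x v) =
      - (θ.leviForm x (θ.phi x (θ.twistDeriv f x v)) v +
        θ.leviForm x (θ.phi x (θ.twistDeriv f x (θ.phi x v))) (θ.phi x v)) := by
  have hD := θ.isTanakaWebster hS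
  obtain ⟨hU, hx, -, -⟩ := S.frame_spec x
  obtain ⟨X, hX, rfl⟩ := S.exists_section x hx hv
  have sX := hX.smoothField hU hx
  have eX := hX.eventually_mem hU hx
  have pX := θ.isSection_phi hU hX
  have hW : S.IsSection (S.frameDomain x) (θ.twist f) := θ.isSection_twist fun y _ => hf y
  have h1 := extD_eq (θ.smooth_twistForm (hf x)).diffForm sX.diff (pX.smoothField hU hx).diff
  have m1 : dirDeriv (fun y => θ.leviForm y (θ.twist f y) (θ.phiF X y)) x (X x) =
      θ.leviForm x (θ.tanakaWebster (θ.twist f) x (X x)) (θ.phi x (X x)) +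
      θ.leviForm x (θ.twist f x) (θ.tanakaWebster (θ.phiF X) x (X x)) :=
    hD.metric _ _ _ hU hW pX x hx _
  have m2 : dirDeriv (fun y => θ.leviForm y (θ.twist f y) (X y)) x (θ.phi x (X x)) =
      θ.leviForm x (θ.tanakaWebster (θ.twist f) x (θ.phi x (X x))) (X x) +
      θ.leviForm x (θ.twist f x) (θ.tanakaWebster X x (θ.phi x (X x))) :=
    hD.metric _ _ _ hU hW hX x hx _
  have t := congrArg (θ.leviForm x (θ.twist f x)) (hD.torsion _ _ _ hU hX pX x hx)
  obtain ⟨-, -, n⟩ := θ.nijenhuis_phi hS sX.diff sX.diff eX eX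
  have n0 : S.nijenhuis X X x = 0 := by
    have q : ∀ A : VecField m M, lieBr A A x = 0 := fun A => by
      have h : lieBr A A x = - lieBr A A x := lieBr_swap
      have h2 : (2 : ℝ) • lieBr A A x = 0 := by linear_combination (norm := module) h
      exact (smul_eq_zero.1 h2).resolve_left two_ne_zero
    rw [(θ.nijenhuis_section hS sX.diff sX.diff eX eX).2, q, q, lieBr_swap (X := X) (Y := θ.phiF X)]
    simp
  -- Antilinearity reduces N(X, φX) to N(X, X), which is zero.
  have n1 : θ.leviForm x (θ.twist f x) (S.nijenhuis X (θ.phiF X) x) = 0 := by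
    rw [← θ.leviForm_phi_phi hS, n, n0, map_zero]
  simp only [map_sub, map_smul, n1, leviForm_reeb_right, smul_zero, sub_zero] at t
  have hh : θ.hproj x (X x) = X x := θ.hproj_of_mem (hX.mem x hx)
  simp only [twistForm_apply] at h1
  rw [h1, m1, m2]
  simp only [twistDeriv_apply, hh, hproj_phi, θ.leviForm_phi_phi hS]
  rw [← sub_eq_zero] at t ⊢
  rw [θ.leviForm_phi_left hS, PseudoHermitian.leviForm_eq, phi_phi, map_neg, hh]
  linarith

theorem sum_extD_twistForm (hS : S.IsPartiallyIntegrable)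
    (hf : ContMDiff (𝓡 (2 * m + 1)) 𝓘(ℝ, ℝ) ∞ f) {e : Fin m → Tgt m x}
    (he : θ.IsUnitaryFamily x e) :
    ∑ α, extD (θ.twistForm f) x (e α) (θ.phi x (e α)) =
      - LinearMap.trace ℝ _ (θ.phi x ∘ₗ θ.twistDeriv f x) := by
  rw [he.trace_eq hS (θ.phi x ∘ₗ θ.twistDeriv f x) fun u => θ.phi_mem _, ← Finset.sum_neg_distrib]
  exact Finset.sum_congr rfl fun α _ => θ.extD_twistForm hS hf (he.mem α)

namespace IsConformal
variable {θ θ'} (hc : θ.IsConformal θ' f) (hS : S.IsPartiallyIntegrable)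

include hc hS

/-- Here A is J composed with the difference of the connections, as an endomorphism in the
differentiated vector. In its trace h contributes 2m, each of the four rank one terms contributes 1,
and φ contributes 0; half of 2m + 4 is m + 2. -/
theorem gaugeCLM_sub_of_mem (hy : y ∈ S.frameDomain x₀) {v : Tgt m y} (hv : v ∈ S.H y) :
    θ'.gaugeCLM x₀ y v - θ.gaugeCLM x₀ y v =
      (m + 2) * θ.leviForm y (θ.grad f y) (θ.phi y v) := by
  have hU := (S.frame_spec x₀).1
  have hD := θ.isTanakaWebster hS
  have hg := θ.grad_mem f y
  let A : Tgt m y →ₗ[ℝ] Tgt m y := θ.leviForm y (θ.grad f y) v • θ.phi y +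
    θ.leviForm y (θ.grad f y) (θ.phi y v) • θ.hproj y +
    (θ.leviForm y (θ.grad f y)).smulRight (θ.phi y v) +
    (θ.leviForm y (θ.grad f y) ∘ₗ θ.phi y).smulRight v -
    (θ.leviForm y v).smulRight (θ.phi y (θ.grad f y)) -
    (θ.leviForm y v ∘ₗ θ.phi y).smulRight (θ.grad f y)
  have hA : ∀ u, A u = θ.leviForm y (θ.grad f y) v • θ.phi y u +
      θ.leviForm y (θ.grad f y) (θ.phi y v) • θ.hproj y u +
      θ.leviForm y (θ.grad f y) u • θ.phi y v +
      θ.leviForm y (θ.grad f y) (θ.phi y u) • v -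
      θ.leviForm y v u • θ.phi y (θ.grad f y) -
      θ.leviForm y v (θ.phi y u) • θ.grad f y := fun u => rfl
  have h := θ.two_mul_gaugeCLM_sub θ' hS hy v A (fun u => ?_) fun j => ?_
  · have e1 : θ.leviForm y v (θ.phi y (θ.grad f y)) =
        - θ.leviForm y (θ.grad f y) (θ.phi y v) := by
      rw [leviForm_phi_right, leviForm_phi_right, dform_swap]
    have e2 : LinearMap.trace ℝ _ A = (2 * m + 4) * θ.leviForm y (θ.grad f y) (θ.phi y v) := by
      simp only [A, map_add, map_sub, map_smul, LinearMap.trace_smulRight, trace_phi, trace_hproj,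
        LinearMap.comp_apply, e1, smul_eq_mul]
      ring
    rw [e2] at h
    linarith
  · rw [hA]
    exact (S.H y).sub_mem ((S.H y).sub_mem ((S.H y).add_mem ((S.H y).add_mem ((S.H y).add_mem
      ((S.H y).smul_mem _ (θ.phi_mem _)) ((S.H y).smul_mem _ (θ.hproj_mem _)))
      ((S.H y).smul_mem _ (θ.phi_mem _))) ((S.H y).smul_mem _ hv))
      ((S.H y).smul_mem _ (θ.phi_mem _))) ((S.H y).smul_mem _ hg)
  · have hb := S.realFrame_mem hy j
    rw [hA, hc.tanakaWebster_eq hS hU (isSection_realFrame j) hy hv, map_add]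
    congr 1
    have hm : θ.leviForm y (θ.grad f y) v • S.realFrame x₀ j y -
      θ.leviForm y (θ.grad f y) (θ.phi y v) • θ.phi y (S.realFrame x₀ j y) +
      θ.leviForm y (θ.grad f y) (S.realFrame x₀ j y) • v -
      θ.leviForm y (θ.grad f y) (θ.phi y (S.realFrame x₀ j y)) • θ.phi y v -
      θ.leviForm y v (S.realFrame x₀ j y) • θ.grad f y +
      θ.leviForm y v (θ.phi y (S.realFrame x₀ j y)) • θ.phi y (θ.grad f y) ∈ S.H y :=
      (S.H y).add_mem ((S.H y).sub_mem ((S.H y).sub_mem ((S.H y).add_mem ((S.H y).sub_mem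
      ((S.H y).smul_mem _ hb) ((S.H y).smul_mem _ (θ.phi_mem _))) ((S.H y).smul_mem _ hv))
      ((S.H y).smul_mem _ (θ.phi_mem _))) ((S.H y).smul_mem _ hg)) ((S.H y).smul_mem _ (θ.phi_mem _))
    rw [← θ.phi_of_mem hm]
    simp only [map_add, map_sub, map_smul, phi_phi, θ.hproj_of_mem hv, θ.hproj_of_mem hg]
    module

theorem gaugeCLM_sub_reeb (hy : y ∈ S.frameDomain x₀) :
    2 * (θ'.gaugeCLM x₀ y (θ.reeb y + θ.twist f y) - θ.gaugeCLM x₀ y (θ.reeb y + θ.twist f y)) =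
      - LinearMap.trace ℝ _ (θ.phi y ∘ₗ θ.twistDeriv f y) +
        4 * θ.leviForm y (θ.grad f y) (θ.grad f y) := by
  have hU := (S.frame_spec x₀).1
  have hW := θ.twist_mem f y
  have hdW := fun v => θ.twistDeriv_mem (x := y) hS hc.smooth v
  let A : Tgt m y →ₗ[ℝ] Tgt m y := -(1 / 2 : ℝ) • (θ.phi y ∘ₗ θ.twistDeriv f y +
      θ.twistDeriv f y ∘ₗ θ.phi y) +
    (θ.leviForm y (θ.grad f y)).smulRight (θ.phi y (θ.twist f y)) +
    (θ.leviForm y (θ.grad f y) ∘ₗ θ.phi y).smulRight (θ.twist f y)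
  have hA : ∀ u, A u = -(1 / 2 : ℝ) • (θ.phi y (θ.twistDeriv f y u) +
      θ.twistDeriv f y (θ.phi y u)) + θ.leviForm y (θ.grad f y) u • θ.phi y (θ.twist f y) +
      θ.leviForm y (θ.grad f y) (θ.phi y u) • θ.twist f y := fun u => rfl
  have h := θ.two_mul_gaugeCLM_sub θ' hS hy (θ.reeb y + θ.twist f y) A (fun u => ?_) fun j => ?_
  · have e2 : LinearMap.trace ℝ _ A = - LinearMap.trace ℝ _ (θ.phi y ∘ₗ θ.twistDeriv f y) +
        4 * θ.leviForm y (θ.grad f y) (θ.grad f y) := by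
      simp only [A, map_add, map_smul, LinearMap.trace_smulRight, LinearMap.comp_apply, phi_twist,
        smul_eq_mul]
      rw [show LinearMap.trace ℝ _ (θ.twistDeriv f y ∘ₗ θ.phi y) =
        LinearMap.trace ℝ _ (θ.phi y ∘ₗ θ.twistDeriv f y) from LinearMap.trace_mul_comm ℝ _ _]
      ring
    rw [h, e2]
  · rw [hA]
    exact (S.H y).add_mem ((S.H y).add_mem ((S.H y).smul_mem _ ((S.H y).add_mem (θ.phi_mem _)
      (hdW _))) ((S.H y).smul_mem _ (θ.phi_mem _))) ((S.H y).smul_mem _ hW)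
  · have hb := S.realFrame_mem hy j
    have hd1 := hdW (S.realFrame x₀ j y)
    rw [hA, hc.tanakaWebster_reeb hS hU (isSection_realFrame j) hy, map_add]
    congr 1
    have e1 : θ.tanakaWebster (θ.twist f) y (S.realFrame x₀ j y) =
        θ.twistDeriv f y (S.realFrame x₀ j y) := by rw [twistDeriv_apply, θ.hproj_of_mem hb]
    have e2 : θ.tanakaWebster (θ.twist f) y (θ.phi y (S.realFrame x₀ j y)) =
        θ.twistDeriv f y (θ.phi y (S.realFrame x₀ j y)) := by rw [twistDeriv_apply, hproj_phi]
    rw [e1, e2, ← θ.phi_of_mem ((S.H y).sub_mem ((S.H y).add_mem ((S.H y).smul_mem _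
      ((S.H y).sub_mem hd1 (θ.phi_mem _))) ((S.H y).smul_mem _ hW)) ((S.H y).smul_mem _ (θ.phi_mem _)))]
    simp only [map_add, map_sub, map_smul, phi_phi, θ.hproj_of_mem hW, θ.hproj_of_mem (hdW _)]
    module

/-- The change of the gauge form. -/
theorem gaugeCLM_eq (hy : y ∈ S.frameDomain x₀) :
    θ'.gaugeCLM x₀ y = θ.gaugeCLM x₀ y + ((m + 2) / 2 : ℝ) • θ.twistForm f y +
      (θ'.gaugeCLM x₀ y (θ.reeb y) - θ.gaugeCLM x₀ y (θ.reeb y)) • θ.form y := by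
  ext v
  have h := hc.gaugeCLM_sub_of_mem hS hy (θ.hproj_mem v)
  simp only [add_apply, smul_apply, smul_eq_mul, twistForm_apply, θ.leviForm_twist_left hS]
  rw [phi_hproj] at h
  have e1 := congrArg (θ'.gaugeCLM x₀ y) (θ.eq_hproj_add v)
  have e2 := congrArg (θ.gaugeCLM x₀ y) (θ.eq_hproj_add v)
  rw [map_add, map_smul, smul_eq_mul] at e1 e2
  linear_combination h + e1 - e2

/-- The change along T + W contributes 2|g|² besides the trace; removing the horizontal change along
W, which is 2(m+2)|g|², leaves -2(m+1)|g|². -/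
theorem gaugeCLM_sub_reeb_eq (hy : y ∈ S.frameDomain x₀) :
    θ'.gaugeCLM x₀ y (θ.reeb y) - θ.gaugeCLM x₀ y (θ.reeb y) =
      - (1 / 2) * LinearMap.trace ℝ _ (θ.phi y ∘ₗ θ.twistDeriv f y) -
        2 * (m + 1) * θ.leviForm y (θ.grad f y) (θ.grad f y) := by
  have h1 := hc.gaugeCLM_sub_reeb hS hy
  have h2 := hc.gaugeCLM_sub_of_mem hS hy (θ.twist_mem f y)
  rw [phi_twist, map_smul, smul_eq_mul] at h2
  rw [map_add, map_add] at h1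
  linear_combination (1 / 2) * h1 - h2

end IsConformal
end PseudoHermitian
end AlmostCRStructure

/-! ### Conformal change of the scalar curvature and of the Weyl connection -/

namespace AlmostCRStructure
namespace PseudoHermitian
variable {S : AlmostCRStructure m M} (θ θ' : S.PseudoHermitian) {x₀ x y : M} {f : M → ℝ}

/-- Traces with respect to the Levi form do not depend on the unitary basis. -/
theorem sum_bilin_eq (hS : S.IsPartiallyIntegrable) {e e' : Fin m → Tgt m x}
    (he : θ.IsUnitaryFamily x e) (he' : θ.IsUnitaryFamily x e')
    (B : Tgt m x →ₗ[ℝ] Tgt m x →ₗ[ℝ] ℝ) :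
    ∑ α, (B (e α) (e α) + B (θ.phi x (e α)) (θ.phi x (e α))) =
      ∑ α, (B (e' α) (e' α) + B (θ.phi x (e' α)) (θ.phi x (e' α))) := by
  obtain ⟨A, hA⟩ := exists_linearMap_forall_eq (S.H x) (θ.leviForm x) B
    (fun v hv h => θ.eq_zero_of_leviForm hv h)
  have h1 := he.trace_eq hS A fun v => (hA v).1
  have h2 := he'.trace_eq hS A fun v => (hA v).1
  rw [h1] at h2
  refine Eq.trans ?_ (h2.trans ?_)
  · exact Finset.sum_congr rfl fun α _ => by
      rw [(hA _).2 _ (he.mem α), (hA _).2 _ (θ.phi_mem _)]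
  · exact Finset.sum_congr rfl fun α _ => by
      rw [(hA _).2 _ (he'.mem α), (hA _).2 _ (θ.phi_mem _)]

/-- Twice the sum is the full Levi trace of the bilinear form dη(·, φ·), because φ² = -1 on H and dη
is antisymmetric. -/
theorem sum_extD_eq (hS : S.IsPartiallyIntegrable) {e e' : Fin m → Tgt m x}
    (he : θ.IsUnitaryFamily x e) (he' : θ.IsUnitaryFamily x e')
    {η : ∀ y : M, Tgt m y →L[ℝ] ℝ} (hη : DiffForm η x) :
    ∑ α, extD η x (e α) (θ.phi x (e α)) = ∑ α, extD η x (e' α) (θ.phi x (e' α)) := by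
  have h := θ.sum_bilin_eq hS he he' ((extDBilin η hη).compl₂ (θ.phi x))
  have key : ∀ v ∈ S.H x, (extDBilin η hη).compl₂ (θ.phi x) v v +
      (extDBilin η hη).compl₂ (θ.phi x) (θ.phi x v) (θ.phi x v) = 2 * extD η x v (θ.phi x v) := by
    intro v hv
    rw [LinearMap.compl₂_apply, LinearMap.compl₂_apply, phi_phi, θ.hproj_of_mem hv, map_neg]
    have h1 : extDBilin η hη v (θ.phi x v) = extD η x v (θ.phi x v) := rfl
    have h2 : extDBilin η hη (θ.phi x v) v = extD η x (θ.phi x v) v := rfl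
    rw [h1, h2, extD_swap η (θ.phi x v)]
    ring
  simp only [key _ (he.mem _), key _ (he'.mem _), ← Finset.mul_sum] at h
  linarith

theorem scal_eq_sum (hS : S.IsPartiallyIntegrable) {e : Fin m → Tgt m x}
    (he : θ.IsUnitaryFamily x e) :
    θ.scal x = ∑ α, extD (θ.gaugeCLM x) x (e α) (θ.phi x (e α)) := by
  rw [θ.scal_eq hS, θ.sum_extD_eq hS (θ.isUnitaryFamily_unitaryBasis hS x) he
    (θ.smooth_gaugeCLM hS (S.frame_spec x).2.1).diffForm]

namespace IsConformal
variable {θ θ'} (hc : θ.IsConformal θ' f) (hS : S.IsPartiallyIntegrable)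

include hc

theorem isUnitaryFamily {e : Fin m → Tgt m x} (he : θ.IsUnitaryFamily x e) :
    θ'.IsUnitaryFamily x fun α => Real.exp (-f x) • e α := by
  have hE : Real.exp (-f x) * Real.exp (-f x) * Real.exp (2 * f x) = 1 := by
    rw [← Real.exp_add, ← Real.exp_add]
    simp [two_mul]
  refine ⟨fun α => (S.H x).smul_mem _ (he.mem α), fun α β => ?_, fun α β => ?_⟩
  · rw [map_smul, map_smul, LinearMap.smul_apply, hc.leviForm_of_mem (he.mem α) (he.mem β),
      he.levi_self]
    simp only [smul_eq_mul]
    rw [← mul_assoc, ← mul_assoc, hE, one_mul]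
  · have h := he.levi_phi α β
    rw [map_smul, map_smul, map_smul, LinearMap.smul_apply, θ'.phi_of_mem (he.mem β),
      ← θ.phi_of_mem (he.mem β), hc.leviForm_of_mem (he.mem α) (θ.phi_mem _), h]
    simp

include hS

/-- The change of the Webster scalar curvature. -/
theorem scal_eq (x : M) : Real.exp (2 * f x) * θ'.scal x = θ.scal x -
    (m + 2) / 2 * LinearMap.trace ℝ _ (θ.phi x ∘ₗ θ.twistDeriv f x) +
    m * (θ'.gaugeCLM x x (θ.reeb x) - θ.gaugeCLM x x (θ.reeb x)) := by
  obtain ⟨hU, hx, -, -⟩ := S.frame_spec x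
  have he := θ.isUnitaryFamily_unitaryBasis hS x
  set e := θ.unitaryBasis x
  have hE : Real.exp (2 * f x) * (Real.exp (-f x) * Real.exp (-f x)) = 1 := by
    rw [← Real.exp_add, ← Real.exp_add]
    simp [two_mul]
  have g := (θ.smooth_gaugeCLM hS hx).diffForm
  have g' := (θ'.smooth_gaugeCLM hS hx).diffForm
  have hw := (θ.smooth_twistForm (hc.smooth x)).diffForm
  -- In the exterior derivative of cθ, the derivatives of c drop out on H, where θ vanishes. Hence c
  -- need only be differentiable.
  let c : M → ℝ := fun y => θ'.gaugeCLM x y (θ.reeb y) - θ.gaugeCLM x y (θ.reeb y)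
  have hcd : DiffFun (m := m) c x :=
    (g' _ (θ.smooth_reeb x).diff).sub (g _ (θ.smooth_reeb x).diff)
  have dk : DiffFun (m := m) (fun _ : M => ((m + 2) / 2 : ℝ)) x := mdifferentiableAt_const
  have fw : DiffForm (fun y => ((m + 2) / 2 : ℝ) • θ.twistForm f y) x := fun X hX => dk.mul (hw X hX)
  have fc : DiffForm (fun y => c y • θ.form y) x := fun X hX => hcd.mul (θ.diffForm x X hX)
  have fgw : DiffForm (fun y => θ.gaugeCLM x y + ((m + 2) / 2 : ℝ) • θ.twistForm f y) x :=
    fun X hX => (g X hX).add (fw X hX)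
  have h1 : ∀ v ∈ S.H x, ∀ w ∈ S.H x, extD (θ'.gaugeCLM x) x v w = extD (θ.gaugeCLM x) x v w +
      (m + 2) / 2 * extD (θ.twistForm f) x v w + c x * θ.dform x v w := by
    intro v hv w hw'
    have ev : ∀ᶠ y in 𝓝 x, θ'.gaugeCLM x y =
        (θ.gaugeCLM x y + ((m + 2) / 2 : ℝ) • θ.twistForm f y) + c y • θ.form y := by
      filter_upwards [hU.mem_nhds hx] with y hy using hc.gaugeCLM_eq hS hy
    rw [extD_congr ev, extD_add_form fgw fc, extD_add_form g fw, extD_smul_form hcd (θ.diffForm x),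
      extD_smul_form dk hw, θ.vanish x v hv, θ.vanish x w hw', dirDeriv_const, dirDeriv_const,
      dform_apply]
    ring
  rw [θ.scal_eq_sum hS he, θ'.scal_eq_sum hS (hc.isUnitaryFamily he)]
  have h2 : ∀ α, extD (θ'.gaugeCLM x) x (Real.exp (-f x) • e α)
      (θ'.phi x (Real.exp (-f x) • e α)) = Real.exp (-f x) * Real.exp (-f x) *
        (extD (θ.gaugeCLM x) x (e α) (θ.phi x (e α)) +
          (m + 2) / 2 * extD (θ.twistForm f) x (e α) (θ.phi x (e α)) + c x) := by
    intro α
    -- Each of the m basis vectors thus contributes c once, which gives the term mc.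
    have h3 : θ.dform x (e α) (θ.phi x (e α)) = 1 := by
      rw [← PseudoHermitian.leviForm_eq, he.levi_self, if_pos rfl]
    have h4 := h1 _ (he.mem α) _ (θ.phi_mem (e α))
    rw [h3, mul_one] at h4
    rw [map_smul, θ'.phi_of_mem (he.mem α), ← θ.phi_of_mem (he.mem α), extD_smul_right g',
      extD_swap, extD_smul_right g', ← h4, extD_swap _ (θ.phi x (e α))]
    ring
  simp only [h2]
  rw [← Finset.mul_sum, ← mul_assoc, hE, one_mul, Finset.sum_add_distrib, Finset.sum_add_distrib,
    ← Finset.mul_sum, θ.sum_extD_twistForm hS hc.smooth he]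
  simp only [Finset.sum_const, Finset.card_univ, Fintype.card_fin, nsmul_eq_mul]
  ring

/-- The trace of φ∇W, the only second order term in f, occurs in the changes of both γ(T) and scal.
Eliminating it fixes the constant 1/(2(m+1)) in A_θ. -/
theorem gaugeCLM_sub_reeb_eq_scal (x : M) :
    θ'.gaugeCLM x x (θ.reeb x) - θ.gaugeCLM x x (θ.reeb x) =
      (Real.exp (2 * f x) * θ'.scal x - θ.scal x) / (2 * (m + 1)) -
        (m + 2) * θ.leviForm x (θ.grad f x) (θ.grad f x) := by
  have h1 := hc.gaugeCLM_sub_reeb_eq hS (S.frame_spec x).2.1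
  have h2 := hc.scal_eq hS x
  have hm : (m + 1 : ℝ) ≠ 0 := by positivity
  field_simp
  linear_combination (m + 2 : ℝ) * h1 - h2

end IsConformal

theorem metricOf_eq (A : ∀ p : S.CanonicalBundle, TgtF S p → ℂ) (p : S.CanonicalBundle)
    (v w : TgtF S p) : θ.metricOf A p v w = θ.leviForm p.proj (dproj p v) (dproj p w) +
      2 / (m + 2) * (θ.form p.proj (dproj p v) * (A p w).im + θ.form p.proj (dproj p w) * (A p v).im) := by
  have h : (-(Complex.I * (4 / (m + 2))) * ((1 / 2) *
      (θ.form p.proj (dproj p v) * A p w + θ.form p.proj (dproj p w) * A p v)) : ℂ) =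
      ((2 / (m + 2) : ℝ) : ℂ) * (-Complex.I * (θ.form p.proj (dproj p v) * A p w +
        θ.form p.proj (dproj p w) * A p v)) := by
    push_cast
    ring
  rw [metricOf, h, Complex.re_ofReal_mul, leviForm_apply]
  simp

theorem im_weylForm (p : S.CanonicalBundle) (v : TgtF S p) :
    (θ.weylForm p v).im = ((S.fibreCoord p.proj p.snd : ℂ)⁻¹ *
      mvfderiv ((𝓡 (2 * m + 1)).prod (𝓡 1))
        (fun q : S.CanonicalBundle => (S.fibreCoord p.proj q.snd : ℂ)) p v).im +
      θ.gaugeCLM p.proj p.proj (dproj p v) -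
      θ.scal p.proj * θ.form p.proj (dproj p v) / (2 * (m + 1)) := by
  have h : Complex.I / (2 * (m + 1)) * θ.scal p.proj * θ.form p.proj (dproj p v) =
      ((θ.scal p.proj * θ.form p.proj (dproj p v) / (2 * (m + 1)) : ℝ) : ℂ) * Complex.I := by
    push_cast
    ring
  rw [weylForm, websterForm, h, θ.gaugeForm_eq (S.frame_spec p.proj).2.1, Complex.sub_im,
    Complex.add_im, mul_comm Complex.I, Complex.im_ofReal_mul, Complex.im_ofReal_mul, Complex.I_im,
    mul_one, mul_one]

end PseudoHermitian
end AlmostCRStructure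

/-! ### Conformal invariance of the Fefferman metrics and their conformal classes -/

namespace AlmostCRStructure

/-- In the charts of the circle bundle the projection is the first factor. This is needed to lift f
to a smooth function on the circle bundle. -/
theorem contMDiff_proj (S : AlmostCRStructure m M) :
    ContMDiff ((𝓡 (2 * m + 1)).prod (𝓡 1)) (𝓡 (2 * m + 1)) ∞ (π Circle S.circleFiber) := by
  intro p
  refine contMDiffAt_iff.2 ⟨(FiberBundle.continuous_proj Circle S.circleFiber).continuousAt, ?_⟩
  have h : ∀ z ∈ (extChartAt ((𝓡 (2 * m + 1)).prod (𝓡 1)) p).target,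
      (extChartAt (𝓡 (2 * m + 1)) p.proj ∘ π Circle S.circleFiber ∘
        (extChartAt ((𝓡 (2 * m + 1)).prod (𝓡 1)) p).symm) z = z.1 := fun z hz =>
    congrArg Prod.fst ((extChartAt ((𝓡 (2 * m + 1)).prod (𝓡 1)) p).right_inv hz)
  refine contDiff_fst.contDiffWithinAt.congr_of_eventuallyEq ?_
    (h _ (mem_extChartAt_target (I := (𝓡 (2 * m + 1)).prod (𝓡 1)) p))
  filter_upwards [extChartAt_target_mem_nhdsWithin (I := (𝓡 (2 * m + 1)).prod (𝓡 1)) p] with z hz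
  exact h z hz

namespace PseudoHermitian
variable {S : AlmostCRStructure m M} {θ θ' : S.PseudoHermitian} {f : M → ℝ}

namespace IsConformal
variable (hc : θ.IsConformal θ' f) (hS : S.IsPartiallyIntegrable)

include hc

theorem symm : θ'.IsConformal θ (fun x => -f x) where
  smooth := hc.smooth.neg
  form_eq x := by
    rw [hc.form_eq, smul_smul, ← Real.exp_add, mul_neg, neg_add_cancel, Real.exp_zero, one_smul]

include hS

/-- The terms of L_θ' that are linear in W cancel against the summand (m+2)/2 · L_θ(W,·) of A', and
the quadratic term L_θ(W,W) = 4|g|² against its summand -(m+2)|g|²θ. -/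
theorem metricOf_eq {A A' : ∀ p : S.CanonicalBundle, TgtF S p → ℂ} (p : S.CanonicalBundle)
    (hA : ∀ u, (A' p u).im = (A p u).im + (m + 2) / 2 * θ.twistForm f p.proj (dproj p u) -
      (m + 2) * θ.leviForm p.proj (θ.grad f p.proj) (θ.grad f p.proj) * θ.form p.proj (dproj p u))
    (v w : TgtF S p) : θ'.metricOf A' p v w = Real.exp (2 * f p.proj) * θ.metricOf A p v w := by
  have hm : (m + 2 : ℝ) ≠ 0 := by positivity
  have hT : θ.leviForm p.proj (θ.twist f p.proj) (θ.twist f p.proj) =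
      4 * θ.leviForm p.proj (θ.grad f p.proj) (θ.grad f p.proj) := by
    rw [θ.leviForm_twist_left hS, phi_twist, map_smul, smul_eq_mul]
    ring
  rw [PseudoHermitian.metricOf_eq, PseudoHermitian.metricOf_eq, hc.leviForm_eq hS, hA, hA,
    hc.hproj_eq hS, hc.hproj_eq hS, hc.form_eq, twistForm_apply, twistForm_apply]
  simp only [map_sub, map_smul, LinearMap.sub_apply, LinearMap.smul_apply, smul_eq_mul,
    smul_apply, leviForm_hproj_left, leviForm_hproj_right, hT,
    θ.leviForm_symm hS (dproj p v) (θ.twist f p.proj)]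
  field_simp
  ring

/-- The fibre term is common to θ and θ'. In the change cθ of the gauge form, the curvature part of
c is exactly the change of the scal-correction, so only -(m+2)|g|²θ remains of it. -/
theorem im_weylForm (p : S.CanonicalBundle) (u : TgtF S p) :
    (θ'.weylForm p u).im = (θ.weylForm p u).im + (m + 2) / 2 * θ.twistForm f p.proj (dproj p u) -
      (m + 2) * θ.leviForm p.proj (θ.grad f p.proj) (θ.grad f p.proj) *
        θ.form p.proj (dproj p u) := by
  have hm : (m + 1 : ℝ) ≠ 0 := by positivity
  rw [PseudoHermitian.im_weylForm, PseudoHermitian.im_weylForm,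
    hc.gaugeCLM_eq hS (S.frame_spec p.proj).2.1, hc.gaugeCLM_sub_reeb_eq_scal hS, hc.form_eq]
  simp only [add_apply, smul_apply, smul_eq_mul]
  field_simp
  ring

theorem feffermanMetric_eq (p : S.CanonicalBundle) (v w : TgtF S p) :
    θ'.feffermanMetric p v w = Real.exp (2 * f p.proj) * θ.feffermanMetric p v w :=
  hc.metricOf_eq hS p (hc.im_weylForm hS p) v w

theorem ellFeffermanMetric_eq (ℓ : ImaginaryOneForm m M) (p : S.CanonicalBundle) (v w : TgtF S p) :
    θ'.ellFeffermanMetric ℓ p v w = Real.exp (2 * f p.proj) * θ.ellFeffermanMetric ℓ p v w := by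
  refine hc.metricOf_eq hS p (fun u => ?_) v w
  rw [Complex.add_im, Complex.add_im, hc.im_weylForm hS]
  ring

end IsConformal

/-- Both forms have kernel H, so θ' = gθ with g = θ'(T). Comparing the two positive Levi forms on a
nonzero vector of H gives g > 0. Such a vector exists because m ≥ 1; for H = 0 positivity is vacuous
and θ' = -θ would be allowed. -/
theorem exists_isConformal (hm : 0 < m) (θ θ' : S.PseudoHermitian) : ∃ f, θ.IsConformal θ' f := by
  let g : M → ℝ := fun x => θ'.form x (θ.reeb x)
  have hg : ∀ x, SmoothFun (m := m) g x := fun x => θ'.smoothForm x _ (θ.smooth_reeb x)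
  have hform : ∀ x, θ'.form x = g x • θ.form x := by
    intro x
    ext v
    conv_lhs => rw [θ.eq_hproj_add v]
    rw [map_add, map_smul, θ'.vanish x _ (θ.hproj_mem v), zero_add, smul_apply, smul_eq_mul,
      smul_eq_mul, mul_comm]
  have hpos : ∀ x, 0 < g x := by
    intro x
    have hx := (S.frame_spec x).2.1
    let v := S.holFrame x ⟨0, hm⟩ x
    have hv : v ∈ S.H x := S.holFrame_mem hx _
    have hv0 : v ≠ 0 :=
      ((S.frame_spec x).2.2.1.linearIndependent hx).ne_zero (some (Sum.inl (⟨0, hm⟩ : Fin m)))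
    have h1 := θ.dform_pos hv hv0
    have h2 := θ'.dform_pos hv hv0
    rw [dform_apply, funext hform, extD_smul_form (hg x).diff (θ.diffForm x),
      θ.vanish x _ hv, θ.vanish x _ (S.J_mem x v hv), ← dform_apply] at h2
    nlinarith
  refine ⟨fun x => Real.log (g x) / 2, ⟨fun x => ?_, fun x => ?_⟩⟩
  · have h1 : SmoothFun (m := m) (fun y => Real.log (g y)) x :=
      (Real.contDiffAt_log.2 (hpos x).ne').contMDiffAt.comp x (hg x)
    exact (contDiff_id.div_const (2 : ℝ)).contMDiff.contMDiffAt.comp x h1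
  · rw [mul_div_cancel₀ _ two_ne_zero, Real.exp_log (hpos x), hform]

end PseudoHermitian

/-- One inclusion suffices, since the relation between θ and θ' is symmetric with f replaced by -f.
-/
theorem conformalClass_subset {S : AlmostCRStructure m M} {f : M → ℝ}
    (hf : ContMDiff (𝓡 (2 * m + 1)) 𝓘(ℝ, ℝ) ∞ f) {g g' : S.TwoTensor}
    (h : ∀ p v w, g' p v w = Real.exp (2 * f p.proj) * g p v w) :
    conformalClass g' ⊆ conformalClass g := by
  rintro k ⟨φ, hφ, hk⟩
  refine ⟨fun p => φ p + f p.proj, hφ.add (hf.comp S.contMDiff_proj), fun p v w => ?_⟩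
  rw [hk, h, ← mul_assoc, ← Real.exp_add, mul_add]

end AlmostCRStructure

end CR
end

theorem mainTheorem8 (m : ℕ) {M : Type*} [TopologicalSpace M]
    [ChartedSpace (EuclideanSpace ℝ (Fin (2 * m + 1))) M] [IsManifold (𝓡 (2 * m + 1)) ∞ M]
    (S : CR.AlmostCRStructure m M) (hS : S.IsPartiallyIntegrable) :
    (∀ (θ θ' : S.PseudoHermitian) (f : M → ℝ), ContMDiff (𝓡 (2 * m + 1)) 𝓘(ℝ, ℝ) ∞ f →
      (∀ x, θ'.form x = Real.exp (2 * f x) • θ.form x) →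
        (∀ (p : S.CanonicalBundle) (v w : S.TgtF p),
          θ'.feffermanMetric p v w = Real.exp (2 * f p.proj) * θ.feffermanMetric p v w) ∧
        (∀ (ℓ : CR.ImaginaryOneForm m M) (p : S.CanonicalBundle) (v w : S.TgtF p),
          θ'.ellFeffermanMetric ℓ p v w =
            Real.exp (2 * f p.proj) * θ.ellFeffermanMetric ℓ p v w)) ∧
    (0 < m → ∀ θ θ' : S.PseudoHermitian,
      CR.AlmostCRStructure.conformalClass θ.feffermanMetric =
          CR.AlmostCRStructure.conformalClass θ'.feffermanMetric ∧
        ∀ ℓ : CR.ImaginaryOneForm m M,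
          CR.AlmostCRStructure.conformalClass (θ.ellFeffermanMetric ℓ) =
            CR.AlmostCRStructure.conformalClass (θ'.ellFeffermanMetric ℓ)) := by
  refine ⟨fun θ θ' f hf hform => ?_, fun hm θ θ' => ?_⟩
  · have hc : θ.IsConformal θ' f := ⟨hf, hform⟩
    exact ⟨hc.feffermanMetric_eq hS, hc.ellFeffermanMetric_eq hS⟩
  · obtain ⟨f, hc⟩ := CR.AlmostCRStructure.PseudoHermitian.exists_isConformal hm θ θ'
    refine ⟨Set.Subset.antisymm ?_ ?_, fun ℓ => Set.Subset.antisymm ?_ ?_⟩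
    · exact CR.AlmostCRStructure.conformalClass_subset hc.symm.smooth (hc.symm.feffermanMetric_eq hS)
    · exact CR.AlmostCRStructure.conformalClass_subset hc.smooth (hc.feffermanMetric_eq hS)
    · exact CR.AlmostCRStructure.conformalClass_subset hc.symm.smooth
        (hc.symm.ellFeffermanMetric_eq hS ℓ)
    · exact CR.AlmostCRStructure.conformalClass_subset hc.smooth (hc.ellFeffermanMetric_eq hS ℓ)
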